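/- **Setting.** Let $\mathcal A$ be a semisimple stable autonomous tensor category over a field $K$. That is: $\mathcal A$ is an abelian $K$-linear symmetric monoidal category with $K$-bilinear product $\diamond$ (often omitted), unit $\mathbf 1$ and symmetry $\gamma$. Every object $A$ has an assigned dual $A^*$ with morphisms $\Lambda_A:\mathbf 1\to A^*A$ and $\lambda_A:AA^*\to\mathbf 1$ satisfying the zig-zag identities. Moreover $A^{**}=A$ and $\gamma_{A^*,A}\circ\Lambda_A=\Lambda_{A^*}$. There is a finite set $\Sigma$ of objects, containing $\mathbf 1$ and closed under $*$, such that every object is isomorphic to a finite direct sum of members of $\Sigma$, and for $a,b\in\Sigma$ the space $F(a,b)=\mathrm{Hom}(a,b)$ is $0$ if $a\ne b$ and is isomorphic to $K$ if $a=b$. We identify $F(\mathbf 1,\mathbf 1)$ with $K$ and suppress associativity and unit isomorphisms. Put $r(A)=\lambda_{A^*}\circ\Lambda_A\in K$. For $a\in\Sigma$ let $\{\epsilon_i(a,A)\}$ be a basis of $F(a,A)$ and $\{\epsilon_i(a,A)^*\}$ the dual basis of $F(A,a)$, i.e. $\epsilon_i^*\circ\epsilon_j=\delta_{ij}\,\mathrm{id}_a$.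 The partial trace $\mathrm{Tr}_{A\to a}(\varphi)$ of an endomorphism $\varphi$ of a product with a factor $A$ is $\sum_i(\mathrm{id}\diamond\epsilon_i^*\diamond\mathrm{id})\circ\varphi\circ(\mathrm{id}\diamond\epsilon_i\diamond\mathrm{id})$. Let $P=\langle x_1,\dots,x_n\mid R_1,\dots,R_m\rangle$ be a finite presentation whose relations are words $R=x_{i_1}^{l_1}\cdots x_{i_k}^{l_k}$ with $l_r\in\mathbb Z$. **The global invariant.** For $b\in\Sigma$ let $b^l$ be the product of $l$ copies of $b$ if $l>0$, of $|l|$ copies of $b^*$ if $l<0$, and $\mathbf 1$ if $l=0$. For $l\ge0$ let $f(b,l):b\diamond b^l\to b^l\diamond b$ be the identity of the product of $l+1$ copies of $b$. For $l<0$ let $f(b,l):b\diamond b^l\to b^l\diamond b$ be obtained from $f(b^*,|l|):b^*\diamond (b^*)^{|l|}\to (b^*)^{|l|}\diamond b^*$ by joining the last upper end $b^*$ to the new first lower end $b$ by $\lambda_b$, and the first lower end $b^*$ to the new last upper end $b$ by $\Lambda_b$. Put $R(b)=b^{l_1}\diamond\cdots\diamond b^{l_k}$. Composing $f(b,l_1),\dots,f(b,l_k)$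 successively along the free strand $b$ gives a morphism $b\diamond R(b)\to R(b)\diamond b$. Let $[R,b]:R(b)\to R(b)$ be $r(b)$ times the morphism obtained from it by closing the free strand with $\Lambda_b$ and $\lambda_{b^*}$. For $\underline b\in\Sigma^m$ let $[P,\underline b]=[R_1,b_1]\diamond\cdots\diamond[R_m,b_m]$. Let $G_k(\underline b)$ be the product, in order of occurrence, of the factors $b_j^{l}$ of $R_1(b_1)\diamond\cdots\diamond R_m(b_m)$ that come from powers of $x_k$, and let $\xi(P)$ be the permutation isomorphism from $R_1(b_1)\diamond\cdots\diamond R_m(b_m)$ to $G_1(\underline b)\diamond\cdots\diamond G_n(\underline b)$. Define $$Q(P)=\sum_{\underline b\in\Sigma^m}\mathrm{Tr}_{\{G_k(\underline b)\to\mathbf 1\}_k}\bigl(\xi(P)\circ[P,\underline b]\circ\xi(P)^{-1}\bigr)\in K .$$ **Quinn's algorithm.** Let $V(n)=\bigoplus_{y\in\Sigma^n}F(\mathbf 1,y_1y_1^*\cdots y_ny_n^*)$, and write $V(n+1)=\bigoplus_{b\in\Sigma,\,y\in\Sigma^n}F(\mathbf 1,b^*b\,y_1y_1^*\cdots y_ny_n^*)$.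 The *circulator* $CR(b,a)$ is the endomorphism of $\bigoplus_{x\in\Sigma}F(a,bxx^*)$ given by the composite $$\bigoplus_xF(a,bxx^*)\to\bigoplus_xF(a,x(x^*b))\xrightarrow{\nabla^{-1}}\bigoplus_{x,z}F(a,xz^*)\otimes F(z^*,x^*b)\to\bigoplus_{x,z}F(a,xz^*)\otimes F(x,bz)\xrightarrow{\nabla}\bigoplus_zF(a,bzz^*).$$ Here the first map is the permutation of factors. The map $\nabla$ composes $\psi\otimes\phi$ by inserting $\phi$ into the corresponding factor of the target of $\psi$; its inverse is $\varphi\mapsto\bigoplus_{c}\sum_i\bigl((\mathrm{id}\diamond\epsilon_i(c,B)^*\diamond\mathrm{id})\circ\varphi\bigr)\otimes\epsilon_i(c,B)$, with $c$ running over $\Sigma$. The third map is $\mathrm{id}\otimes cycl$, where $cycl$ sends $\phi:z^*\to x^*b$ to the composite $x\xrightarrow{\mathrm{id}\diamond\Lambda_z}x z^*z\xrightarrow{\mathrm{id}\diamond\phi\diamond\mathrm{id}}xx^*bz\xrightarrow{\lambda_x\diamond\mathrm{id}}bz$. The elementary maps are as follows. 1. *Beginning presentation* $F(\mathbf 1,\mathbf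 1)\to V(n)$: the embedding as the summand $y=(\mathbf 1,\dots,\mathbf 1)$ (where $\mathbf 1^*=\mathbf 1$). 2. *Beginning relation* $V(n)\to V(n+1)$: $\psi\mapsto\bigoplus_b r(b)^2\,(\Lambda_b\diamond\psi)$. 3. *Factor $x_i^s$*, $V(n+1)\to V(n+1)$: move $y_iy_i^*$ next to $b$; split off $\bigoplus_{a\in\Sigma}\bigoplus_{y_i\in\Sigma} F(a,by_iy_i^*)$ by $\nabla^{-1}$; apply $\mathrm{id}\otimes CR(b,a)^s$; recombine by $\nabla$; move $y_iy_i^*$ back. 4. *Ending relation* $V(n+1)\to V(n)$: $\varphi\mapsto\sum_b r(b)^{-1}(\lambda_{b^*}\diamond\mathrm{id})\circ\varphi_b$. 5. *Ending presentation* $V(n)\to F(\mathbf 1,\mathbf 1)$: the identification of the summand $y=(\mathbf 1,\dots,\mathbf 1)$ with $F(\mathbf 1,\mathbf 1)$, and $0$ on all other summands. The algorithm begins the presentation. Then, for each relation $R_1,\dots,R_m$ in turn, it begins the relation, applies its factors in order, and ends the relation. Finally it ends the presentation. **Theorem.** The algorithm is well defined, i.e. $r(b)\neq0$ for all $b\in\Sigma$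 and every circulator $CR(b,a)$ is invertible. For every presentation $P$ the resulting map $F(\mathbf 1,\mathbf 1)\to F(\mathbf 1,\mathbf 1)$ is multiplication by $Q(P)$. -/

import Mathlib

open CategoryTheory MonoidalCategory Limits

universe w v u

noncomputable section

namespace QuinnInvariant

/-! ### Semisimple stable autonomous tensor categories -/

section Duals

variable {C : Type u} [Category.{v} C] [MonoidalCategory C] [LeftRigidCategory C]

/-- The object `A*` assigned to `A`. -/
def dual (A : C) : C := (LeftRigidCategory.leftDual A).leftDual

/-- The coform `Λ_A : 1 ⟶ A* A`. -/
def coform (A : C) : 𝟙_ C ⟶ dual A ⊗ A :=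
  (LeftRigidCategory.leftDual A).exact.coevaluation'

/-- The form `λ_A : A A* ⟶ 1`. -/
def form (A : C) : A ⊗ dual A ⟶ 𝟙_ C :=
  (LeftRigidCategory.leftDual A).exact.evaluation'

end Duals

/-- A (symmetric) autonomous tensor category is stable if `A** = A` for every object `A` and the
canonical isomorphism `w_A : A** ⟶ A`, characterised by
`γ_{A*,A} ∘ Λ_A = (w_A ⋄ id) ∘ Λ_{A*}`, is the identity. -/
class Stable (C : Type u) [Category.{v} C] [MonoidalCategory C] [SymmetricCategory C]
    [LeftRigidCategory C] : Prop where
  dual_dual : ∀ A : C, dual (dual A) = A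
  coform_braiding : ∀ A : C, coform A ≫ (β_ (dual A) A).hom =
    coform (dual A) ≫ (eqToHom (dual_dual A) ▷ dual A)

attribute [local instance] Abelian.hasFiniteBiproducts

/-- The finite set `Σ` of simple objects of a semisimple autonomous tensor category over `K`:
every object is isomorphic to a finite direct sum of members of `Σ`, and `Hom(a, b)` is `0` for
distinct members `a`, `b` and is isomorphic to `K` for `a = b`. The unit object is a member and
`Σ` is closed under `*`. -/
structure Simples (K : Type w) [Field K] (C : Type u) [Category.{v} C] [Abelian C] [Linear K C]
    [MonoidalCategory C] [LeftRigidCategory C] where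
  carrier : Finset C
  unit_mem : 𝟙_ C ∈ carrier
  dual_mem : ∀ a ∈ carrier, dual a ∈ carrier
  hom_eq_zero : ∀ a ∈ carrier, ∀ b ∈ carrier, a ≠ b → ∀ f : a ⟶ b, f = 0
  hom_self : ∀ a ∈ carrier, Nonempty ((a ⟶ a) ≃ₗ[K] K)
  decomposes : ∀ A : C, ∃ (n : ℕ) (c : Fin n → carrier), Nonempty (A ≅ ⨁ fun i => (c i : C))

/-- A basis of `F(a, A) = Hom(a, A)` together with the dual basis of `F(A, a)`. -/
structure DualBasis (K : Type w) [Field K] {C : Type u} [Category.{v} C] [Preadditive C]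
    [Linear K C] (a A : C) where
  ι : Type
  [fintype : Fintype ι]
  [decEq : DecidableEq ι]
  ε : Module.Basis ι K (a ⟶ A)
  ε' : Module.Basis ι K (A ⟶ a)
  dual_eq : ∀ i j, ε j ≫ ε' i = if i = j then 𝟙 a else 0

attribute [instance] DualBasis.fintype DualBasis.decEq

/-! ### Tensor products of families, with insertion and extraction of factors -/

section Tensor

variable {C : Type u} [Category.{v} C] [MonoidalCategory C]

/-- The product `X 0 ⋄ X 1 ⋄ ⋯ ⋄ X (n - 1)` (the unit object for `n = 0`). -/
def tensorFin : (n : ℕ) → (Fin n → C) → C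
  | 0, _ => 𝟙_ C
  | n + 1, X => X 0 ⊗ tensorFin n (fun j => X j.succ)

/-- The product of all `X j` with `j ≠ i`. -/
def restFin : (n : ℕ) → Fin n → (Fin n → C) → C
  | n + 1, ⟨0, _⟩, X => tensorFin n (fun j => X j.succ)
  | n + 1, ⟨i + 1, h⟩, X => X 0 ⊗ restFin n ⟨i, Nat.lt_of_succ_lt_succ h⟩ (fun j => X j.succ)

/-- Replace the `i`-th entry of a tuple by `x`. -/
def setAt {α : Type*} (x : α) : (n : ℕ) → Fin n → (Fin n → α) → (Fin n → α)
  | n + 1, ⟨0, _⟩, y => Fin.cons x (fun j : Fin n => y j.succ)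
  | n + 1, ⟨i + 1, h⟩, y =>
      Fin.cons (y 0) (setAt x n ⟨i, Nat.lt_of_succ_lt_succ h⟩ (fun j => y j.succ))

theorem setAt_eq_update {α : Type*} (x : α) : ∀ (n : ℕ) (i : Fin n) (y : Fin n → α),
    setAt x n i y = Function.update y i x
  | n + 1, ⟨0, _⟩, y => by
      funext j
      refine Fin.cases ?_ (fun j => ?_) j
      · simp [setAt]
      · simp [setAt]
  | n + 1, ⟨i + 1, h⟩, y => by
      have ih := setAt_eq_update x n ⟨i, Nat.lt_of_succ_lt_succ h⟩ (fun j => y j.succ)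
      have e : (⟨i + 1, h⟩ : Fin (n + 1)) = Fin.succ ⟨i, Nat.lt_of_succ_lt_succ h⟩ := rfl
      funext j
      refine Fin.cases ?_ (fun j => ?_) j
      · simp only [setAt, Fin.cons_zero]
        rw [e, Function.update_of_ne (Fin.succ_ne_zero _).symm]
      · simp only [setAt, Fin.cons_succ, ih]
        rw [e]
        by_cases hj : j = ⟨i, Nat.lt_of_succ_lt_succ h⟩
        · subst hj; simp
        · rw [Function.update_of_ne hj, Function.update_of_ne]
          exact fun h' => hj (Fin.succ_injective _ h')

/-- Multiply the `i`-th entry of a family of objects by `A` from the left. -/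
def mulAt (A : C) (n : ℕ) (i : Fin n) (X : Fin n → C) : Fin n → C :=
  setAt (A ⊗ X i) n i X

variable [SymmetricCategory C]

/-- The permutation moving the first factor past the second one:
`A ⋄ (B ⋄ D) ⟶ B ⋄ (A ⋄ D)`. -/
def swapIso (A B D : C) : A ⊗ (B ⊗ D) ≅ B ⊗ (A ⊗ D) :=
  (α_ A B D).symm ≪≫ whiskerRightIso (β_ A B) D ≪≫ α_ B A D

/-- The permutation of factors bringing the `i`-th factor to the front. -/
def pullIso : (n : ℕ) → (i : Fin n) → (X : Fin n → C) →
    (tensorFin n X ≅ X i ⊗ restFin n i X)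
  | _ + 1, ⟨0, _⟩, _ => Iso.refl _
  | n + 1, ⟨i + 1, h⟩, X =>
      whiskerLeftIso (X 0)
        (pullIso n ⟨i, Nat.lt_of_succ_lt_succ h⟩ (fun j => X j.succ)) ≪≫ swapIso _ _ _

/-- For a family `X y₀, X y₁, …` indexed by a tuple `y`, the permutation of factors bringing the
`i`-th factor to the front, when the `i`-th entry of `y` has been replaced by `x`. -/
def pullSetIso {α : Type*} (X : α → C) (x : α) : (n : ℕ) → (i : Fin n) → (y : Fin n → α) →
    (tensorFin n (fun j => X (setAt x n i y j)) ≅ X x ⊗ restFin n i (fun j => X (y j)))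
  | _ + 1, ⟨0, _⟩, _ => Iso.refl _
  | n + 1, ⟨i + 1, h⟩, y =>
      whiskerLeftIso (X (y 0))
        (pullSetIso X x n ⟨i, Nat.lt_of_succ_lt_succ h⟩ (fun j => y j.succ)) ≪≫ swapIso _ _ _

/-- The permutation of factors moving `A` in front of the `i`-th factor of a product. -/
def insertIso (A : C) (n : ℕ) (i : Fin n) (X : Fin n → C) :
    A ⊗ tensorFin n X ≅ tensorFin n (mulAt A n i X) :=
  whiskerLeftIso A (pullIso n i X) ≪≫ (α_ A (X i) (restFin n i X)).symm ≪≫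
    (pullSetIso (fun Y : C => Y) (A ⊗ X i) n i X).symm

/-- `1 ≅ 1 ⋄ 1 ⋄ ⋯ ⋄ 1`. -/
def unitIso : (n : ℕ) → (𝟙_ C ≅ tensorFin n (fun _ => 𝟙_ C))
  | 0 => Iso.refl _
  | n + 1 => (λ_ (𝟙_ C)).symm ≪≫ whiskerLeftIso (𝟙_ C) (unitIso n)

end Tensor

/-! ### Presentations -/

/-- A word `x_{i₁}^{l₁} x_{i₂}^{l₂} ⋯ x_{i_k}^{l_k}` in the generators `x_0, …, x_{n-1}`. -/
abbrev Word (n : ℕ) := List (Fin n × ℤ)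

/-- A presentation `⟨x_0, …, x_{n-1} | R_0, …, R_{m-1}⟩`. -/
structure Presentation (n m : ℕ) where
  rel : Fin m → Word n

/-! ### The open morphisms of a relation -/

section Relations

variable {C : Type u} [Category.{v} C] [MonoidalCategory C]

/-- `b ⋄ b ⋄ ⋯ ⋄ b` (`k` factors). -/
def natPow (b : C) : ℕ → C
  | 0 => 𝟙_ C
  | k + 1 => natPow b k ⊗ b

/-- The identity permutation `b ⋄ b^k ⟶ b^k ⋄ b` of the product of `k + 1` copies of `b`, the
first lower copy being the in-end and the last upper copy the out-end. -/
def shift (b : C) : (k : ℕ) → (b ⊗ natPow b k ⟶ natPow b k ⊗ b)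
  | 0 => (ρ_ b).hom ≫ (λ_ b).inv
  | k + 1 => (α_ b (natPow b k) b).inv ≫ (shift b k ▷ b)

variable [LeftRigidCategory C]

/-- `b^l`: `l` factors `b` if `l > 0`, `|l|` factors `b*` if `l < 0` (and `1` if `l = 0`). -/
def intPow (b : C) : ℤ → C
  | Int.ofNat k => natPow b k
  | Int.negSucc k => natPow (dual b) (k + 1)

variable [SymmetricCategory C]

/-- The reverse of an open morphism `F : b* ⋄ B ⟶ B ⋄ b*` with in-end and out-end `b*`: the
out-end of `F` is joined to the new in-end `b` by the form, and the in-end of `F` is joined to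
the new out-end `b` by the coform. -/
def reverse (b B : C) (F : dual b ⊗ B ⟶ B ⊗ dual b) : b ⊗ B ⟶ B ⊗ b :=
  (ρ_ (b ⊗ B)).inv ≫ ((b ⊗ B) ◁ coform b) ≫ (α_ (b ⊗ B) (dual b) b).inv ≫
    (((α_ b B (dual b)).hom ≫ (b ◁ (β_ B (dual b)).hom) ≫ (b ◁ F) ≫
      (b ◁ (β_ B (dual b)).hom) ≫ (α_ b (dual b) B).inv ≫ (form b ▷ B) ≫ (λ_ B).hom) ▷ b)

/-- The open morphism `f(b, l)`, from (in-end) `⋄ b^l` to `b^l ⋄` (out-end). -/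
def powMor (b : C) : (l : ℤ) → (b ⊗ intPow b l ⟶ intPow b l ⊗ b)
  | Int.ofNat k => shift b k
  | Int.negSucc k => reverse b _ (shift (dual b) (k + 1))

variable {n : ℕ}

/-- `R(b) = b^{l₁} b^{l₂} ⋯ b^{l_k}`. -/
def relObj (b : C) : Word n → C
  | [] => 𝟙_ C
  | (_, l) :: R => intPow b l ⊗ relObj b R

/-- The open morphism `[R, b]ᵒ / r(b)`: the out-end of each `f(b, l_i)` is joined to the in-end
of `f(b, l_{i+1})`. -/
def openRel (b : C) : (R : Word n) → (b ⊗ relObj b R ⟶ relObj b R ⊗ b)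
  | [] => (ρ_ b).hom ≫ (λ_ b).inv
  | (_, l) :: R => (α_ b (intPow b l) (relObj b R)).inv ≫ (powMor b l ▷ relObj b R) ≫
      (α_ (intPow b l) b (relObj b R)).hom ≫ (intPow b l ◁ openRel b R) ≫
      (α_ (intPow b l) (relObj b R) b).inv

/-- The family `k ↦ g_k(R, b) ⋄ G_k`, where `g_k(R, b)` is the product of the factors `b^{l_r}`
of `R(b)` with `x_{i_r} = x_k`. -/
def wordGens (b : C) (G : Fin n → C) : Word n → (Fin n → C)
  | [] => G
  | (i, l) :: R => mulAt (intPow b l) n i (wordGens b G R)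

/-- The permutation `R(b) ⋄ (⋄_k G_k) ⟶ ⋄_k (g_k(R, b) ⋄ G_k)` grouping the factors according to
generators. -/
def wordPerm (b : C) (G : Fin n → C) : (R : Word n) →
    (relObj b R ⊗ tensorFin n G ≅ tensorFin n (wordGens b G R))
  | [] => λ_ _
  | (i, l) :: R => α_ _ _ _ ≪≫ whiskerLeftIso (intPow b l) (wordPerm b G R) ≪≫
      insertIso (intPow b l) n i (wordGens b G R)

end Relations

variable {K : Type w} [Field K] {C : Type u} [Category.{v} C] [Abelian C] [Linear K C]
  [MonoidalCategory C]

/-! ### The maps `∇` and `∇⁻¹`, cyclic rotation -/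

/-- The component at `a` of `∇ : ⊕_a F(p, G a) ⊗ F(a, B) ⟶ F(p, G B)`, `ψ ⊗ φ ↦ G(φ) ∘ ψ`,
where `G` is a functor such as `A ⋄ (- ⋄ D)`. -/
def nabla (G : C ⥤ C) [G.Additive] [G.Linear K] (p a B : C) :
    TensorProduct K (p ⟶ G.obj a) (a ⟶ B) →ₗ[K] (p ⟶ G.obj B) :=
  TensorProduct.lift ((Linear.comp p (G.obj a) (G.obj B)).compl₂ (G.mapLinearMap K))

/-- The rotation `cycl(a, b, c) : F(a, b c) ⟶ F(b*, c a*)`, written for objects `a'`, `b'` in the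
place of `a*`, `b*` with a coform `1 ⟶ a a'` and a form `b' b ⟶ 1`. -/
def cycl {a a' b b' : C} [MonoidalPreadditive C] [MonoidalLinear K C]
    (coev : 𝟙_ C ⟶ a ⊗ a') (ev : b' ⊗ b ⟶ 𝟙_ C) (c : C) :
    (a ⟶ b ⊗ c) →ₗ[K] (b' ⟶ c ⊗ a') :=
  Linear.leftComp K _ ((ρ_ b').inv ≫ (b' ◁ coev)) ∘ₗ
    Linear.rightComp K _ ((b' ◁ (α_ b c a').hom) ≫ (α_ b' b (c ⊗ a')).inv ≫
      (ev ▷ (c ⊗ a')) ≫ (λ_ (c ⊗ a')).hom) ∘ₗ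
    (tensorLeft b').mapLinearMap K ∘ₗ (tensorRight a').mapLinearMap K

variable [LeftRigidCategory C]

namespace Simples

/-- The simple objects, as a type. -/
abbrev Obj (S : Simples K C) : Type u := {a : C // a ∈ S.carrier}

variable (S : Simples K C)

/-- The unit object as a member of `Σ`. -/
def unit : S.Obj := ⟨𝟙_ C, S.unit_mem⟩

/-- The involution `a ↦ a*` of `Σ`. -/
def star (a : S.Obj) : S.Obj := ⟨dual (a : C), S.dual_mem a a.2⟩

theorem id_ne_zero (a : S.Obj) : 𝟙 (a : C) ≠ 0 := by
  intro h
  obtain ⟨e⟩ := S.hom_self a a.2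
  have h0 : e.symm 1 = 0 := by
    rw [← Category.comp_id (e.symm 1), h, comp_zero]
  exact one_ne_zero ((LinearEquiv.map_eq_zero_iff e.symm).mp h0)

theorem smul_id_bijective (a : S.Obj) :
    Function.Bijective (LinearMap.toSpanSingleton K ((a : C) ⟶ a) (𝟙 (a : C))) := by
  obtain ⟨e⟩ := S.hom_self a a.2
  have hne : e (𝟙 (a : C)) ≠ 0 := fun h =>
    S.id_ne_zero a ((LinearEquiv.map_eq_zero_iff e).mp h)
  constructor
  · intro x y h
    have h' := congrArg e h
    simp only [LinearMap.toSpanSingleton_apply, map_smul, smul_eq_mul] at h'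
    exact mul_right_cancel₀ hne h'
  · intro f
    refine ⟨e f / e (𝟙 (a : C)), e.injective ?_⟩
    simp only [LinearMap.toSpanSingleton_apply, map_smul, smul_eq_mul]
    exact div_mul_cancel₀ _ hne

/-- The standard isomorphism `K ≅ F(1, 1)`, `c ↦ c · id`. -/
def scalarEquiv : K ≃ₗ[K] (𝟙_ C ⟶ 𝟙_ C) :=
  LinearEquiv.ofBijective (LinearMap.toSpanSingleton K (𝟙_ C ⟶ 𝟙_ C) (𝟙 (𝟙_ C)))
    (S.smul_id_bijective S.unit)

theorem exists_dualBasis (a : S.Obj) (A : C) : Nonempty (DualBasis K (a : C) A) := by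
  classical
  obtain ⟨n, c, ⟨e⟩⟩ := S.decomposes A
  let ι := {i : Fin n // c i = a}
  let inc : ι → ((a : C) ⟶ A) := fun i =>
    eqToHom (congrArg Subtype.val i.2.symm) ≫ biproduct.ι (fun i => (c i : C)) i.1 ≫ e.inv
  let prj : ι → (A ⟶ (a : C)) := fun i =>
    e.hom ≫ biproduct.π (fun i => (c i : C)) i.1 ≫ eqToHom (congrArg Subtype.val i.2)
  have hd : ∀ i j : ι, inc j ≫ prj i = if i = j then 𝟙 (a : C) else 0 := by
    intro i j
    by_cases h : i = j
    · subst h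
      simp [inc, prj]
    · have h' : j.1 ≠ i.1 := fun h'' => h (Subtype.ext h''.symm)
      simp [inc, prj, h, biproduct.ι_π_ne_assoc _ h']
  have hsum : ∑ i : Fin n, e.hom ≫ biproduct.π (fun i => (c i : C)) i ≫
      biproduct.ι (fun i => (c i : C)) i ≫ e.inv = 𝟙 A := by
    have h1 := biproduct.total (f := fun i => (c i : C))
    have h2 : e.hom ≫ (∑ i : Fin n, biproduct.π (fun i => (c i : C)) i ≫
      biproduct.ι (fun i => (c i : C)) i) ≫ e.inv = 𝟙 A := by
      rw [h1]; simp
    rw [← h2, Preadditive.sum_comp, Preadditive.comp_sum]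
    simp
  have hin : ∀ g : (a : C) ⟶ A, g ∈ Submodule.span K (Set.range inc) := by
    intro g
    rw [← Category.comp_id g, ← hsum, Preadditive.comp_sum]
    refine Submodule.sum_mem _ fun i _ => ?_
    by_cases h : c i = a
    · obtain ⟨r, hr⟩ := (S.smul_id_bijective a).2
        (g ≫ e.hom ≫ biproduct.π (fun i => (c i : C)) i ≫ eqToHom (congrArg Subtype.val h))
      have : g ≫ e.hom ≫ biproduct.π (fun i => (c i : C)) i ≫
          biproduct.ι (fun i => (c i : C)) i ≫ e.inv = r • inc ⟨i, h⟩ := by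
        have h3 : r • inc ⟨i, h⟩ = (r • 𝟙 (a : C)) ≫ inc ⟨i, h⟩ := by simp
        rw [LinearMap.toSpanSingleton_apply] at hr
        rw [h3, hr]
        simp [inc]
      rw [this]
      exact Submodule.smul_mem _ _ (Submodule.subset_span ⟨_, rfl⟩)
    · have h0 : g ≫ e.hom ≫ biproduct.π (fun i => (c i : C)) i = 0 :=
        S.hom_eq_zero _ a.2 _ (c i).2 (fun h' => h (Subtype.ext h'.symm)) _
      have : g ≫ e.hom ≫ biproduct.π (fun i => (c i : C)) i ≫
          biproduct.ι (fun i => (c i : C)) i ≫ e.inv = 0 := by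
        have := congrArg (· ≫ biproduct.ι (fun i => (c i : C)) i ≫ e.inv) h0
        simpa using this
      rw [this]
      exact Submodule.zero_mem _
  have hout : ∀ g : A ⟶ (a : C), g ∈ Submodule.span K (Set.range prj) := by
    intro g
    rw [← Category.id_comp g, ← hsum, Preadditive.sum_comp]
    refine Submodule.sum_mem _ fun i _ => ?_
    by_cases h : c i = a
    · obtain ⟨r, hr⟩ := (S.smul_id_bijective a).2
        (eqToHom (congrArg Subtype.val h.symm) ≫ biproduct.ι (fun i => (c i : C)) i ≫ e.inv ≫ g)
      have : (e.hom ≫ biproduct.π (fun i => (c i : C)) i ≫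
          biproduct.ι (fun i => (c i : C)) i ≫ e.inv) ≫ g = r • prj ⟨i, h⟩ := by
        have h3 : r • prj ⟨i, h⟩ = prj ⟨i, h⟩ ≫ (r • 𝟙 (a : C)) := by simp
        rw [LinearMap.toSpanSingleton_apply] at hr
        rw [h3, hr]
        simp [prj]
      rw [this]
      exact Submodule.smul_mem _ _ (Submodule.subset_span ⟨_, rfl⟩)
    · have h0 : biproduct.ι (fun i => (c i : C)) i ≫ e.inv ≫ g = 0 :=
        S.hom_eq_zero _ (c i).2 _ a.2 (fun h' => h (Subtype.ext h')) _
      have : (e.hom ≫ biproduct.π (fun i => (c i : C)) i ≫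
          biproduct.ι (fun i => (c i : C)) i ≫ e.inv) ≫ g = 0 := by
        simp [h0]
      rw [this]
      exact Submodule.zero_mem _
  have lin1 : LinearIndependent K inc := by
    rw [Fintype.linearIndependent_iff]
    intro x hx i
    have h1 := congrArg (· ≫ prj i) hx
    simp only [Preadditive.sum_comp, Linear.smul_comp, hd, zero_comp] at h1
    rw [Finset.sum_eq_single i (fun j _ hj => by simp [Ne.symm hj]) (by simp), if_pos rfl] at h1
    exact (smul_eq_zero.mp h1).resolve_right (S.id_ne_zero a)
  have lin2 : LinearIndependent K prj := by
    rw [Fintype.linearIndependent_iff]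
    intro x hx i
    have h1 := congrArg (inc i ≫ ·) hx
    simp only [Preadditive.comp_sum, Linear.comp_smul, hd, comp_zero] at h1
    rw [Finset.sum_eq_single i (fun j _ hj => by simp [hj]) (by simp), if_pos rfl] at h1
    exact (smul_eq_zero.mp h1).resolve_right (S.id_ne_zero a)
  exact ⟨{
    ι := ι
    ε := Module.Basis.mk lin1 (fun g _ => hin g)
    ε' := Module.Basis.mk lin2 (fun g _ => hout g)
    dual_eq := by
      intro i j
      simpa using hd i j }⟩

/-- A choice of dual bases `ε_i(a, A)`, `ε_i(a, A)*` for every simple `a` and every object `A`. -/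
def basis (a : S.Obj) (A : C) : DualBasis K (a : C) A :=
  Classical.choice (S.exists_dualBasis a A)

theorem dual_unit (S : Simples K C) [MonoidalPreadditive C] : dual (𝟙_ C) = 𝟙_ C := by
  by_contra h
  have h0 : coform (𝟙_ C) ≫ (ρ_ (dual (𝟙_ C))).hom = 0 :=
    S.hom_eq_zero _ S.unit_mem _ (S.dual_mem _ S.unit_mem) (fun h' => h h'.symm) _
  have h1 : coform (𝟙_ C) = 0 := by
    rw [← Category.comp_id (coform (𝟙_ C)), ← (ρ_ (dual (𝟙_ C))).hom_inv_id,
      ← Category.assoc, h0, zero_comp]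
  have h2 : 𝟙_ C ◁ coform (𝟙_ C) ≫ (α_ (𝟙_ C) (dual (𝟙_ C)) (𝟙_ C)).inv ≫
      form (𝟙_ C) ▷ 𝟙_ C = (ρ_ (𝟙_ C)).hom ≫ (λ_ (𝟙_ C)).inv :=
    (LeftRigidCategory.leftDual (𝟙_ C)).exact.coevaluation_evaluation'
  rw [h1, MonoidalPreadditive.whiskerLeft_zero, zero_comp] at h2
  refine S.id_ne_zero S.unit ?_
  have h3 : 𝟙 (𝟙_ C) = (ρ_ (𝟙_ C)).inv ≫ ((ρ_ (𝟙_ C)).hom ≫ (λ_ (𝟙_ C)).inv) ≫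
      (λ_ (𝟙_ C)).hom := by simp
  change 𝟙 (𝟙_ C) = 0
  rw [h3, ← h2, zero_comp, comp_zero]

/-- The partial trace `Tr_{A → b}` of an endomorphism of `A ⋄ Y`. -/
def partialTrace (b : S.Obj) (A Y : C) (φ : A ⊗ Y ⟶ A ⊗ Y) : ((b : C) ⊗ Y ⟶ (b : C) ⊗ Y) :=
  ∑ i, ((S.basis b A).ε i ▷ Y) ≫ φ ≫ ((S.basis b A).ε' i ▷ Y)

/-- The iterated partial trace `Tr_{X_k → 1 for all k}`, an element of `F(1, 1)`; the factors `1`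
that arise are removed by the unit isomorphisms. -/
def traceUnit : (n : ℕ) → (X : Fin n → C) → (tensorFin n X ⟶ tensorFin n X) → (𝟙_ C ⟶ 𝟙_ C)
  | 0, _, φ => φ
  | n + 1, X, φ => traceUnit n (fun j => X j.succ)
      ((λ_ _).inv ≫ S.partialTrace S.unit (X 0) (tensorFin n (fun j => X j.succ)) φ ≫ (λ_ _).hom)

/-- The component at `a` of `∇⁻¹ : F(p, G B) ⟶ ⊕_a F(p, G a) ⊗ F(a, B)`, which is
`φ ↦ ∑_i (G(ε_i(a, B)*) ∘ φ) ⊗ ε_i(a, B)`. -/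
def nablaInv (G : C ⥤ C) (p : C) (a : S.Obj) (B : C) :
    (p ⟶ G.obj B) →ₗ[K] TensorProduct K (p ⟶ G.obj (a : C)) ((a : C) ⟶ B) :=
  ∑ i, (TensorProduct.mk K (p ⟶ G.obj (a : C)) ((a : C) ⟶ B)).flip ((S.basis a B).ε i) ∘ₗ
    Linear.rightComp K p (G.map ((S.basis a B).ε' i))

section Algorithm

variable [MonoidalPreadditive C] [MonoidalLinear K C] [SymmetricCategory C]

/-- The domain `⊕_{x ∈ Σ} F(a, b x x*)` of the circulator. -/
abbrev CircSpace (b a : S.Obj) : Type (max u v) :=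
  ∀ x : S.Obj, (a : C) ⟶ ((b : C) ⊗ (x : C)) ⊗ dual (x : C)

/-- The block of the circulator from the summand `x` to the summand `z`:
`F(a, b x x*) → F(a, x (x* b)) → F(a, x z*) ⊗ F(z*, x* b) → F(a, x z*) ⊗ F(x, b z)
→ F(a, b z z*)`. -/
def circBlock (b a x z : S.Obj) :
    ((a : C) ⟶ ((b : C) ⊗ (x : C)) ⊗ dual (x : C)) →ₗ[K]
      ((a : C) ⟶ ((b : C) ⊗ (z : C)) ⊗ dual (z : C)) :=
  nabla (K := K) (tensorRight (dual (z : C))) (a : C) (x : C) ((b : C) ⊗ (z : C)) ∘ₗ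
    LinearMap.lTensor _ (cycl (K := K) (coform (z : C)) (form (x : C)) (b : C)) ∘ₗ
    S.nablaInv (tensorLeft (x : C)) (a : C) (S.star z) (dual (x : C) ⊗ (b : C)) ∘ₗ
    Linear.rightComp K (a : C)
      ((α_ (b : C) (x : C) (dual (x : C))).hom ≫ (β_ (b : C) ((x : C) ⊗ dual (x : C))).hom ≫
        (α_ (x : C) (dual (x : C)) (b : C)).hom)

/-- The circulator, an endomorphism of `⊕_{x ∈ Σ} F(a, b x x*)`. -/
def circulator (b a : S.Obj) : Module.End K (S.CircSpace b a) :=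
  LinearMap.pi fun z => ∑ x, S.circBlock b a x z ∘ₗ LinearMap.proj x

/-- The integral powers of the circulator (which is invertible). -/
def circPow (b a : S.Obj) : ℤ → Module.End K (S.CircSpace b a)
  | Int.ofNat k => S.circulator b a ^ k
  | Int.negSucc k => Ring.inverse (S.circulator b a) ^ (k + 1)

end Algorithm

variable [SymmetricCategory C] [Stable C]

/-- The form `λ_{A*} : A* A ⟶ 1`, using `A** = A`. -/
def _root_.QuinnInvariant.formDual (A : C) : dual A ⊗ A ⟶ 𝟙_ C :=
  (dual A ◁ eqToHom (Stable.dual_dual A).symm) ≫ form (dual A)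

/-- The closure of an open morphism `b ⋄ X ⟶ X ⋄ b`, joining the out-end with the in-end. -/
def _root_.QuinnInvariant.closure (b X : C) (F : b ⊗ X ⟶ X ⊗ b) : X ⟶ X :=
  (λ_ X).inv ≫ (coform b ▷ X) ≫ (α_ (dual b) b X).hom ≫ (dual b ◁ F) ≫
    (dual b ◁ (β_ X b).hom) ≫ (α_ (dual b) b X).inv ≫ (formDual b ▷ X) ≫ (λ_ X).hom

/-- The rank `r(A) = λ_{A*} ∘ Λ_A`, as an element of `K`. -/
def rank (A : C) : K := S.scalarEquiv.symm (coform A ≫ formDual A)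

/-! ### The invariant `Q(P)` -/

variable {n m : ℕ}

/-- `[R, b] : R(b) ⟶ R(b)`. -/
def relMor (b : S.Obj) (R : Word n) : relObj (b : C) R ⟶ relObj (b : C) R :=
  S.rank (b : C) • closure (b : C) (relObj (b : C) R) (openRel (b : C) R)

/-- `Rel(b₁, b₂, …) = R₁(b₁) ⋄ R₂(b₂) ⋄ ⋯`. -/
def relsObj : List (Word n × S.Obj) → C
  | [] => 𝟙_ C
  | (R, b) :: L => relObj (b : C) R ⊗ relsObj L

/-- `[R₁, b₁] ⋄ [R₂, b₂] ⋄ ⋯`. -/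
def relsMor : (L : List (Word n × S.Obj)) → (S.relsObj L ⟶ S.relsObj L)
  | [] => 𝟙 _
  | (R, b) :: L => S.relMor b R ⊗ₘ relsMor L

/-- `G_k(b₁, b₂, …) = g_k(R₁, b₁) ⋄ g_k(R₂, b₂) ⋄ ⋯`. -/
def relsGens : List (Word n × S.Obj) → (Fin n → C)
  | [] => fun _ => 𝟙_ C
  | (R, b) :: L => wordGens (b : C) (relsGens L) R

/-- The permutation `ξ(P)` grouping the factors of `Rel(b₁, b₂, …)` according to generators. -/
def relsPerm : (L : List (Word n × S.Obj)) → (S.relsObj L ≅ tensorFin n (S.relsGens L))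
  | [] => unitIso n
  | (R, b) :: L =>
      whiskerLeftIso (relObj (b : C) R) (relsPerm L) ≪≫ wordPerm (b : C) (S.relsGens L) R

/-- The summand of `Q(P)` for a tuple `(b₁, b₂, …)`, in `F(1, 1)`. -/
def invariantTerm (L : List (Word n × S.Obj)) : 𝟙_ C ⟶ 𝟙_ C :=
  S.traceUnit n (S.relsGens L) ((S.relsPerm L).inv ≫ S.relsMor L ≫ (S.relsPerm L).hom)

/-- The globally defined invariant `Q(P)`. -/
def Q (P : Presentation n m) : K :=
  S.scalarEquiv.symm
    (∑ b : Fin m → S.Obj, S.invariantTerm (List.ofFn fun j => (P.rel j, b j)))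

/-! ### The state-space algorithm -/

/-- `y₁ y₁* y₂ y₂* ⋯ y_n y_n*`. -/
abbrev stateObj (y : Fin n → S.Obj) : C :=
  tensorFin n fun j => (y j : C) ⊗ dual (y j : C)

variable (n) in
/-- The state space `V(n) = ⊕_y F(1, y₁ y₁* ⋯ y_n y_n*)`. -/
abbrev V : Type (max u v) := ∀ y : Fin n → S.Obj, 𝟙_ C ⟶ S.stateObj y

variable (n) in
/-- The state space `V(n + 1) = ⊕_{b, y} F(1, b* b y₁ y₁* ⋯ y_n y_n*)`, where the simple object
of the additional generator is `b*` and `b** = b`. -/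
abbrev VRel : Type (max u v) :=
  ∀ (b : S.Obj) (y : Fin n → S.Obj), 𝟙_ C ⟶ dual (b : C) ⊗ ((b : C) ⊗ S.stateObj y)

variable [MonoidalPreadditive C] [MonoidalLinear K C]

/-- The identification of `F(1, 1)` with the trivial summand `F(1, 1 1* ⋯ 1 1*)`, using
`1* = 1` and the unit isomorphisms. -/
def trivialIso : (n : ℕ) → (𝟙_ C ≅ S.stateObj (fun _ : Fin n => S.unit))
  | 0 => Iso.refl _
  | n + 1 => (λ_ (𝟙_ C)).symm ≪≫
      (((λ_ (𝟙_ C)).symm ≪≫ whiskerLeftIso (𝟙_ C) (eqToIso S.dual_unit.symm)) ⊗ᵢ trivialIso n)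

open Classical in
variable (n) in
/-- Beginning presentation: the embedding of `F(1, 1)` as the trivial summand of `V(n)`. -/
def beginPresentation : (𝟙_ C ⟶ 𝟙_ C) →ₗ[K] S.V n :=
  LinearMap.single K (fun y : Fin n → S.Obj => 𝟙_ C ⟶ S.stateObj y) (fun _ => S.unit) ∘ₗ
    Linear.rightComp K (𝟙_ C) (S.trivialIso n).hom

variable (n) in
/-- Ending presentation: the identification of the trivial summand of `V(n)` with `F(1, 1)`,
and zero on all other summands. -/
def endPresentation : S.V n →ₗ[K] (𝟙_ C ⟶ 𝟙_ C) :=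
  Linear.rightComp K (𝟙_ C) (S.trivialIso n).inv ∘ₗ LinearMap.proj (fun _ => S.unit)

variable (n) in
/-- Beginning relation: `⊕_b r(b)² m_{b*}`, where `m_{b*}(ψ) = Λ_b ⋄ ψ`. -/
def beginRelation : S.V n →ₗ[K] S.VRel n :=
  LinearMap.pi fun b => LinearMap.pi fun y => S.rank (b : C) ^ 2 •
    (Linear.rightComp K (𝟙_ C) ((λ_ _).inv ≫ (coform (b : C) ▷ S.stateObj y) ≫
      (α_ (dual (b : C)) (b : C) (S.stateObj y)).hom) ∘ₗ LinearMap.proj y)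

variable (n) in
/-- Ending relation: `⊕_b r(b)⁻¹ d_{b*}`, where `d_{b*}(φ) = (λ_{b*} ⋄ id) ∘ φ`. -/
def endRelation : S.VRel n →ₗ[K] S.V n :=
  LinearMap.pi fun y => ∑ b : S.Obj, (S.rank (b : C))⁻¹ •
    (Linear.rightComp K (𝟙_ C) ((α_ (dual (b : C)) (b : C) (S.stateObj y)).inv ≫
      (formDual (b : C) ▷ S.stateObj y) ≫ (λ_ _).hom) ∘ₗ LinearMap.proj y ∘ₗ LinearMap.proj b)

/-- The product of all `y_j y_j*` with `j ≠ i`. -/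
abbrev restObj (i : Fin n) (y : Fin n → S.Obj) : C :=
  restFin n i fun j => (y j : C) ⊗ dual (y j : C)

/-- The permutation `b y₁ y₁* ⋯ y_n y_n* ⟶ (b x x*) y₁ y₁* ⋯ y_n y_n*` (with `y_i y_i*` omitted
on the right), where `y_i = x`. -/
def moveIso (b x : S.Obj) (i : Fin n) (y : Fin n → S.Obj) :
    (b : C) ⊗ S.stateObj (setAt x n i y) ≅
      (((b : C) ⊗ (x : C)) ⊗ dual (x : C)) ⊗ S.restObj i y :=
  whiskerLeftIso (b : C)
      (pullSetIso (fun x : S.Obj => (x : C) ⊗ dual (x : C)) x n i y) ≪≫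
    (α_ (b : C) ((x : C) ⊗ dual (x : C)) (S.restObj i y)).symm ≪≫
    whiskerRightIso (α_ (b : C) (x : C) (dual (x : C))).symm (S.restObj i y)

/-- The permutation `b y₁ y₁* ⋯ y_n y_n* ⟶ (b y_i y_i*) y₁ y₁* ⋯ y_n y_n*` (with `y_i y_i*`
omitted at its old place). -/
def moveIso' (b : S.Obj) (i : Fin n) (y : Fin n → S.Obj) :
    (b : C) ⊗ S.stateObj y ≅
      (((b : C) ⊗ (y i : C)) ⊗ dual (y i : C)) ⊗ S.restObj i y :=
  whiskerLeftIso (b : C) (pullIso n i fun j => (y j : C) ⊗ dual (y j : C)) ≪≫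
    (α_ (b : C) ((y i : C) ⊗ dual (y i : C)) (S.restObj i y)).symm ≪≫
    whiskerRightIso (α_ (b : C) (y i : C) (dual (y i : C))).symm (S.restObj i y)

open Classical in
/-- The morphism of a factor `x_i^s`. Its block from the summand of `(b, y₁, …, x, …, y_n)` (with
`x` at the place `i`) to the summand of `(b, y₁, …, y_n)` is
`F(1, b* b y₁ y₁* ⋯) → F(1, b* (b x x*) y₁ y₁* ⋯)
→ ⊕_a F(1, b* a y₁ y₁* ⋯) ⊗ F(a, b x x*) → ⊕_a F(1, b* a y₁ y₁* ⋯) ⊗ F(a, b y_i y_i*)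
→ F(1, b* (b y_i y_i*) y₁ y₁* ⋯) → F(1, b* b y₁ y₁* ⋯)`,
where the map in the middle is the `s`-th power of the circulator. -/
def factor (i : Fin n) (s : ℤ) : S.VRel n →ₗ[K] S.VRel n :=
  LinearMap.pi fun b => LinearMap.pi fun y => ∑ x : S.Obj, ∑ a : S.Obj,
    Linear.rightComp K (𝟙_ C) (dual (b : C) ◁ (S.moveIso' b i y).inv) ∘ₗ
    nabla (K := K) (tensorRight (S.restObj i y) ⋙ tensorLeft (dual (b : C)))
      (𝟙_ C) (a : C) (((b : C) ⊗ (y i : C)) ⊗ dual (y i : C)) ∘ₗ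
    LinearMap.lTensor _ (LinearMap.proj (y i) ∘ₗ S.circPow b a s ∘ₗ
      LinearMap.single K
        (fun x : S.Obj => (a : C) ⟶ ((b : C) ⊗ (x : C)) ⊗ dual (x : C)) x) ∘ₗ
    S.nablaInv (tensorRight (S.restObj i y) ⋙ tensorLeft (dual (b : C)))
      (𝟙_ C) a (((b : C) ⊗ (x : C)) ⊗ dual (x : C)) ∘ₗ
    Linear.rightComp K (𝟙_ C) (dual (b : C) ◁ (S.moveIso b x i y).hom) ∘ₗ
    LinearMap.proj (setAt x n i y) ∘ₗ LinearMap.proj b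

/-- The composite of the morphisms of the factors of a word, the first factor being applied
first. -/
def wordMap : Word n → (S.VRel n →ₗ[K] S.VRel n)
  | [] => LinearMap.id
  | (i, l) :: R => wordMap R ∘ₗ S.factor i l

/-- The endomorphism of `V(n)` induced by a relation. -/
def relationMap (R : Word n) : S.V n →ₗ[K] S.V n :=
  S.endRelation n ∘ₗ S.wordMap R ∘ₗ S.beginRelation n

/-- The composite of the endomorphisms induced by a list of relations, the first one being
applied first. -/
def relationsMap : List (Word n) → (S.V n →ₗ[K] S.V n)
  | [] => LinearMap.id
  | R :: L => relationsMap L ∘ₗ S.relationMap R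

/-- The map `F(1, 1) ⟶ F(1, 1)` produced by the state-space algorithm. -/
def quinnMap (P : Presentation n m) : (𝟙_ C ⟶ 𝟙_ C) →ₗ[K] (𝟙_ C ⟶ 𝟙_ C) :=
  S.endPresentation n ∘ₗ S.relationsMap (List.ofFn P.rel) ∘ₗ S.beginPresentation n

end Simples

end QuinnInvariant

end

/-!
The algorithm evaluates `Q(P)` because its states are names of endomorphisms, and each elementary
map transforms the endomorphism in a simple way.

A pair `(A*, A)` of an object with a chosen dual is an element `P` of `DPair`. In a semisimple
category the morphisms `A* A ⟶ x x*`, `x ∈ Σ`, that sum the products of the transpose of `ε_i` with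
`ε_i*` over a basis `ε_i` of `F(x*, A)` form a universal dinatural transformation (`coendMap`):
a morphism acting on `A` can be slid to `A*` (`coendMap_dinatural`), so isomorphic pairs give the
same map (`coendMap_iso`). Hence an endomorphism `φ` of a product `A₁ A₂ ⋯ A_n` has a state
`stateVec P φ ∈ V(n)`: close up `φ` by the coform of the product, group the factors into pairs
`A_k* A_k`, and apply `coendMap` to each pair. In the same way an open morphism
`b A₁ ⋯ A_n ⟶ A₁ ⋯ A_n b` gives a vector `strandVec` in the `b`-summand of `V(n + 1)`.

*Circulators.* For `A = x* b` the universal map is computed by rotating basis elements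
(`sum_cycl`), and this is how the circulator is defined. So a circulator lets the strand `b` pass
and merges a factor `b` into `A` (`circulator_apply`); its `s`-th power passes the open morphism
`f(b, s)` for `s ≥ 0` (`circulator_pow`). It takes the state of `f(b, -(l + 1))` to that of
`f(b, -l)` by dinaturality (`circulator_reverse`). Thus every state, in particular every standard
summand, is in the range of the circulator, which is therefore invertible
(`isUnit_circulator`), and negative powers pass `f(b, s)` as well (`circPow_coendMapRight`).

*Relations.* A factor `x_i^s` composes an open morphism with `f(b, s)`, the new factor `b^s` being
absorbed by `A_i` (`factor_strandVec`). The beginning of a relation puts a strand beside the state,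
and its end closes the strand (`openName_closure`), with weights `r(b)²` and `r(b)⁻¹`. So a relation
`R` replaces `φ` by the sum over `b` of `φ ⋄ [R, b]`, up to a permutation of factors
(`relationMap_stateVec`). Here `r(b) ≠ 0` because a coform whose pairing with the form vanishes
would vanish on all morphisms to `1` (`rank_ne_zero`).

*Trace.* On the trivial summand `coendMap` is a sum over dual bases of `F(1, A)`, so the end of the
presentation takes the state of `φ` to the iterated partial trace of `φ`, up to a power of the
scalar comparing the coform of `1` with the unit isomorphism (`stateVec_unit`); the beginning of
the presentation contributes the inverse power. The permutation of factors built up by the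
algorithm differs from `ξ(P)` by isomorphisms of the single factors (`exists_distribRels`), to
which the trace is insensitive (`traceUnit_conj`).

The recursive products `tensorFin`, `restFin` and the permutations built on them do not unfold
during unification with rewriting rules. Lemmas about them are therefore proved by recursion from
lemmas with suffix `_step`, which state the inductive step for arbitrary objects.
-/

set_option linter.unusedSectionVars false

noncomputable section

namespace QuinnInvariant

/-! ### Objects with chosen duals -/

section

section DualPairs

variable {C : Type u} [Category.{v} C] [MonoidalCategory C]

/-- An object `ob` with a chosen dual object `co`, exhibited by a coform `η : 1 ⟶ co ⋄ ob` and a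
form `ev : ob ⋄ co ⟶ 1` satisfying the zig-zag identities. -/
structure DPair (C : Type u) [Category.{v} C] [MonoidalCategory C] where
  co : C
  ob : C
  η : 𝟙_ C ⟶ co ⊗ ob
  ev : ob ⊗ co ⟶ 𝟙_ C
  zig : ob ◁ η ≫ (α_ ob co ob).inv ≫ ev ▷ ob = (ρ_ ob).hom ≫ (λ_ ob).inv
  zag : η ▷ co ≫ (α_ co ob co).hom ≫ co ◁ ev = (λ_ co).hom ≫ (ρ_ co).inv

namespace DPair

/-- The pair `(A*, A)` given by the assigned dual. -/
abbrev of [LeftRigidCategory C] (A : C) : DPair C where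
  co := dual A
  ob := A
  η := coform A
  ev := form A
  zig := (LeftRigidCategory.leftDual A).exact.coevaluation_evaluation'
  zag := (LeftRigidCategory.leftDual A).exact.evaluation_coevaluation'

/-- `f'` is the transpose of `f`. -/
def IsMate (P Q : DPair C) (f : P.ob ⟶ Q.ob) (f' : Q.co ⟶ P.co) : Prop :=
  f ▷ Q.co ≫ Q.ev = P.ob ◁ f' ≫ P.ev

/-- The transpose of a morphism. -/
def mate (P Q : DPair C) (f : P.ob ⟶ Q.ob) : Q.co ⟶ P.co :=
  (λ_ _).inv ≫ P.η ▷ Q.co ≫ (P.co ◁ f) ▷ Q.co ≫ (α_ _ _ _).hom ≫ P.co ◁ Q.ev ≫ (ρ_ _).hom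

theorem isMate_mate (P Q : DPair C) (f : P.ob ⟶ Q.ob) : IsMate P Q f (mate P Q f) := by
  unfold IsMate mate
  symm
  calc _ = 𝟙 _ ⊗≫ P.ob ◁ P.η ▷ Q.co ⊗≫ ((P.ob ⊗ P.co) ◁ (f ▷ Q.co ≫ Q.ev) ≫ P.ev ▷ 𝟙_ C) ⊗≫ 𝟙 _ := by
        monoidal
    _ = 𝟙 _ ⊗≫ (P.ob ◁ P.η ≫ (α_ _ _ _).inv ≫ P.ev ▷ P.ob) ▷ Q.co ⊗≫ (f ▷ Q.co ≫ Q.ev) ⊗≫ 𝟙 _ := by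
        rw [whisker_exchange]; monoidal
    _ = _ := by rw [zig]; monoidal

theorem IsMate.eq_mate {P Q : DPair C} {f : P.ob ⟶ Q.ob} {f' : Q.co ⟶ P.co}
    (h : IsMate P Q f f') : f' = mate P Q f := by
  unfold IsMate at h
  unfold mate
  symm
  calc _ = 𝟙 _ ⊗≫ P.η ▷ Q.co ⊗≫ P.co ◁ (f ▷ Q.co ≫ Q.ev) ⊗≫ 𝟙 _ := by monoidal
    _ = 𝟙 _ ⊗≫ (P.η ▷ Q.co ≫ (P.co ⊗ P.ob) ◁ f') ⊗≫ P.co ◁ P.ev ⊗≫ 𝟙 _ := by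
        rw [h]; monoidal
    _ = 𝟙 _ ⊗≫ f' ⊗≫ (P.η ▷ P.co ≫ (α_ _ _ _).hom ≫ P.co ◁ P.ev) ⊗≫ 𝟙 _ := by
        rw [← whisker_exchange]; monoidal
    _ = _ := by rw [zag]; monoidal

/-- The transpose, characterised by the coforms instead of the forms. -/
theorem IsMate.η_comp {P Q : DPair C} {f : P.ob ⟶ Q.ob} {f' : Q.co ⟶ P.co}
    (h : IsMate P Q f f') : P.η ≫ P.co ◁ f = Q.η ≫ f' ▷ Q.ob := by
  rw [h.eq_mate]
  unfold mate
  symm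
  calc _ = 𝟙 _ ⊗≫ (𝟙_ C ◁ Q.η ≫ (P.η ≫ P.co ◁ f) ▷ (Q.co ⊗ Q.ob)) ⊗≫ P.co ◁ Q.ev ▷ Q.ob ⊗≫ 𝟙 _ := by
        monoidal
    _ = 𝟙 _ ⊗≫ (P.η ≫ P.co ◁ f) ⊗≫ P.co ◁ (Q.ob ◁ Q.η ≫ (α_ _ _ _).inv ≫ Q.ev ▷ Q.ob) ⊗≫ 𝟙 _ := by
        rw [whisker_exchange]; monoidal
    _ = _ := by rw [zig]; monoidal

theorem IsMate.id (P : DPair C) : IsMate P P (𝟙 _) (𝟙 _) := by simp [IsMate]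

theorem IsMate.comp {P Q R : DPair C} {f : P.ob ⟶ Q.ob} {f' : Q.co ⟶ P.co} {g : Q.ob ⟶ R.ob}
    {g' : R.co ⟶ Q.co} (hf : IsMate P Q f f') (hg : IsMate Q R g g') :
    IsMate P R (f ≫ g) (g' ≫ f') := by
  unfold IsMate at *
  rw [comp_whiskerRight, Category.assoc, hg, ← whisker_exchange_assoc, hf, MonoidalCategory.whiskerLeft_comp,
    Category.assoc]

theorem mate_comp (P Q R : DPair C) (f : P.ob ⟶ Q.ob) (g : Q.ob ⟶ R.ob) :
    mate P R (f ≫ g) = mate Q R g ≫ mate P Q f :=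
  ((isMate_mate P Q f).comp (isMate_mate Q R g)).eq_mate.symm

theorem mate_id (P : DPair C) : mate P P (𝟙 _) = 𝟙 _ := (IsMate.id P).eq_mate.symm

/-- The transposes of an isomorphism and of its inverse are inverse to each other. -/
theorem IsMate.of_iso {P Q : DPair C} (e : P.ob ≅ Q.ob) {f' : Q.co ⟶ P.co} {g' : P.co ⟶ Q.co}
    (hf : IsMate P Q e.hom f') (hg : IsMate Q P e.inv g') : g' ≫ f' = 𝟙 _ := by
  have h := (hf.comp hg)
  rw [Iso.hom_inv_id] at h
  rw [h.eq_mate, mate_id]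

theorem IsMate.inv {P Q : DPair C} {e : P.ob ≅ Q.ob} {e' : Q.co ≅ P.co}
    (h : IsMate P Q e.hom e'.hom) : IsMate Q P e.inv e'.inv := by
  unfold IsMate at *
  have h1 : P.ev = P.ob ◁ e'.inv ≫ e.hom ▷ Q.co ≫ Q.ev := by
    rw [h, ← MonoidalCategory.whiskerLeft_comp_assoc]
    simp
  rw [h1, ← whisker_exchange_assoc, ← comp_whiskerRight_assoc]
  simp

variable [SymmetricCategory C]

/-- In a symmetric category the interchange of the middle factors is its own inverse. -/
theorem _root_.QuinnInvariant.tensorδ_eq_tensorμ (X₁ X₂ Y₁ Y₂ : C) :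
    tensorδ X₁ X₂ Y₁ Y₂ = tensorμ X₁ Y₁ X₂ Y₂ := by
  simp [tensorμ, tensorδ, SymmetricCategory.braiding_swap_eq_inv_braiding X₂ Y₁]

@[simp]
theorem _root_.QuinnInvariant.tensorμ_tensorμ (X₁ X₂ Y₁ Y₂ : C) :
    tensorμ X₁ X₂ Y₁ Y₂ ≫ tensorμ X₁ Y₁ X₂ Y₂ = 𝟙 _ := by
  rw [← tensorδ_eq_tensorμ X₁ X₂ Y₁ Y₂, tensorμ_tensorδ]

@[simp]
theorem _root_.QuinnInvariant.tensorμ_tensorμ_assoc (X₁ X₂ Y₁ Y₂ : C) {Z : C}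
    (h : (X₁ ⊗ X₂) ⊗ (Y₁ ⊗ Y₂) ⟶ Z) :
    tensorμ X₁ X₂ Y₁ Y₂ ≫ tensorμ X₁ Y₁ X₂ Y₂ ≫ h = h := by
  rw [← Category.assoc, tensorμ_tensorμ, Category.id_comp]

instance _root_.QuinnInvariant.tensorμ_isIso (X₁ X₂ Y₁ Y₂ : C) : IsIso (tensorμ X₁ X₂ Y₁ Y₂) :=
  ⟨tensorμ X₁ Y₁ X₂ Y₂, by simp, by simp⟩

/-- The pair with the roles of the two objects exchanged. -/
abbrev swap (P : DPair C) : DPair C :=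
  letI : ExactPairing P.co P.ob := ⟨P.η, P.ev, P.zig, P.zag⟩
  letI := BraidedCategory.exactPairing_swap P.co P.ob
  { co := P.ob
    ob := P.co
    η := P.η ≫ (β_ P.ob P.co).inv
    ev := (β_ P.co P.ob).hom ≫ P.ev
    zig := ExactPairing.coevaluation_evaluation P.ob P.co
    zag := ExactPairing.evaluation_coevaluation P.ob P.co }

/-- The product of two objects with chosen duals, with dual `A* B*`. -/
abbrev tensor (P Q : DPair C) : DPair C where
  co := P.co ⊗ Q.co
  ob := P.ob ⊗ Q.ob
  η := (λ_ (𝟙_ C)).inv ≫ (P.η ⊗ₘ Q.η) ≫ tensorμ P.co P.ob Q.co Q.ob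
  ev := tensorμ P.ob Q.ob P.co Q.co ≫ (P.ev ⊗ₘ Q.ev) ≫ (λ_ (𝟙_ C)).hom
  zig := by
    have h1 : (P.ob ⊗ Q.ob) ◁ tensorμ P.co P.ob Q.co Q.ob ≫ (α_ _ _ _).inv ≫
        tensorμ P.ob Q.ob P.co Q.co ▷ (P.ob ⊗ Q.ob) =
        tensorμ P.ob Q.ob (P.co ⊗ P.ob) (Q.co ⊗ Q.ob) ≫
          ((α_ _ _ _).inv ⊗ₘ (α_ _ _ _).inv) ≫ tensorμ (P.ob ⊗ P.co) P.ob (Q.ob ⊗ Q.co) Q.ob := by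
      have h := tensor_associativity P.ob Q.ob P.co Q.co P.ob Q.ob
      rw [← cancel_mono (tensorμ (P.ob ⊗ P.co) (Q.ob ⊗ Q.co) P.ob Q.ob ≫
        ((α_ _ _ _).hom ⊗ₘ (α_ _ _ _).hom)), Category.assoc, Category.assoc, h]
      rw [Iso.inv_hom_id_assoc, ← MonoidalCategory.whiskerLeft_comp_assoc, tensorμ_tensorμ]
      simp
    have h2 := tensorμ_natural_right P.ob Q.ob P.η Q.η
    have h3 := tensorμ_natural_left P.ev Q.ev P.ob Q.ob
    have h3' : tensorμ (P.ob ⊗ P.co) P.ob (Q.ob ⊗ Q.co) Q.ob ≫ (P.ev ⊗ₘ Q.ev) ▷ (P.ob ⊗ Q.ob) =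
        (P.ev ▷ P.ob ⊗ₘ Q.ev ▷ Q.ob) ≫ tensorμ (𝟙_ C) P.ob (𝟙_ C) Q.ob := by
      rw [← cancel_epi (tensorμ (P.ob ⊗ P.co) (Q.ob ⊗ Q.co) P.ob Q.ob),
        tensorμ_tensorμ_assoc, ← cancel_mono (tensorμ (𝟙_ C) (𝟙_ C) P.ob Q.ob), h3]
      simp
    have h4 := tensor_right_unitality P.ob Q.ob
    have h5 := leftUnitor_monoidal P.ob Q.ob
    simp only [MonoidalCategory.whiskerLeft_comp, comp_whiskerRight, Category.assoc]
    rw [reassoc_of% h1, reassoc_of% h2, reassoc_of% h3', tensorHom_comp_tensorHom_assoc,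
      tensorHom_comp_tensorHom_assoc, Category.assoc, Category.assoc, P.zig, Q.zig, ← tensorHom_comp_tensorHom_assoc, h4,
      ← cancel_mono (λ_ (P.ob ⊗ Q.ob)).hom]
    simp only [Category.assoc, ← h5]
    simp
  zag := by
    have h1 : tensorμ P.co P.ob Q.co Q.ob ▷ (P.co ⊗ Q.co) ≫ (α_ _ _ _).hom ≫
        (P.co ⊗ Q.co) ◁ tensorμ P.ob Q.ob P.co Q.co =
        tensorμ (P.co ⊗ P.ob) (Q.co ⊗ Q.ob) P.co Q.co ≫
          ((α_ _ _ _).hom ⊗ₘ (α_ _ _ _).hom) ≫ tensorμ P.co (P.ob ⊗ P.co) Q.co (Q.ob ⊗ Q.co) := by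
      have h := tensor_associativity P.co Q.co P.ob Q.ob P.co Q.co
      rw [← cancel_mono (tensorμ P.co Q.co (P.ob ⊗ P.co) (Q.ob ⊗ Q.co)), Category.assoc,
        Category.assoc, ← h]
      rw [← comp_whiskerRight_assoc, tensorμ_tensorμ]
      simp
    have h2 := tensorμ_natural_left P.η Q.η P.co Q.co
    have h3 := tensorμ_natural_right P.co Q.co P.ev Q.ev
    have h3' : tensorμ P.co (P.ob ⊗ P.co) Q.co (Q.ob ⊗ Q.co) ≫ (P.co ⊗ Q.co) ◁ (P.ev ⊗ₘ Q.ev) =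
        (P.co ◁ P.ev ⊗ₘ Q.co ◁ Q.ev) ≫ tensorμ P.co (𝟙_ C) Q.co (𝟙_ C) := by
      rw [← cancel_epi (tensorμ P.co Q.co (P.ob ⊗ P.co) (Q.ob ⊗ Q.co)),
        tensorμ_tensorμ_assoc, ← cancel_mono (tensorμ P.co Q.co (𝟙_ C) (𝟙_ C)), h3]
      simp
    have h4 := tensor_left_unitality P.co Q.co
    have h5 := rightUnitor_monoidal P.co Q.co
    simp only [MonoidalCategory.whiskerLeft_comp, comp_whiskerRight, Category.assoc]
    rw [reassoc_of% h1, reassoc_of% h2, reassoc_of% h3', tensorHom_comp_tensorHom_assoc,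
      tensorHom_comp_tensorHom_assoc, Category.assoc, Category.assoc, P.zag, Q.zag,
      ← tensorHom_comp_tensorHom_assoc, h4, ← cancel_mono (ρ_ (P.co ⊗ Q.co)).hom]
    simp only [Category.assoc, ← h5]
    simp

theorem IsMate.tensor {P P' Q Q' : DPair C} {f : P.ob ⟶ P'.ob} {f' : P'.co ⟶ P.co}
    {g : Q.ob ⟶ Q'.ob} {g' : Q'.co ⟶ Q.co} (hf : IsMate P P' f f') (hg : IsMate Q Q' g g') :
    IsMate (P.tensor Q) (P'.tensor Q') (f ⊗ₘ g) (f' ⊗ₘ g') := by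
  unfold IsMate at *
  change (f ⊗ₘ g) ▷ (P'.co ⊗ Q'.co) ≫ tensorμ P'.ob Q'.ob P'.co Q'.co ≫ (P'.ev ⊗ₘ Q'.ev) ≫
    (λ_ (𝟙_ C)).hom = (P.ob ⊗ Q.ob) ◁ (f' ⊗ₘ g') ≫ tensorμ P.ob Q.ob P.co Q.co ≫
    (P.ev ⊗ₘ Q.ev) ≫ (λ_ (𝟙_ C)).hom
  rw [tensorμ_natural_left_assoc, tensorμ_natural_right_assoc, tensorHom_comp_tensorHom_assoc,
    tensorHom_comp_tensorHom_assoc, hf, hg]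

/-- The unit object as its own dual. -/
abbrev unit : DPair C where
  co := 𝟙_ C
  ob := 𝟙_ C
  η := (ρ_ _).inv
  ev := (ρ_ _).hom
  zig := by monoidal_coherence
  zag := by monoidal_coherence

end DPair
end DualPairs

end

/-! ### Open morphisms and their names -/

section

section OpenMorphisms

variable {C : Type u} [Category.{v} C] [MonoidalCategory C]

/-- The composite of two open morphisms along the free strand. -/
def openComp {b b₁ b₂ A B : C} (F : b ⊗ A ⟶ A ⊗ b₁) (G : b₁ ⊗ B ⟶ B ⊗ b₂) :
    b ⊗ (A ⊗ B) ⟶ (A ⊗ B) ⊗ b₂ :=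
  (α_ b A B).inv ≫ F ▷ B ≫ (α_ A b₁ B).hom ≫ A ◁ G ≫ (α_ A B b₂).inv

variable [SymmetricCategory C]

/-- The coform of a product. -/
def coformTensor {A' A B' B : C} (η : 𝟙_ C ⟶ A' ⊗ A) (η' : 𝟙_ C ⟶ B' ⊗ B) :
    𝟙_ C ⟶ (A' ⊗ B') ⊗ (A ⊗ B) :=
  (λ_ (𝟙_ C)).inv ≫ (η ⊗ₘ η') ≫ tensorμ A' A B' B

/-- The name of an open morphism `b ⋄ A ⟶ A ⋄ b`: the input `A` is joined to a new output `A*`. -/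
def openName {A' A B b b₁ : C} (η : 𝟙_ C ⟶ A' ⊗ A) (F : b ⊗ A ⟶ B ⊗ b₁) : b ⟶ (A' ⊗ B) ⊗ b₁ :=
  (λ_ b).inv ≫ η ▷ b ≫ (α_ _ _ _).hom ≫ A' ◁ ((β_ A b).hom ≫ F) ≫ (α_ _ _ _).inv

/-- The effect of an open morphism on names: the strand `b` passes through it, and the factor
`B* B` which arises is merged into `A* A`. -/
def openStep (A' A : C) {B' B D b b₁ : C} (η : 𝟙_ C ⟶ B' ⊗ B) (G : b ⊗ B ⟶ D ⊗ b₁) :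
    (A' ⊗ A) ⊗ b ⟶ ((A' ⊗ B') ⊗ (A ⊗ D)) ⊗ b₁ :=
  (A' ⊗ A) ◁ openName η G ≫ (α_ _ _ _).inv ≫ tensorμ A' A B' D ▷ b₁

/-- An object passes a coform from either side. -/
theorem cup_braiding {B' B : C} (η : 𝟙_ C ⟶ B' ⊗ B) (b : C) :
    (λ_ b).inv ≫ η ▷ b ≫ (α_ _ _ _).hom ≫ B' ◁ (β_ B b).hom =
      (ρ_ b).inv ≫ b ◁ η ≫ (α_ _ _ _).inv ≫ (β_ b B').hom ▷ B ≫ (α_ _ _ _).hom := by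
  have h := BraidedCategory.braiding_naturality_left η b
  rw [BraidedCategory.braiding_tensor_left_hom] at h
  have h2 : (β_ B' b).hom ≫ (β_ b B').hom = 𝟙 _ := SymmetricCategory.symmetry _ _
  have h' := congrArg (fun t => (λ_ b).inv ≫ t ≫ (α_ _ _ _).inv ≫ (β_ b B').hom ▷ B ≫
    (α_ _ _ _).hom) h
  simp only [Category.assoc, Iso.hom_inv_id_assoc, ← comp_whiskerRight_assoc, h2] at h'
  simpa using h'

/-- The name of a composite of open morphisms is computed by letting the strand pass through the
second one. -/
theorem openName_openComp {A' A B' B b b₁ b₂ : C} (η : 𝟙_ C ⟶ A' ⊗ A) (η' : 𝟙_ C ⟶ B' ⊗ B)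
    (F : b ⊗ A ⟶ A ⊗ b₁) (G : b₁ ⊗ B ⟶ B ⊗ b₂) :
    openName (coformTensor η η') (openComp F G) = openName η F ≫ openStep A' A η' G := by
  have hins : ∀ c : C, (A ◁ (λ_ c).inv ≫ A ◁ η' ▷ c) ⊗≫ (β_ A B').hom ▷ (B ⊗ c) ⊗≫
      (B' ⊗ A) ◁ (β_ B c).hom =
      (ρ_ (A ⊗ c)).inv ≫ (A ⊗ c) ◁ η' ≫ (α_ _ _ _).inv ≫ (β_ (A ⊗ c) B').hom ▷ B ⊗≫ 𝟙 _ := by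
    intro c
    calc _ = (A ◁ (λ_ c).inv ≫ A ◁ η' ▷ c) ⊗≫ ((β_ A B').hom ▷ (B ⊗ c) ≫
          (B' ⊗ A) ◁ (β_ B c).hom) := by monoidal
      _ = A ◁ ((λ_ c).inv ≫ η' ▷ c ≫ (α_ _ _ _).hom ≫ B' ◁ (β_ B c).hom) ⊗≫
          (β_ A B').hom ▷ (c ⊗ B) := by rw [← whisker_exchange]; monoidal
      _ = _ := by rw [cup_braiding, BraidedCategory.braiding_tensor_left_hom]; monoidal
  unfold openName openStep openName openComp coformTensor tensorμ
  rw [BraidedCategory.braiding_tensor_left_hom, MonoidalCategory.tensorHom_def]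
  calc _ = 𝟙 _ ⊗≫ η ▷ b ⊗≫ A' ◁ ((A ◁ (λ_ b).inv ≫ A ◁ η' ▷ b) ⊗≫ (β_ A B').hom ▷ (B ⊗ b) ⊗≫
        (B' ⊗ A) ◁ (β_ B b).hom) ⊗≫
        (A' ⊗ B') ◁ (((β_ A b).hom ≫ F) ▷ B) ⊗≫ (A' ⊗ B' ⊗ A) ◁ G ⊗≫ 𝟙 _ := by monoidal
    _ = 𝟙 _ ⊗≫ η ▷ b ⊗≫ A' ◁ ((A ⊗ b) ◁ η' ⊗≫
        ((β_ (A ⊗ b) B').hom ≫ B' ◁ ((β_ A b).hom ≫ F)) ▷ B) ⊗≫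
        (A' ⊗ B' ⊗ A) ◁ G ⊗≫ 𝟙 _ := by
      rw [hins]; monoidal
    _ = 𝟙 _ ⊗≫ η ▷ b ⊗≫ A' ◁ ((A ⊗ b) ◁ η' ≫ ((β_ A b).hom ≫ F) ▷ (B' ⊗ B)) ⊗≫
        A' ◁ ((β_ (A ⊗ b₁) B').hom ▷ B) ⊗≫ (A' ⊗ B' ⊗ A) ◁ G ⊗≫ 𝟙 _ := by
      rw [← BraidedCategory.braiding_naturality_left]; monoidal
    _ = 𝟙 _ ⊗≫ η ▷ b ⊗≫ A' ◁ ((β_ A b).hom ≫ F) ⊗≫ A' ◁ ((ρ_ (A ⊗ b₁)).inv ≫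
        (A ⊗ b₁) ◁ η' ≫ (α_ _ _ _).inv ≫ (β_ (A ⊗ b₁) B').hom ▷ B ⊗≫ 𝟙 ((B' ⊗ A) ⊗ b₁ ⊗ B)) ⊗≫
        (A' ⊗ B' ⊗ A) ◁ G ⊗≫ 𝟙 _ := by
      rw [whisker_exchange]; monoidal
    _ = 𝟙 _ ⊗≫ η ▷ b ⊗≫ A' ◁ ((β_ A b).hom ≫ F) ⊗≫ A' ◁ A ◁ η' ▷ b₁ ⊗≫
        A' ◁ ((β_ A B').hom ▷ (B ⊗ b₁) ≫ (B' ⊗ A) ◁ ((β_ B b₁).hom ≫ G)) ⊗≫ 𝟙 _ := by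
      rw [← hins]; monoidal
    _ = _ := by rw [← whisker_exchange]; monoidal

/-- Steps compose along the free strand. -/
theorem openStep_comp (A' A : C) {B' B D' D b b₁ b₂ : C} (η : 𝟙_ C ⟶ B' ⊗ B)
    (η' : 𝟙_ C ⟶ D' ⊗ D) (F : b ⊗ B ⟶ B ⊗ b₁) (G : b₁ ⊗ D ⟶ D ⊗ b₂) :
    openStep A' A η F ≫ openStep (A' ⊗ B') (A ⊗ B) η' G =
      openStep A' A (coformTensor η η') (openComp F G) ≫
        ((α_ A' B' D').inv ⊗ₘ (α_ A B D).inv) ▷ b₂ := by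
  have h := tensor_associativity A' A B' B D' D
  have h' : tensorμ A' A B' B ▷ (D' ⊗ D) ≫ tensorμ (A' ⊗ B') (A ⊗ B) D' D =
      (α_ (A' ⊗ A) (B' ⊗ B) (D' ⊗ D)).hom ≫ ((A' ⊗ A) ◁ tensorμ B' B D' D) ≫
        tensorμ A' A (B' ⊗ D') (B ⊗ D) ≫ ((α_ A' B' D').inv ⊗ₘ (α_ A B D).inv) := by
    rw [← cancel_mono ((α_ A' B' D').hom ⊗ₘ (α_ A B D).hom), Category.assoc, h]
    simp
  calc _ = 𝟙 _ ⊗≫ (A' ⊗ A) ◁ openName η F ⊗≫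
        (tensorμ A' A B' B ▷ b₁ ≫ ((A' ⊗ B') ⊗ (A ⊗ B)) ◁ openName η' G) ⊗≫
        tensorμ (A' ⊗ B') (A ⊗ B) D' D ▷ b₂ := by unfold openStep; monoidal
    _ = 𝟙 _ ⊗≫ (A' ⊗ A) ◁ openName η F ⊗≫ (A' ⊗ A) ◁ (B' ⊗ B) ◁ openName η' G ⊗≫
        (tensorμ A' A B' B ▷ (D' ⊗ D) ≫ tensorμ (A' ⊗ B') (A ⊗ B) D' D) ▷ b₂ := by
      rw [← whisker_exchange]; monoidal
    _ = 𝟙 _ ⊗≫ (A' ⊗ A) ◁ (openName η F ≫ openStep B' B η' G) ⊗≫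
        (tensorμ A' A (B' ⊗ D') (B ⊗ D) ≫ ((α_ A' B' D').inv ⊗ₘ (α_ A B D).inv)) ▷ b₂ := by
      rw [h']; unfold openStep; monoidal
    _ = _ := by rw [← openName_openComp]; unfold openStep; monoidal

/-- Transport of a name along morphisms of both of its factors. -/
theorem openName_natural {A' A D' D b b₁ : C} (η : 𝟙_ C ⟶ A' ⊗ A) (f' : A' ⟶ D') (f : A ⟶ D)
    (F : b ⊗ D ⟶ A ⊗ b₁) :
    openName (η ≫ (f' ⊗ₘ f)) (F ≫ f ▷ b₁) =
      openName η (b ◁ f ≫ F) ≫ (f' ⊗ₘ f) ▷ b₁ := by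
  unfold openName
  rw [MonoidalCategory.tensorHom_def]
  calc _ = 𝟙 _ ⊗≫ η ▷ b ⊗≫ f' ▷ A ▷ b ⊗≫ D' ◁ (f ▷ b ≫ (β_ D b).hom) ⊗≫ D' ◁ (F ≫ f ▷ b₁) ⊗≫ 𝟙 _ := by
        monoidal
    _ = 𝟙 _ ⊗≫ η ▷ b ⊗≫ (f' ▷ (A ⊗ b) ≫ D' ◁ ((β_ A b).hom ≫ b ◁ f ≫ F)) ⊗≫
        D' ◁ f ▷ b₁ ⊗≫ 𝟙 _ := by
      rw [BraidedCategory.braiding_naturality_left]; monoidal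
    _ = _ := by rw [← whisker_exchange]; monoidal

/-- The mixed form of a name, in which the output of the open morphism is changed. -/
theorem openName_comp_whiskerRight {A' A B D b b₁ : C} (η : 𝟙_ C ⟶ A' ⊗ A)
    (F : b ⊗ A ⟶ B ⊗ b₁) (f : B ⟶ D) :
    openName η (F ≫ f ▷ b₁) = openName η F ≫ (A' ◁ f) ▷ b₁ := by
  unfold openName
  monoidal

/-- A morphism in front of the input is slid around the loop, where it becomes its transpose. -/
theorem openName_mate {P Q : DPair C} {f : P.ob ⟶ Q.ob} {f' : Q.co ⟶ P.co}
    (h : DPair.IsMate P Q f f') {B b b₁ : C} (F : b ⊗ Q.ob ⟶ B ⊗ b₁) :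
    openName Q.η F ≫ (f' ▷ B) ▷ b₁ = openName P.η (b ◁ f ≫ F) := by
  have e := h.η_comp
  calc _ = 𝟙 _ ⊗≫ (Q.η ▷ b ⊗≫ (Q.co ◁ ((β_ Q.ob b).hom ≫ F) ≫ f' ▷ (B ⊗ b₁))) ⊗≫ 𝟙 _ := by
        unfold openName; monoidal
    _ = 𝟙 _ ⊗≫ (Q.η ≫ f' ▷ Q.ob) ▷ b ⊗≫ P.co ◁ ((β_ Q.ob b).hom ≫ F) ⊗≫ 𝟙 _ := by
        rw [whisker_exchange]; monoidal
    _ = 𝟙 _ ⊗≫ P.η ▷ b ⊗≫ P.co ◁ ((f ▷ b ≫ (β_ Q.ob b).hom) ≫ F) ⊗≫ 𝟙 _ := by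
        rw [← e]; monoidal
    _ = _ := by rw [BraidedCategory.braiding_naturality_left]; unfold openName; monoidal

end OpenMorphisms

end

/-! ### The reverse of an open morphism -/

section

section Reverse

variable {C : Type u} [Category.{v} C] [MonoidalCategory C] [LeftRigidCategory C]
  [SymmetricCategory C]

/-- The factors `b* b` that arise when the strand of the reverse of `F` passes a further
factor `b`. -/
def reverseUnit (b B : C) (F : dual b ⊗ B ⟶ B ⊗ dual b) : B ⟶ (B ⊗ dual b) ⊗ b :=
  (ρ_ B).inv ≫ B ◁ coform b ≫ (α_ _ _ _).inv ≫ ((β_ B (dual b)).hom ≫ F) ▷ b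

/-- The free strand `b` is joined to a factor `b*`, and a factor `b` becomes the free strand. -/
def reverseCounit (b B : C) : b ⊗ ((B ⊗ dual b) ⊗ b) ⟶ B ⊗ b :=
  (α_ _ _ _).inv ≫ (b ◁ (β_ B (dual b)).hom ≫ (α_ _ _ _).inv ≫ form b ▷ B ≫ (λ_ B).hom) ▷ b

/-- The two halves of the reverse of `F`. -/
theorem reverseUnit_counit (b B : C) (F : dual b ⊗ B ⟶ B ⊗ dual b) :
    b ◁ reverseUnit b B F ≫ reverseCounit b B = reverse b B F := by
  unfold reverseUnit reverseCounit reverse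
  monoidal

/-- Composing the reverse with one more factor `b` cancels a factor `b*`: up to the order of the two
halves, this is the reverse of the shorter open morphism. -/
theorem reverse_openComp (b B : C) (F : dual b ⊗ B ⟶ B ⊗ dual b) :
    openComp (reverse b _ ((α_ _ _ _).inv ≫ F ▷ dual b)) (𝟙 (b ⊗ b)) =
      reverseCounit b B ≫ reverseUnit b B F ▷ b := by
  have key : ∀ d : C, ∀ F : d ⊗ B ⟶ B ⊗ d, (β_ (B ⊗ d) d).hom ≫ (α_ d B d).inv ≫ F ▷ d ≫
      (β_ (B ⊗ d) d).hom = (β_ B d).hom ▷ d ≫ (α_ _ _ _).hom ≫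
      d ◁ ((β_ B d).hom ≫ F) := by
    intro d F
    have h1 : (β_ d d).hom ≫ (β_ d d).hom = 𝟙 _ := SymmetricCategory.symmetry _ _
    calc _ = 𝟙 _ ⊗≫ B ◁ (β_ d d).hom ⊗≫ (((β_ B d).hom ≫ F) ▷ d ≫ (β_ (B ⊗ d) d).hom) := by
          rw [BraidedCategory.braiding_tensor_left_hom B d d]; monoidal
      _ = 𝟙 _ ⊗≫ B ◁ ((β_ d d).hom ≫ (β_ d d).hom) ⊗≫ (β_ B d).hom ▷ d ⊗≫
          d ◁ ((β_ B d).hom ≫ F) := by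
          rw [BraidedCategory.braiding_naturality_left, BraidedCategory.braiding_tensor_left_hom B d d]
          monoidal
      _ = _ := by rw [h1]; monoidal
  unfold reverse openComp
  calc _ = 𝟙 _ ⊗≫ (b ⊗ (B ⊗ dual b)) ◁ coform b ▷ b ⊗≫
        b ◁ ((β_ (B ⊗ dual b) (dual b)).hom ≫ (α_ (dual b) B (dual b)).inv ≫ F ▷ dual b ≫
          (β_ (B ⊗ dual b) (dual b)).hom) ▷ b ▷ b ⊗≫ form b ▷ (B ⊗ dual b) ▷ b ▷ b ⊗≫ 𝟙 _ := by
        monoidal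
    _ = 𝟙 _ ⊗≫ ((b ⊗ (B ⊗ dual b)) ◁ coform b ≫
        (b ◁ (β_ B (dual b)).hom) ▷ (dual b ⊗ b)) ▷ b ⊗≫
          ((b ⊗ dual b) ◁ ((β_ B (dual b)).hom ≫ F) ≫ form b ▷ (B ⊗ dual b)) ▷ b ▷ b ⊗≫ 𝟙 _ := by
        rw [key]; monoidal
    _ = 𝟙 _ ⊗≫ (b ◁ (β_ B (dual b)).hom) ▷ b ⊗≫ ((b ⊗ dual b) ◁ (B ◁ coform b) ≫
        form b ▷ (B ⊗ dual b ⊗ b)) ▷ b ⊗≫ ((β_ B (dual b)).hom ≫ F) ▷ b ▷ b ⊗≫ 𝟙 _ := by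
        rw [whisker_exchange, whisker_exchange]; monoidal
    _ = _ := by
        rw [whisker_exchange]; unfold reverseUnit reverseCounit; monoidal

/-- The reverse of the open morphism without factors is the open morphism without factors. -/
theorem reverse_unit (b : C) :
    reverse b (𝟙_ C) ((ρ_ _).hom ≫ (λ_ _).inv) = (ρ_ b).hom ≫ (λ_ b).inv := by
  have h := (DPair.of b).zig
  simp only [DPair.of] at h
  unfold reverse
  have h2 : (β_ (𝟙_ C) (dual b)).hom = (λ_ _).hom ≫ (ρ_ _).inv := by simp
  rw [h2]
  calc _ = 𝟙 (b ⊗ 𝟙_ C) ⊗≫ (b ◁ coform b ≫ (α_ b (dual b) b).inv ≫ form b ▷ b) ⊗≫ 𝟙 (𝟙_ C ⊗ b) := by monoidal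
    _ = _ := by rw [h]; monoidal

end Reverse

end

/-! ### Dual bases, ranks and the universal dinatural map -/

section

/-- The form is determined by the coform. -/
theorem ev_unique {C : Type u} [Category.{v} C] [MonoidalCategory C] {A' A : C}
    (η : 𝟙_ C ⟶ A' ⊗ A) (ev ev' : A ⊗ A' ⟶ 𝟙_ C)
    (zag : η ▷ A' ≫ (α_ A' A A').hom ≫ A' ◁ ev = (λ_ A').hom ≫ (ρ_ A').inv)
    (zig : A ◁ η ≫ (α_ A A' A).inv ≫ ev' ▷ A = (ρ_ A).hom ≫ (λ_ A).inv) : ev = ev' := by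
  symm
  calc _ = 𝟙 _ ⊗≫ A ◁ ((λ_ A').hom ≫ (ρ_ A').inv) ⊗≫ ev' := by monoidal
    _ = 𝟙 _ ⊗≫ A ◁ η ▷ A' ⊗≫ ((A ⊗ A') ◁ ev ≫ ev' ▷ 𝟙_ C) ⊗≫ 𝟙 _ := by rw [← zag]; monoidal
    _ = 𝟙 _ ⊗≫ (A ◁ η ≫ (α_ A A' A).inv ≫ ev' ▷ A) ▷ A' ⊗≫ ev ⊗≫ 𝟙 _ := by
      rw [whisker_exchange]; monoidal
    _ = _ := by rw [zig]; monoidal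

/-- Every morphism `A A* ⟶ 1` is the form preceded by an endomorphism of `A*`. -/
theorem DPair.eq_whisker_ev {C : Type u} [Category.{v} C] [MonoidalCategory C] (P : DPair C)
    (f : P.ob ⊗ P.co ⟶ 𝟙_ C) :
    f = P.ob ◁ ((λ_ _).inv ≫ P.η ▷ P.co ≫ (α_ _ _ _).hom ≫ P.co ◁ f ≫ (ρ_ _).hom) ≫ P.ev := by
  symm
  calc _ = 𝟙 _ ⊗≫ P.ob ◁ P.η ▷ P.co ⊗≫ ((P.ob ⊗ P.co) ◁ f ≫ P.ev ▷ 𝟙_ C) ⊗≫ 𝟙 _ := by monoidal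
    _ = 𝟙 _ ⊗≫ (P.ob ◁ P.η ≫ (α_ _ _ _).inv ≫ P.ev ▷ P.ob) ▷ P.co ⊗≫ f ⊗≫ 𝟙 _ := by
      rw [whisker_exchange]; monoidal
    _ = _ := by rw [P.zig]; monoidal

/-- In a stable category the form of `A*` is the form of `A` composed with the symmetry. -/
theorem formDual_eq {C : Type u} [Category.{v} C] [MonoidalCategory C] [LeftRigidCategory C]
    [SymmetricCategory C] [Stable C] (A : C) : formDual A = (β_ (dual A) A).hom ≫ form A := by
  have h := Stable.coform_braiding A
  have h1 := (DPair.of (dual A)).zig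
  have h2 := (DPair.of A).swap.zag
  simp only [DPair.of] at h1
  have e : (DPair.of A).swap.η = coform (dual A) ≫ eqToHom (Stable.dual_dual A) ▷ dual A := by
    rw [← h]
    simp [DPair.swap, DPair.of, SymmetricCategory.braiding_swap_eq_inv_braiding A (dual A)]
  have e2 : (DPair.of A).swap.ev = (β_ (dual A) A).hom ≫ form A := by
    simp [DPair.swap, DPair.of]
  rw [← e2]
  refine (ev_unique (DPair.of A).swap.η _ _ h2 ?_).symm
  rw [e]
  change dual A ◁ (coform (dual A) ≫ eqToHom (Stable.dual_dual A) ▷ dual A) ≫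
    (α_ (dual A) A (dual A)).inv ≫ (dual A ◁ eqToHom (Stable.dual_dual A).symm ≫
      form (dual A)) ▷ dual A = (ρ_ (dual A)).hom ≫ (λ_ (dual A)).inv
  rw [← h1]
  calc _ = 𝟙 _ ⊗≫ dual A ◁ coform (dual A) ⊗≫ dual A ◁ (eqToHom (Stable.dual_dual A) ≫
        eqToHom (Stable.dual_dual A).symm) ▷ dual A ⊗≫ form (dual A) ▷ dual A := by monoidal
    _ = _ := by rw [eqToHom_trans, eqToHom_refl]; monoidal

theorem DPair.mate_smul {K : Type w} [Field K] {C : Type u} [Category.{v} C] [Preadditive C]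
    [Linear K C] [MonoidalCategory C] [MonoidalPreadditive C] [MonoidalLinear K C] (P Q : DPair C)
    (r : K) (f : P.ob ⟶ Q.ob) : DPair.mate P Q (r • f) = r • DPair.mate P Q f := by
  simp [DPair.mate]

theorem DPair.mate_sum {C : Type u} [Category.{v} C] [Preadditive C] [MonoidalCategory C]
    [MonoidalPreadditive C] (P Q : DPair C) {ι : Type*} (s : Finset ι)
    (f : ι → (P.ob ⟶ Q.ob)) : DPair.mate P Q (∑ i ∈ s, f i) = ∑ i ∈ s, DPair.mate P Q (f i) := by
  simp [DPair.mate, whiskerLeft_sum, sum_whiskerRight, Preadditive.comp_sum, Preadditive.sum_comp]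

variable {K : Type w} [Field K] {C : Type u} [Category.{v} C] [Abelian C] [Linear K C]
  [MonoidalCategory C] [LeftRigidCategory C]

namespace Simples

variable (S : Simples K C)

attribute [local instance] Abelian.hasFiniteBiproducts

theorem exists_smul_id (a : S.Obj) (f : (a : C) ⟶ a) : ∃ r : K, f = r • 𝟙 (a : C) := by
  obtain ⟨r, hr⟩ := (S.smul_id_bijective a).2 f
  exact ⟨r, by rw [← hr]; simp⟩

theorem hom_eq_zero' {a b : S.Obj} (h : a ≠ b) (f : (a : C) ⟶ b) : f = 0 :=
  S.hom_eq_zero _ a.2 _ b.2 (fun e => h (Subtype.ext e)) f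

/-- A morphism is determined by its composites with morphisms from simple objects. -/
theorem hom_ext {A B : C} {f g : A ⟶ B} (h : ∀ (a : S.Obj) (k : (a : C) ⟶ A), k ≫ f = k ≫ g) :
    f = g := by
  obtain ⟨n, c, ⟨e⟩⟩ := S.decomposes A
  rw [← cancel_epi e.inv]
  refine biproduct.hom_ext' _ _ fun i => ?_
  simpa using h (c i) (biproduct.ι (fun i => (c i : C)) i ≫ e.inv)

/-- Expansion of a morphism from a simple object in the chosen basis. -/
theorem sum_comp_basis (a : S.Obj) {A : C} (g : (a : C) ⟶ A) :
    ∑ i, (g ≫ (S.basis a A).ε' i) ≫ (S.basis a A).ε i = g := by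
  let B := S.basis a A
  have h : ∀ g : (a : C) ⟶ A, g ∈ Submodule.span K (Set.range B.ε) := fun g => by
    rw [B.ε.span_eq]; trivial
  refine Submodule.span_induction (p := fun g _ => ∑ i, (g ≫ B.ε' i) ≫ B.ε i = g)
    ?_ ?_ ?_ ?_ (h g)
  · rintro _ ⟨j, rfl⟩
    rw [Finset.sum_eq_single j]
    · rw [B.dual_eq]; simp
    · intro i _ hi
      rw [B.dual_eq, if_neg hi, zero_comp]
    · simp
  · simp
  · intro x y _ _ hx hy
    simp only [Preadditive.add_comp, Finset.sum_add_distrib, hx, hy]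
  · intro r x _ hx
    simp only [Linear.smul_comp, ← Finset.smul_sum, hx]

/-- The resolution of the identity by simple objects. -/
theorem sum_basis (A : C) :
    ∑ a : S.Obj, ∑ i, (S.basis a A).ε' i ≫ (S.basis a A).ε i = 𝟙 A := by
  refine S.hom_ext fun a k => ?_
  rw [Preadditive.comp_sum, Finset.sum_eq_single a]
  · rw [Preadditive.comp_sum]
    simpa using S.sum_comp_basis a k
  · intro b _ hb
    rw [Preadditive.comp_sum]
    refine Finset.sum_eq_zero fun i _ => ?_
    rw [← Category.assoc, S.hom_eq_zero' hb.symm (k ≫ _), zero_comp]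
  · simp

theorem sum_basis_comp (a : S.Obj) {A : C} (g : A ⟶ (a : C)) :
    ∑ i, (S.basis a A).ε' i ≫ ((S.basis a A).ε i ≫ g) = g := by
  conv_rhs => rw [← Category.id_comp g, ← S.sum_basis A, Preadditive.sum_comp]
  rw [Finset.sum_eq_single a]
  · rw [Preadditive.sum_comp]; simp
  · intro b _ hb
    rw [Preadditive.sum_comp]
    refine Finset.sum_eq_zero fun i _ => ?_
    rw [Category.assoc, S.hom_eq_zero' hb (_ ≫ g), comp_zero]
  · simp

instance finite_hom (a : S.Obj) (A : C) : Module.Finite K ((a : C) ⟶ A) :=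
  Module.Finite.of_basis (S.basis a A).ε

theorem star_injective [SymmetricCategory C] [Stable C] : Function.Injective S.star := by
  intro a b h
  have h' : dual (a : C) = dual (b : C) := congrArg Subtype.val h
  refine Subtype.ext ?_
  rw [← Stable.dual_dual (a : C), h', Stable.dual_dual]

variable [MonoidalPreadditive C] [MonoidalLinear K C] [SymmetricCategory C]

theorem coform_ne_zero (b : S.Obj) : coform (b : C) ≠ 0 := by
  intro h
  have h1 := (DPair.of (b : C)).zig
  simp only [DPair.of, h, MonoidalPreadditive.whiskerLeft_zero, zero_comp] at h1
  refine S.id_ne_zero b ?_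
  have h3 : 𝟙 (b : C) = (ρ_ _).inv ≫ ((ρ_ _).hom ≫ (λ_ _).inv) ≫ (λ_ _).hom := by simp
  rw [h3, ← h1]; simp

/-- If the rank of `b` vanished, every morphism `b* b ⟶ 1` would vanish on the coform, since these
morphisms are multiples of the form; by semisimplicity the coform would be zero. -/
theorem rank_ne_zero [Stable C] (b : S.Obj) : S.rank (b : C) ≠ 0 := by
  intro h
  have h0 : coform (b : C) ≫ formDual (b : C) = 0 := by
    unfold rank at h
    simpa using h
  have hall : ∀ f : dual (b : C) ⊗ (b : C) ⟶ 𝟙_ C, coform (b : C) ≫ f = 0 := by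
    intro f
    have e1 := (DPair.of (b : C)).swap.eq_whisker_ev f
    obtain ⟨r, hr⟩ := S.exists_smul_id b ((λ_ _).inv ≫ (DPair.of (b : C)).swap.η ▷ (b : C) ≫
      (α_ _ _ _).hom ≫ (b : C) ◁ f ≫ (ρ_ _).hom)
    have e2 : (DPair.of (b : C)).swap.ev = formDual (b : C) := by
      rw [formDual_eq]
    have e : f = r • formDual (b : C) := by
      refine e1.trans ((congrArg₂ (fun s t => dual (b : C) ◁ s ≫ t) hr e2).trans ?_)
      rw [MonoidalLinear.whiskerLeft_smul, MonoidalCategory.whiskerLeft_id,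
        Linear.smul_comp, Category.id_comp]
    rw [e, Linear.comp_smul, h0, smul_zero]
  refine S.coform_ne_zero b ?_
  have := S.sum_comp_basis S.unit (coform (b : C))
  rw [← this]
  refine Finset.sum_eq_zero fun i _ => ?_
  have : coform (b : C) ≫ (S.basis S.unit (dual (b : C) ⊗ (b : C))).ε' i = 0 := hall _
  exact (congrArg (· ≫ _) this).trans zero_comp

/-- The pair `(x, x*)`. -/
abbrev pair (x : S.Obj) : DPair C := (DPair.of (x : C)).swap

/-- The index set of the chosen basis of `F(x*, A)`. -/
abbrev Idx (x : S.Obj) (A : C) : Type := (S.basis (S.star x) A).ι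

/-- The chosen basis of `F(x*, A)`. -/
def eps (x : S.Obj) (A : C) (i : S.Idx x A) : dual (x : C) ⟶ A := (S.basis (S.star x) A).ε i

/-- The chosen dual basis of `F(A, x*)`. -/
def eps' (x : S.Obj) (A : C) (i : S.Idx x A) : A ⟶ dual (x : C) := (S.basis (S.star x) A).ε' i

theorem sum_comp_eps (x : S.Obj) {A : C} (g : dual (x : C) ⟶ A) :
    ∑ i, (g ≫ S.eps' x A i) ≫ S.eps x A i = g :=
  S.sum_comp_basis (S.star x) g

theorem sum_eps_comp (x : S.Obj) {A : C} (g : A ⟶ dual (x : C)) :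
    ∑ i, S.eps' x A i ≫ (S.eps x A i ≫ g) = g :=
  S.sum_basis_comp (S.star x) g

theorem exists_smul_id_dual (x : S.Obj) (f : dual (x : C) ⟶ dual (x : C)) :
    ∃ r : K, f = r • 𝟙 (dual (x : C)) :=
  S.exists_smul_id (S.star x) f

/-- The resolution of the identity, indexed by the duals of the simple objects. -/
theorem sum_eps [Stable C] (A : C) : ∑ x : S.Obj, ∑ i, S.eps' x A i ≫ S.eps x A i = 𝟙 A := by
  rw [← S.sum_basis A]
  have hb : Function.Bijective S.star := Finite.injective_iff_bijective.mp S.star_injective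
  exact Fintype.sum_bijective S.star hb _ _ fun x => rfl

/-- The transpose `A* ⟶ x` of a morphism `x* ⟶ A`. -/
def transpose (P : DPair C) (x : S.Obj) (f : dual (x : C) ⟶ P.ob) : P.co ⟶ (x : C) :=
  DPair.mate (S.pair x) P f

/-- The component at `x` of the universal dinatural map `A* A ⟶ ⊕_x x x*`: the sum over a basis
`ε_i` of `F(x*, A)` of the products of the transpose of `ε_i` with `ε_i*`. -/
def coendMap (P : DPair C) (x : S.Obj) : P.co ⊗ P.ob ⟶ (x : C) ⊗ dual (x : C) :=
  ∑ i, S.transpose P x (S.eps x P.ob i) ⊗ₘ S.eps' x P.ob i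

theorem comp_transpose {Y Z : DPair C} {f : Y.ob ⟶ Z.ob} {f' : Z.co ⟶ Y.co}
    (h : DPair.IsMate Y Z f f') (x : S.Obj) (g : dual (x : C) ⟶ Y.ob) :
    f' ≫ S.transpose Y x g = S.transpose Z x (g ≫ f) := by
  rw [h.eq_mate]
  exact (DPair.mate_comp (S.pair x) Y Z g f).symm

theorem transpose_smul (P : DPair C) (x : S.Obj) (r : K) (f : dual (x : C) ⟶ P.ob) :
    S.transpose P x (r • f) = r • S.transpose P x f :=
  DPair.mate_smul (S.pair x) P r f

theorem transpose_sum (P : DPair C) (x : S.Obj) {ι : Type*} (s : Finset ι)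
    (f : ι → (dual (x : C) ⟶ P.ob)) :
    S.transpose P x (∑ i ∈ s, f i) = ∑ i ∈ s, S.transpose P x (f i) :=
  DPair.mate_sum (S.pair x) P s f

theorem transpose_id (x : S.Obj) (r : K) :
    S.transpose (S.pair x) x (r • 𝟙 (dual (x : C))) = r • 𝟙 (x : C) :=
  (DPair.mate_smul (S.pair x) (S.pair x) r (𝟙 _)).trans
    (congrArg (r • ·) (DPair.mate_id (S.pair x)))

end Simples

end

/-! ### Rotation of morphisms -/

section

section Coherence

variable {C : Type u} [Category.{v} C] [MonoidalCategory C] [SymmetricCategory C]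

/-- Exchanging two pairs of factors in two ways. -/
theorem tensorμ_braiding (X₁ X₂ Y₁ Y₂ : C) :
    tensorμ X₁ X₂ Y₁ Y₂ ≫ (β_ (X₁ ⊗ Y₁) (X₂ ⊗ Y₂)).hom =
      ((β_ X₁ X₂).hom ⊗ₘ (β_ Y₁ Y₂).hom) ≫ tensorμ X₂ X₁ Y₂ Y₁ := by
  have h1 : (β_ X₂ Y₁).hom ≫ (β_ Y₁ X₂).hom = 𝟙 _ := SymmetricCategory.symmetry _ _
  unfold tensorμ
  rw [BraidedCategory.braiding_tensor_left_hom, BraidedCategory.braiding_tensor_right_hom Y₁,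
    BraidedCategory.braiding_tensor_right_hom X₁, MonoidalCategory.tensorHom_def]
  calc _ = 𝟙 _ ⊗≫ X₁ ◁ ((β_ X₂ Y₁).hom ≫ (β_ Y₁ X₂).hom) ▷ Y₂ ⊗≫ (X₁ ⊗ X₂) ◁ (β_ Y₁ Y₂).hom ⊗≫
        (β_ X₁ X₂).hom ▷ (Y₂ ⊗ Y₁) ⊗≫ X₂ ◁ (β_ X₁ Y₂).hom ▷ Y₁ ⊗≫ 𝟙 _ := by monoidal
    _ = 𝟙 _ ⊗≫ ((X₁ ⊗ X₂) ◁ (β_ Y₁ Y₂).hom ≫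
        (β_ X₁ X₂).hom ▷ (Y₂ ⊗ Y₁)) ⊗≫ X₂ ◁ (β_ X₁ Y₂).hom ▷ Y₁ ⊗≫ 𝟙 _ := by rw [h1]; monoidal
    _ = _ := by rw [whisker_exchange]; monoidal

/-- The step of the identity of `b b`, followed by a product of morphisms, in the form in which it
arises from a circulator. -/
theorem openStep_id_tensorHom {x x' b b' z z' : C} (cf : 𝟙_ C ⟶ b' ⊗ b) (m : x ⊗ b' ⟶ z) (e : x' ⊗ b ⟶ z') :
    openStep x x' cf (𝟙 (b ⊗ b)) ≫ (m ⊗ₘ e) ▷ b ≫ (β_ (z ⊗ z') b).hom ≫ (α_ b z z').inv =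
      (α_ x x' b).hom ≫ x ◁ e ≫
        ((ρ_ x).inv ≫ x ◁ cf ≫ (α_ x b' b).inv ≫ m ▷ b ≫ (β_ z b).hom) ▷ z' := by
  have h1 : (β_ b z').hom ≫ (β_ z' b).hom = 𝟙 _ := SymmetricCategory.symmetry _ _
  have hn : openName cf (𝟙 (b ⊗ b)) = (ρ_ b).inv ≫ b ◁ cf ≫ (α_ _ _ _).inv ≫
      (β_ b b').hom ▷ b := by
    have := cup_braiding cf b
    unfold openName
    rw [Category.comp_id, reassoc_of% this]
    simp
  unfold openStep
  rw [hn]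
  unfold tensorμ
  calc _ = 𝟙 _ ⊗≫ x ◁ ((x' ⊗ b) ◁ cf ⊗≫ ((α_ x' b b').hom ≫ x' ◁ (β_ b b').hom ≫ (α_ _ _ _).inv ≫
          (β_ x' b').hom ▷ b ≫ (α_ _ _ _).hom) ▷ b ⊗≫ b' ◁ e ▷ b) ⊗≫ m ▷ z' ▷ b ⊗≫
          (β_ (z ⊗ z') b).hom ≫ (α_ b z z').inv := by
        rw [MonoidalCategory.tensorHom_def']; monoidal
    _ = 𝟙 _ ⊗≫ x ◁ ((x' ⊗ b) ◁ cf ⊗≫ ((β_ (x' ⊗ b) b').hom ≫ b' ◁ e) ▷ b) ⊗≫ m ▷ z' ▷ b ⊗≫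
          (β_ (z ⊗ z') b).hom ≫ (α_ b z z').inv := by
        rw [BraidedCategory.braiding_tensor_left_hom x' b b']; monoidal
    _ = 𝟙 _ ⊗≫ x ◁ ((x' ⊗ b) ◁ cf ≫ e ▷ (b' ⊗ b)) ⊗≫ x ◁ (β_ z' b').hom ▷ b ⊗≫ m ▷ z' ▷ b ⊗≫
          (β_ (z ⊗ z') b).hom ≫ (α_ b z z').inv := by
        rw [← BraidedCategory.braiding_naturality_left]; monoidal
    _ = 𝟙 _ ⊗≫ x ◁ e ⊗≫ x ◁ ((ρ_ z').inv ≫ z' ◁ cf ≫ (α_ _ _ _).inv ≫ (β_ z' b').hom ▷ b ≫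
          (α_ _ _ _).hom) ⊗≫ m ▷ z' ▷ b ⊗≫ (β_ (z ⊗ z') b).hom ≫ (α_ b z z').inv := by
        rw [whisker_exchange]; monoidal
    _ = 𝟙 _ ⊗≫ x ◁ e ⊗≫ x ◁ cf ▷ z' ⊗≫ ((x ⊗ b') ◁ (β_ b z').hom ≫ m ▷ (z' ⊗ b)) ⊗≫
          (β_ (z ⊗ z') b).hom ≫ (α_ b z z').inv := by
        rw [← cup_braiding]; monoidal
    _ = 𝟙 _ ⊗≫ x ◁ e ⊗≫ x ◁ cf ▷ z' ⊗≫ m ▷ b ▷ z' ⊗≫ z ◁ ((β_ b z').hom ≫ (β_ z' b).hom) ⊗≫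
          (β_ z b).hom ▷ z' ⊗≫ 𝟙 _ := by
        rw [whisker_exchange, BraidedCategory.braiding_tensor_left_hom]; monoidal
    _ = _ := by rw [h1]; monoidal

/-- The rotation of `ε : z* ⟶ x* b` in terms of its transpose. -/
theorem cycl_eq_mate (X Z B : DPair C) (ε : Z.ob ⟶ X.ob ⊗ B.ob) :
    (ρ_ X.co).inv ≫ X.co ◁ (Z.η ≫ (β_ Z.co Z.ob).hom ≫ ε ▷ Z.co) ≫
      X.co ◁ (α_ _ _ _).hom ≫ (α_ _ _ _).inv ≫ ((β_ X.co X.ob).hom ≫ X.ev) ▷ (B.ob ⊗ Z.co) ≫ (λ_ _).hom =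
    (ρ_ X.co).inv ≫ X.co ◁ B.η ≫ (α_ _ _ _).inv ≫ DPair.mate Z (X.tensor B) ε ▷ B.ob ≫
      (β_ Z.co B.ob).hom := by
  have h := (DPair.isMate_mate Z (X.tensor B) ε).η_comp
  set m : X.co ⊗ B.co ⟶ Z.co := DPair.mate Z (X.tensor B) ε
  change Z.η ≫ Z.co ◁ ε = ((λ_ (𝟙_ C)).inv ≫ (X.η ⊗ₘ B.η) ≫ tensorμ X.co X.ob B.co B.ob) ≫
    m ▷ (X.ob ⊗ B.ob) at h
  have h2 : Z.η ≫ (β_ Z.co Z.ob).hom ≫ ε ▷ Z.co = (λ_ (𝟙_ C)).inv ≫ (X.η ⊗ₘ B.η) ≫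
      ((β_ X.co X.ob).hom ⊗ₘ (β_ B.co B.ob).hom) ≫ tensorμ X.ob X.co B.ob B.co ≫
      (X.ob ⊗ B.ob) ◁ m := by
    rw [← BraidedCategory.braiding_naturality_right, reassoc_of% h,
      BraidedCategory.braiding_naturality_left, reassoc_of% tensorμ_braiding X.co X.ob B.co B.ob]
  have hev : X.co ◁ (X.η ≫ (β_ X.co X.ob).hom) ≫ (α_ _ _ _).inv ≫ ((β_ X.co X.ob).hom ≫ X.ev) ▷ X.co =
      (ρ_ _).hom ≫ (λ_ _).inv := by
    have hz := X.swap.zig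
    have e : X.swap.η = X.η ≫ (β_ X.co X.ob).hom := by
      simp [DPair.swap, SymmetricCategory.braiding_swap_eq_inv_braiding X.ob X.co]
    rw [e] at hz
    exact hz
  rw [h2, tensorHom_comp_tensorHom_assoc, MonoidalCategory.tensorHom_def]
  unfold tensorμ
  calc _ = 𝟙 _ ⊗≫ (X.co ◁ (X.η ≫ (β_ X.co X.ob).hom)) ⊗≫
        ((X.co ⊗ X.ob) ◁ (X.co ◁ (B.η ≫ (β_ B.co B.ob).hom) ⊗≫ (β_ X.co B.ob).hom ▷ B.co ⊗≫ B.ob ◁ m) ≫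
        ((β_ X.co X.ob).hom ≫ X.ev) ▷ (B.ob ⊗ Z.co)) ⊗≫ 𝟙 _ := by monoidal
    _ = 𝟙 _ ⊗≫ (X.co ◁ (X.η ≫ (β_ X.co X.ob).hom) ≫ (α_ _ _ _).inv ≫ ((β_ X.co X.ob).hom ≫ X.ev) ▷ X.co) ⊗≫
        X.co ◁ (B.η ≫ (β_ B.co B.ob).hom) ⊗≫ (β_ X.co B.ob).hom ▷ B.co ⊗≫ B.ob ◁ m := by
        rw [whisker_exchange]; monoidal
    _ = 𝟙 _ ⊗≫ X.co ◁ B.η ⊗≫ ((β_ (X.co ⊗ B.co) B.ob).hom ≫ B.ob ◁ m) ⊗≫ 𝟙 _ := by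
        rw [hev, BraidedCategory.braiding_tensor_left_hom]; monoidal
    _ = _ := by rw [← BraidedCategory.braiding_naturality_left]; monoidal

end Coherence

end

/-! ### Dinaturality of the universal map -/

section

variable {K : Type w} [Field K] {C : Type u} [Category.{v} C] [Abelian C] [Linear K C]
  [MonoidalCategory C] [MonoidalPreadditive C] [MonoidalLinear K C]

theorem tensorHom_sum' {ι : Type*} (s : Finset ι) {A B D E : C} (f : A ⟶ B) (g : ι → (D ⟶ E)) :
    (f ⊗ₘ ∑ i ∈ s, g i) = ∑ i ∈ s, f ⊗ₘ g i := by
  simp only [MonoidalCategory.tensorHom_def, whiskerLeft_sum, Preadditive.comp_sum]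

theorem sum_tensorHom' {ι : Type*} (s : Finset ι) {A B D E : C} (f : ι → (A ⟶ B)) (g : D ⟶ E) :
    ((∑ i ∈ s, f i) ⊗ₘ g) = ∑ i ∈ s, f i ⊗ₘ g := by
  simp only [MonoidalCategory.tensorHom_def, sum_whiskerRight, Preadditive.sum_comp]

theorem tensorHom_smul' {A B D E : C} (r : K) (f : A ⟶ B) (g : D ⟶ E) :
    (f ⊗ₘ r • g) = r • (f ⊗ₘ g) := by
  simp only [MonoidalCategory.tensorHom_def, MonoidalLinear.whiskerLeft_smul, Linear.comp_smul]

theorem smul_tensorHom' {A B D E : C} (r : K) (f : A ⟶ B) (g : D ⟶ E) :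
    ((r • f) ⊗ₘ g) = r • (f ⊗ₘ g) := by
  simp only [MonoidalCategory.tensorHom_def, MonoidalLinear.smul_whiskerRight, Linear.smul_comp]

variable [LeftRigidCategory C] [SymmetricCategory C]

namespace Simples

variable (S : Simples K C)

/-- Dinaturality of the universal map: a morphism may be slid from `A` to `A*`. -/
theorem coendMap_dinatural {Y Z : DPair C} {f : Y.ob ⟶ Z.ob} {f' : Z.co ⟶ Y.co}
    (h : DPair.IsMate Y Z f f') (x : S.Obj) :
    Z.co ◁ f ≫ S.coendMap Z x = f' ▷ Y.ob ≫ S.coendMap Y x := by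
  choose r hr using fun (k : S.Idx x Y.ob) (i : S.Idx x Z.ob) =>
    S.exists_smul_id_dual x ((S.eps x Y.ob k ≫ f) ≫ S.eps' x Z.ob i)
  have h1 : ∀ i, f ≫ S.eps' x Z.ob i = ∑ k, r k i • S.eps' x Y.ob k := fun i => by
    rw [← S.sum_eps_comp x (f ≫ S.eps' x Z.ob i)]
    refine Finset.sum_congr rfl fun k _ => ?_
    rw [← Category.assoc (S.eps x Y.ob k), hr, Linear.comp_smul, Category.comp_id]
  have h2 : ∀ k, S.eps x Y.ob k ≫ f = ∑ i, r k i • S.eps x Z.ob i := fun k => by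
    rw [← S.sum_comp_eps x (S.eps x Y.ob k ≫ f)]
    refine Finset.sum_congr rfl fun i _ => ?_
    rw [hr, Linear.smul_comp, Category.id_comp]
  have h3 : ∀ k, f' ≫ S.transpose Y x (S.eps x Y.ob k) =
      ∑ i, r k i • S.transpose Z x (S.eps x Z.ob i) := fun k => by
    simp only [S.comp_transpose h, h2, transpose_sum, transpose_smul]
  have hL : Z.co ◁ f ≫ S.coendMap Z x =
      ∑ i, S.transpose Z x (S.eps x Z.ob i) ⊗ₘ (f ≫ S.eps' x Z.ob i) := by
    unfold coendMap
    rw [Preadditive.comp_sum]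
    refine Finset.sum_congr rfl fun i _ => ?_
    rw [← id_tensorHom, tensorHom_comp_tensorHom, Category.id_comp]
  have hR : f' ▷ Y.ob ≫ S.coendMap Y x =
      ∑ k, (f' ≫ S.transpose Y x (S.eps x Y.ob k)) ⊗ₘ S.eps' x Y.ob k := by
    unfold coendMap
    rw [Preadditive.comp_sum]
    refine Finset.sum_congr rfl fun i _ => ?_
    rw [← tensorHom_id, tensorHom_comp_tensorHom, Category.id_comp]
  rw [hL, hR]
  simp only [h1, h3, tensorHom_sum', sum_tensorHom']
  rw [Finset.sum_comm]
  refine Finset.sum_congr rfl fun k _ => Finset.sum_congr rfl fun i _ => ?_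
  rw [tensorHom_smul', smul_tensorHom']

/-- At a simple pair the universal map is the identity of one summand. -/
theorem coendMap_self (x : S.Obj) : S.coendMap (S.pair x) x = 𝟙 ((x : C) ⊗ dual (x : C)) := by
  choose r hr using fun i : S.Idx x (dual (x : C)) =>
    S.exists_smul_id_dual x (S.eps x (dual (x : C)) i)
  have h2 : ∑ i, r i • S.eps' x (dual (x : C)) i = 𝟙 (dual (x : C)) := by
    rw [← S.sum_comp_eps x (𝟙 (dual (x : C)))]
    refine Finset.sum_congr rfl fun i _ => ?_
    rw [Category.id_comp, hr, Linear.comp_smul, Category.comp_id]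
  calc _ = ∑ i, (r i • 𝟙 (x : C)) ⊗ₘ S.eps' x (dual (x : C)) i :=
      Finset.sum_congr rfl fun i _ => congrArg (· ⊗ₘ _)
        ((congrArg (S.transpose (S.pair x) x) (hr i)).trans (S.transpose_id x (r i)))
    _ = 𝟙 (x : C) ⊗ₘ ∑ i, r i • S.eps' x (dual (x : C)) i := by
      rw [tensorHom_sum']
      exact Finset.sum_congr rfl fun i _ => by rw [smul_tensorHom', tensorHom_smul']
    _ = _ := by rw [h2, id_tensorHom_id]

theorem coendMap_of_ne [Stable C] {x z : S.Obj} (h : x ≠ z) : S.coendMap (S.pair x) z = 0 := by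
  refine Finset.sum_eq_zero fun i _ => ?_
  have h0 : S.eps' z (S.pair x).ob i = 0 :=
    S.hom_eq_zero' (a := S.star x) (b := S.star z) (fun e => h (S.star_injective e)) _
  rw [h0, MonoidalPreadditive.tensor_zero]

/-- The component at `x` of the map `A* A b ⟶ ⊕_x b x x*`. -/
def coendMapRight (P : DPair C) (b : C) (x : S.Obj) :
    (P.co ⊗ P.ob) ⊗ b ⟶ (b ⊗ (x : C)) ⊗ dual (x : C) :=
  S.coendMap P x ▷ b ≫ (β_ _ _).hom ≫ (α_ _ _ _).inv

omit [MonoidalPreadditive C] [MonoidalLinear K C] [LeftRigidCategory C] [SymmetricCategory C] in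
theorem _root_.QuinnInvariant.nabla_tmul (G : C ⥤ C) [G.Additive] [G.Linear K] (p a B : C)
    (ψ : p ⟶ G.obj a) (φ : a ⟶ B) : nabla (K := K) G p a B (ψ ⊗ₜ φ) = ψ ≫ G.map φ := rfl

omit [MonoidalPreadditive C] [MonoidalLinear K C] [SymmetricCategory C] in
theorem nablaInv_apply (G : C ⥤ C) (p : C) (a : S.Obj) (B : C) (φ : p ⟶ G.obj B) :
    S.nablaInv G p a B φ =
      ∑ i, (φ ≫ G.map ((S.basis a B).ε' i)) ⊗ₜ[K] (S.basis a B).ε i := by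
  unfold nablaInv
  rw [LinearMap.sum_apply]
  rfl

theorem cycl_apply {a a' b b' : C} (coev : 𝟙_ C ⟶ a ⊗ a') (ev : b' ⊗ b ⟶ 𝟙_ C) (c : C)
    (f : a ⟶ b ⊗ c) : cycl (K := K) coev ev c f =
      (ρ_ b').inv ≫ b' ◁ (coev ≫ f ▷ a') ≫ b' ◁ (α_ b c a').hom ≫ (α_ b' b (c ⊗ a')).inv ≫
      ev ▷ (c ⊗ a') ≫ (λ_ (c ⊗ a')).hom := by
  change ((ρ_ b').inv ≫ (b' ◁ coev)) ≫ (b' ◁ (f ▷ a')) ≫ ((b' ◁ (α_ b c a').hom) ≫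
    (α_ b' b (c ⊗ a')).inv ≫ (ev ▷ (c ⊗ a')) ≫ (λ_ (c ⊗ a')).hom) = _
  simp

theorem circBlock_apply (b a x z : S.Obj) (φ : (a : C) ⟶ ((b : C) ⊗ (x : C)) ⊗ dual (x : C)) :
    S.circBlock b a x z φ = ∑ i, φ ≫ ((α_ (b : C) (x : C) (dual (x : C))).hom ≫
      (β_ (b : C) ((x : C) ⊗ dual (x : C))).hom ≫ (α_ (x : C) (dual (x : C)) (b : C)).hom) ≫
      (x : C) ◁ S.eps' z (dual (x : C) ⊗ (b : C)) i ≫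
      cycl (K := K) (coform (z : C)) (form (x : C)) (b : C)
        (S.eps z (dual (x : C) ⊗ (b : C)) i) ▷ dual (z : C) := by
  refine (congrArg (fun t => nabla (K := K) (tensorRight (dual (z : C))) (a : C) (x : C)
    ((b : C) ⊗ (z : C)) (LinearMap.lTensor _ (cycl (K := K) (coform (z : C)) (form (x : C)) (b : C))
      t)) (S.nablaInv_apply (tensorLeft (x : C)) (a : C) (S.star z) (dual (x : C) ⊗ (b : C))
      (φ ≫ ((α_ (b : C) (x : C) (dual (x : C))).hom ≫
      (β_ (b : C) ((x : C) ⊗ dual (x : C))).hom ≫ (α_ (x : C) (dual (x : C)) (b : C)).hom)))).trans ?_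
  refine (congrArg _ (map_sum (LinearMap.lTensor _ (cycl (K := K) (coform (z : C)) (form (x : C)) (b : C))) _ _)).trans ?_
  refine (map_sum _ _ _).trans ?_
  refine Finset.sum_congr rfl fun i _ => ?_
  refine Eq.trans (b := (((φ ≫ ((α_ (b : C) (x : C) (dual (x : C))).hom ≫
      (β_ (b : C) ((x : C) ⊗ dual (x : C))).hom ≫ (α_ (x : C) (dual (x : C)) (b : C)).hom)) ≫
      (x : C) ◁ S.eps' z (dual (x : C) ⊗ (b : C)) i) ≫
      cycl (K := K) (coform (z : C)) (form (x : C)) (b : C)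
        (S.eps z (dual (x : C) ⊗ (b : C)) i) ▷ dual (z : C))) rfl ?_
  simp only [Category.assoc]

end Simples

end

/-! ### Circulators let a strand pass -/

section

/-- A step commutes with morphisms of the factors it leaves alone. -/
theorem openStep_natural {C : Type u} [Category.{v} C] [MonoidalCategory C] [SymmetricCategory C]
    {A' A D' D B' B b b₁ : C} (f' : A' ⟶ D') (f : A ⟶ D) (η : 𝟙_ C ⟶ B' ⊗ B)
    (G : b ⊗ B ⟶ B ⊗ b₁) :
    (f' ⊗ₘ f) ▷ b ≫ openStep D' D η G =
      openStep A' A η G ≫ ((f' ▷ B') ⊗ₘ (f ▷ B)) ▷ b₁ := by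
  have h := tensorμ_natural_left f' f B' B
  unfold openStep
  simp only [Category.assoc, ← comp_whiskerRight]
  rw [← h, comp_whiskerRight, ← associator_inv_naturality_left_assoc,
    ← whisker_exchange_assoc]

variable {K : Type w} [Field K] {C : Type u} [Category.{v} C] [Abelian C] [Linear K C]
  [MonoidalCategory C] [MonoidalPreadditive C] [MonoidalLinear K C]
  [LeftRigidCategory C] [SymmetricCategory C]

namespace Simples

variable (S : Simples K C)

/-- A summand of the universal map of `Y` followed by a step, and then by the universal map of the
product: the factors through `X` are slid to one side. -/
theorem coendMap_slide (Y X B : DPair C) {b b₁ : C} (f : X.ob ⟶ Y.ob) (e : Y.ob ⟶ X.ob)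
    (G : b ⊗ B.ob ⟶ B.ob ⊗ b₁) (z : S.Obj) :
    (DPair.mate X Y f ⊗ₘ e) ▷ b ≫ openStep X.co X.ob B.η G ≫ S.coendMap (X.tensor B) z ▷ b₁ =
      openStep Y.co Y.ob B.η G ≫
        ((Y.co ⊗ B.co) ◁ ((e ≫ f) ▷ B.ob)) ▷ b₁ ≫ S.coendMap (Y.tensor B) z ▷ b₁ := by
  rw [← comp_whiskerRight _ (S.coendMap (Y.tensor B) z)]
  have hm : DPair.IsMate (X.tensor B) (Y.tensor B) (f ⊗ₘ 𝟙 B.ob) (DPair.mate X Y f ⊗ₘ 𝟙 B.co) :=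
    (DPair.isMate_mate X Y f).tensor (DPair.IsMate.id B)
  have hd := S.coendMap_dinatural hm z
  rw [← Category.assoc, openStep_natural, Category.assoc, ← comp_whiskerRight]
  congr 2
  rw [tensorHom_def', Category.assoc]
  have h1 : (DPair.mate X Y f ▷ B.co) ▷ (X.ob ⊗ B.ob) ≫ S.coendMap (X.tensor B) z =
      (Y.co ⊗ B.co) ◁ (f ▷ B.ob) ≫ S.coendMap (Y.tensor B) z := by
    have e1 : DPair.mate X Y f ⊗ₘ 𝟙 B.co = DPair.mate X Y f ▷ B.co := tensorHom_id _ _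
    have e2 : f ⊗ₘ 𝟙 B.ob = f ▷ B.ob := tensorHom_id _ _
    rw [e1, e2] at hd
    exact hd.symm
  exact (congrArg _ h1).trans (by simp)

/-- The universal map at a simple pair, computed by rotations. -/
theorem sum_cycl (b x z : S.Obj) :
    ∑ i, (α_ (x : C) (dual (x : C)) (b : C)).hom ≫
      (x : C) ◁ S.eps' z (dual (x : C) ⊗ (b : C)) i ≫
      cycl (K := K) (coform (z : C)) (form (x : C)) (b : C)
        (S.eps z (dual (x : C) ⊗ (b : C)) i) ▷ dual (z : C) =
    openStep (x : C) (dual (x : C)) (coform (b : C)) (𝟙 ((b : C) ⊗ (b : C))) ≫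
      S.coendMapRight ((S.pair x).tensor (DPair.of (b : C))) (b : C) z := by
  have hc : ∀ ε : dual (z : C) ⟶ dual (x : C) ⊗ (b : C),
      cycl (K := K) (coform (z : C)) (form (x : C)) (b : C) ε =
      (ρ_ (x : C)).inv ≫ (x : C) ◁ coform (b : C) ≫ (α_ _ _ _).inv ≫
        S.transpose ((S.pair x).tensor (DPair.of (b : C))) z ε ▷ (b : C) ≫
        (β_ (z : C) (b : C)).hom := by
    intro ε
    have h := cycl_eq_mate (S.pair x) (S.pair z) (DPair.of (b : C)) ε
    simp only [DPair.of, Category.assoc, Iso.inv_hom_id_assoc,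
      SymmetricCategory.symmetry_assoc] at h
    rw [cycl_apply]
    exact h
  have hs : S.coendMapRight ((S.pair x).tensor (DPair.of (b : C))) (b : C) z =
      ∑ i : S.Idx z (dual (x : C) ⊗ (b : C)),
        (S.transpose ((S.pair x).tensor (DPair.of (b : C))) z (S.eps z (dual (x : C) ⊗ (b : C)) i) ⊗ₘ
          S.eps' z (dual (x : C) ⊗ (b : C)) i) ▷ (b : C) ≫
          (β_ ((z : C) ⊗ dual (z : C)) (b : C)).hom ≫ (α_ _ _ _).inv := by
    unfold coendMapRight coendMap
    rw [sum_whiskerRight, Preadditive.sum_comp]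
  rw [hs]
  refine Eq.trans ?_ (Preadditive.comp_sum ..).symm
  refine Finset.sum_congr rfl fun i _ => ?_
  rw [hc]
  exact (openStep_id_tensorHom (coform (b : C)) _ _).symm

/-- A circulator lets the strand `b` pass through the state and absorb a factor `b`. -/
theorem circulator_apply [Stable C] (b a : S.Obj) (Y : DPair C)
    (f : (a : C) ⟶ (Y.co ⊗ Y.ob) ⊗ (b : C)) :
    S.circulator b a (fun x => f ≫ S.coendMapRight Y (b : C) x) =
      fun z => f ≫ openStep Y.co Y.ob (coform (b : C)) (𝟙 ((b : C) ⊗ (b : C))) ≫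
        S.coendMapRight (Y.tensor (DPair.of (b : C))) (b : C) z := by
  funext z
  have h1 : ∀ x : S.Obj, S.circBlock b a x z (f ≫ S.coendMapRight Y (b : C) x) =
      f ≫ S.coendMap Y x ▷ (b : C) ≫
        openStep (x : C) (dual (x : C)) (coform (b : C)) (𝟙 ((b : C) ⊗ (b : C))) ≫
        S.coendMapRight ((S.pair x).tensor (DPair.of (b : C))) (b : C) z := by
    intro x
    rw [circBlock_apply, ← sum_cycl, Preadditive.comp_sum, Preadditive.comp_sum]
    refine Finset.sum_congr rfl fun i _ => ?_
    unfold coendMapRight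
    simp only [Category.assoc, Iso.inv_hom_id_assoc, SymmetricCategory.symmetry_assoc]
  have h2 : ∀ x : S.Obj, S.coendMap Y x ▷ (b : C) ≫
        openStep (x : C) (dual (x : C)) (coform (b : C)) (𝟙 ((b : C) ⊗ (b : C))) ≫
        S.coendMapRight ((S.pair x).tensor (DPair.of (b : C))) (b : C) z =
      ∑ k, openStep Y.co Y.ob (coform (b : C)) (𝟙 ((b : C) ⊗ (b : C))) ≫
        ((Y.co ⊗ dual (b : C)) ◁ ((S.eps' x Y.ob k ≫ S.eps x Y.ob k) ▷ (b : C))) ▷ (b : C) ≫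
        S.coendMapRight (Y.tensor (DPair.of (b : C))) (b : C) z := by
    intro x
    conv_lhs => unfold coendMap
    rw [sum_whiskerRight, Preadditive.sum_comp]
    refine Finset.sum_congr rfl fun k _ => ?_
    have := S.coendMap_slide Y (S.pair x) (DPair.of (b : C)) (S.eps x Y.ob k) (S.eps' x Y.ob k)
      (𝟙 ((b : C) ⊗ (b : C))) z
    have h := congrArg (· ≫ (β_ ((z : C) ⊗ dual (z : C)) (b : C)).hom ≫ (α_ _ _ _).inv) this
    simp only [Category.assoc] at h
    exact h
  change (∑ x, S.circBlock b a x z ∘ₗ LinearMap.proj x) (fun x => f ≫ S.coendMapRight Y (b : C) x) = _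
  rw [LinearMap.sum_apply]
  have h3 : ∀ x : S.Obj, (S.circBlock b a x z ∘ₗ LinearMap.proj x)
      (fun x => f ≫ S.coendMapRight Y (b : C) x) = f ≫ ∑ k : S.Idx x Y.ob,
      openStep Y.co Y.ob (coform (b : C)) (𝟙 ((b : C) ⊗ (b : C))) ≫
        ((Y.co ⊗ dual (b : C)) ◁ ((S.eps' x Y.ob k ≫ S.eps x Y.ob k) ▷ (b : C))) ▷ (b : C) ≫
        S.coendMapRight (Y.tensor (DPair.of (b : C))) (b : C) z := fun x => by
    rw [← h2 x]; exact h1 x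
  rw [Finset.sum_congr rfl fun x _ => h3 x, ← Preadditive.comp_sum]
  simp only [← Preadditive.comp_sum, ← Preadditive.sum_comp, ← sum_whiskerRight,
    ← whiskerLeft_sum]
  have he := S.sum_eps Y.ob
  rw [he]
  simp

end Simples

end

/-! ### Change of the object passed by a strand -/

section

section
variable {C : Type u} [Category.{v} C] [MonoidalCategory C] [SymmetricCategory C]

theorem DPair.isMate_associator (X Y Z : DPair C) :
    DPair.IsMate ((X.tensor Y).tensor Z) (X.tensor (Y.tensor Z)) (α_ X.ob Y.ob Z.ob).hom
      (α_ X.co Y.co Z.co).inv := by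
  have h := associator_monoidal X.ob Y.ob Z.ob X.co Y.co Z.co
  unfold DPair.IsMate
  dsimp only
  have e1 : ((X.ev ⊗ₘ tensorμ Y.ob Z.ob Y.co Z.co ≫ (Y.ev ⊗ₘ Z.ev) ≫ (λ_ (𝟙_ C)).hom) ≫ (λ_ (𝟙_ C)).hom) =
      (X.ob ⊗ X.co) ◁ tensorμ Y.ob Z.ob Y.co Z.co ≫ (X.ev ⊗ₘ (Y.ev ⊗ₘ Z.ev)) ≫ 𝟙_ C ◁ (λ_ (𝟙_ C)).hom ≫
        (λ_ (𝟙_ C)).hom := by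
    simp only [MonoidalCategory.tensorHom_def']
    monoidal
  have e2 : ((tensorμ X.ob Y.ob X.co Y.co ≫ (X.ev ⊗ₘ Y.ev) ≫ (λ_ (𝟙_ C)).hom) ⊗ₘ Z.ev) ≫ (λ_ (𝟙_ C)).hom =
      tensorμ X.ob Y.ob X.co Y.co ▷ (Z.ob ⊗ Z.co) ≫ (α_ _ _ _).hom ≫ (X.ev ⊗ₘ (Y.ev ⊗ₘ Z.ev)) ≫
        𝟙_ C ◁ (λ_ (𝟙_ C)).hom ≫ (λ_ (𝟙_ C)).hom := by
    simp only [MonoidalCategory.tensorHom_def]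
    monoidal
  rw [e1, e2]
  have h' := congrArg (· ≫ (X.ev ⊗ₘ (Y.ev ⊗ₘ Z.ev)) ≫ 𝟙_ C ◁ (λ_ (𝟙_ C)).hom ≫ (λ_ (𝟙_ C)).hom) h
  simp only [Category.assoc] at h'
  have h2 := congrArg (((X.ob ⊗ Y.ob) ⊗ Z.ob) ◁ (α_ X.co Y.co Z.co).inv ≫ ·) h'
  rw [h2]
  simp [MonoidalCategory.tensorHom_def']

theorem DPair.isMate_rightUnitor (X : DPair C) :
    DPair.IsMate (X.tensor DPair.unit) X (ρ_ X.ob).hom (ρ_ X.co).inv := by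
  have h := rightUnitor_monoidal X.ob X.co
  unfold DPair.IsMate
  dsimp only
  rw [← cancel_epi ((X.ob ⊗ 𝟙_ C) ◁ (ρ_ X.co).hom)]
  have e : (X.ob ⊗ 𝟙_ C) ◁ (ρ_ X.co).hom ≫ (ρ_ X.ob).hom ▷ X.co = ((ρ_ X.ob).hom ⊗ₘ (ρ_ X.co).hom) := by
    simp [MonoidalCategory.tensorHom_def']
  rw [reassoc_of% e, h]
  simp [MonoidalCategory.tensorHom_def, unitors_equal]

theorem openStep_comp_whiskerRight (A' A : C) {B' B D E b b₁ : C} (η : 𝟙_ C ⟶ B' ⊗ B)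
    (F : b ⊗ B ⟶ D ⊗ b₁) (f : D ⟶ E) :
    openStep A' A η (F ≫ f ▷ b₁) = openStep A' A η F ≫ ((A' ⊗ B') ◁ (A ◁ f)) ▷ b₁ := by
  have h := tensorμ_natural_right A' A (𝟙 B') f
  simp only [id_tensorHom, MonoidalCategory.whiskerLeft_id] at h
  calc _ = 𝟙 _ ⊗≫ (A' ⊗ A) ◁ openName η F ⊗≫ ((A' ⊗ A) ◁ B' ◁ f ≫ tensorμ A' A B' E) ▷ b₁ := by
        unfold openStep; rw [openName_comp_whiskerRight]; monoidal
    _ = _ := by rw [h]; unfold openStep; monoidal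

/-- A morphism in front of the object passed is slid around the loop. -/
theorem openStep_mate (A' A : C) {P Q : DPair C} {f : P.ob ⟶ Q.ob} {f' : Q.co ⟶ P.co}
    (hf : DPair.IsMate P Q f f') {D b b₁ : C} (F : b ⊗ Q.ob ⟶ D ⊗ b₁) :
    openStep A' A Q.η F ≫ ((A' ◁ f') ▷ (A ⊗ D)) ▷ b₁ = openStep A' A P.η (b ◁ f ≫ F) := by
  have h := tensorμ_natural_right A' A f' (𝟙 D)
  simp only [tensorHom_id, MonoidalCategory.whiskerLeft_id] at h
  calc _ = 𝟙 _ ⊗≫ (A' ⊗ A) ◁ openName Q.η F ⊗≫ (tensorμ A' A Q.co D ≫ (A' ◁ f') ▷ (A ⊗ D)) ▷ b₁ := by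
        unfold openStep; monoidal
    _ = _ := by rw [← h]; unfold openStep; rw [← openName_mate hf]; monoidal

/-- Passing the unit object inserts units. -/
theorem openStep_unit (A' A b : C) :
    openStep A' A (DPair.unit (C := C)).η ((ρ_ b).hom ≫ (λ_ b).inv) =
      ((ρ_ A').inv ⊗ₘ (ρ_ A).inv) ▷ b := by
  have h := tensor_right_unitality A' A
  have h2 : tensorμ A' A (𝟙_ C) (𝟙_ C) = (A' ⊗ A) ◁ (λ_ (𝟙_ C)).hom ≫ (ρ_ _).hom ≫
      ((ρ_ A').inv ⊗ₘ (ρ_ A).inv) := by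
    rw [h]; simp
  unfold openStep openName
  rw [h2]
  simp
  monoidal

end

variable {K : Type w} [Field K] {C : Type u} [Category.{v} C] [Abelian C] [Linear K C]
  [MonoidalCategory C] [MonoidalPreadditive C] [MonoidalLinear K C]
  [LeftRigidCategory C] [SymmetricCategory C]

namespace Simples

variable (S : Simples K C)

/-- The universal map is invariant under isomorphisms of objects with chosen duals. -/
theorem coendMap_iso {Y Z : DPair C} (e : Y.ob ≅ Z.ob) {e' : Z.co ⟶ Y.co} {g' : Y.co ⟶ Z.co}
    (he : DPair.IsMate Y Z e.hom e') (hg : DPair.IsMate Z Y e.inv g') (x : S.Obj) :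
    (g' ⊗ₘ e.hom) ≫ S.coendMap Z x = S.coendMap Y x := by
  rw [MonoidalCategory.tensorHom_def, Category.assoc, S.coendMap_dinatural he,
    ← comp_whiskerRight_assoc, he.of_iso e hg]
  simp

theorem coendMapRight_iso {Y Z : DPair C} (e : Y.ob ≅ Z.ob) {e' : Z.co ⟶ Y.co} {g' : Y.co ⟶ Z.co}
    (he : DPair.IsMate Y Z e.hom e') (hg : DPair.IsMate Z Y e.inv g') (b : C) (x : S.Obj) :
    (g' ⊗ₘ e.hom) ▷ b ≫ S.coendMapRight Z b x = S.coendMapRight Y b x := by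
  unfold coendMapRight
  rw [← comp_whiskerRight_assoc, S.coendMap_iso e he hg]

/-- A morphism behind the object passed can be moved in front of it. -/
theorem openStep_dinatural (Y : DPair C) {P Q : DPair C} (f : P.ob ⟶ Q.ob) {b b₁ : C}
    (F : b ⊗ Q.ob ⟶ P.ob ⊗ b₁) (x : S.Obj) :
    openStep Y.co Y.ob Q.η (F ≫ f ▷ b₁) ≫ S.coendMapRight (Y.tensor Q) b₁ x =
      openStep Y.co Y.ob P.η (b ◁ f ≫ F) ≫ S.coendMapRight (Y.tensor P) b₁ x := by
  have hm : DPair.IsMate (Y.tensor P) (Y.tensor Q) (𝟙 Y.ob ⊗ₘ f) (𝟙 Y.co ⊗ₘ DPair.mate P Q f) :=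
    (DPair.IsMate.id Y).tensor (DPair.isMate_mate P Q f)
  have hd := S.coendMap_dinatural hm x
  simp only [id_tensorHom] at hd
  rw [openStep_comp_whiskerRight, ← openStep_mate Y.co Y.ob (DPair.isMate_mate P Q f)]
  unfold coendMapRight
  simp only [Category.assoc, ← comp_whiskerRight_assoc]
  rw [hd]

end Simples

end

/-! ### Invertibility and powers of circulators -/

section

variable {K : Type w} [Field K] {C : Type u} [Category.{v} C] [Abelian C] [Linear K C]
  [MonoidalCategory C] [MonoidalPreadditive C] [MonoidalLinear K C]
  [LeftRigidCategory C] [SymmetricCategory C]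

namespace Simples

variable (S : Simples K C)

/-- Two consecutive steps amount to the step of the composite open morphism. -/
theorem openStep_openStep (Y P Q : DPair C) {b b₁ b₂ : C} (F : b ⊗ P.ob ⟶ P.ob ⊗ b₁)
    (G : b₁ ⊗ Q.ob ⟶ Q.ob ⊗ b₂) (x : S.Obj) :
    openStep Y.co Y.ob P.η F ≫ openStep (Y.co ⊗ P.co) (Y.ob ⊗ P.ob) Q.η G ≫
        S.coendMapRight ((Y.tensor P).tensor Q) b₂ x =
      openStep Y.co Y.ob (P.tensor Q).η (openComp F G) ≫
        S.coendMapRight (Y.tensor (P.tensor Q)) b₂ x := by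
  have h := S.coendMapRight_iso (Y := Y.tensor (P.tensor Q)) (Z := (Y.tensor P).tensor Q)
    (α_ Y.ob P.ob Q.ob).symm (e' := (α_ Y.co P.co Q.co).hom) (g' := (α_ Y.co P.co Q.co).inv)
    (DPair.IsMate.inv (P := (Y.tensor P).tensor Q) (Q := Y.tensor (P.tensor Q))
      (e := α_ Y.ob P.ob Q.ob) (e' := (α_ Y.co P.co Q.co).symm) (DPair.isMate_associator Y P Q))
    (DPair.isMate_associator Y P Q) b₂ x
  rw [← h, ← Category.assoc, openStep_comp, Category.assoc]
  rfl

/-- Passing the unit object changes nothing. -/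
theorem openStep_unitPair (Y : DPair C) (b : C) (x : S.Obj) :
    openStep Y.co Y.ob (DPair.unit (C := C)).η ((ρ_ b).hom ≫ (λ_ b).inv) ≫
      S.coendMapRight (Y.tensor DPair.unit) b x = S.coendMapRight Y b x := by
  rw [openStep_unit]
  exact S.coendMapRight_iso (Y := Y) (Z := Y.tensor DPair.unit) (ρ_ Y.ob).symm
    (e' := (ρ_ Y.co).hom)
    (DPair.IsMate.inv (P := Y.tensor DPair.unit) (Q := Y) (e := ρ_ Y.ob) (e' := (ρ_ Y.co).symm)
      (DPair.isMate_rightUnitor Y))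
    (DPair.isMate_rightUnitor Y) b x

variable [Stable C]

/-- The state attached to an open morphism with free strand `b`, as an element of the domain of
the circulator. -/
def circState (b a : S.Obj) (Y P : DPair C) (f : (a : C) ⟶ (Y.co ⊗ Y.ob) ⊗ (b : C))
    (F : (b : C) ⊗ P.ob ⟶ P.ob ⊗ (b : C)) : S.CircSpace b a :=
  fun x => f ≫ openStep Y.co Y.ob P.η F ≫ S.coendMapRight (Y.tensor P) (b : C) x

theorem circState_dinatural (b a : S.Obj) (Y : DPair C) {P Q : DPair C} (f : P.ob ⟶ Q.ob)
    (k : (a : C) ⟶ (Y.co ⊗ Y.ob) ⊗ (b : C)) (F : (b : C) ⊗ Q.ob ⟶ P.ob ⊗ (b : C)) :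
    S.circState b a Y Q k (F ≫ f ▷ (b : C)) = S.circState b a Y P k ((b : C) ◁ f ≫ F) := by
  funext x
  unfold circState
  rw [S.openStep_dinatural]

/-- States do not depend on the choice of the dual of the object passed. -/
theorem circState_congr (b a : S.Obj) (Y : DPair C) {P Q : DPair C} (h : P.ob = Q.ob)
    (k : (a : C) ⟶ (Y.co ⊗ Y.ob) ⊗ (b : C)) (F : (b : C) ⊗ P.ob ⟶ P.ob ⊗ (b : C))
    (F' : (b : C) ⊗ Q.ob ⟶ Q.ob ⊗ (b : C)) (hF : HEq F F') :
    S.circState b a Y P k F = S.circState b a Y Q k F' := by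
  obtain ⟨pc, po, pη, pe, p1, p2⟩ := P
  obtain ⟨qc, qo, qη, qe, q1, q2⟩ := Q
  obtain rfl : po = qo := h
  obtain rfl : F = F' := eq_of_heq hF
  have h := S.circState_dinatural b a Y (P := ⟨pc, po, pη, pe, p1, p2⟩)
    (Q := ⟨qc, po, qη, qe, q1, q2⟩) (𝟙 po) k F
  simp only [id_whiskerRight, Category.comp_id, MonoidalCategory.whiskerLeft_id, Category.id_comp]
    at h
  exact h.symm

theorem circState_unit (b a : S.Obj) (Y : DPair C) (k : (a : C) ⟶ (Y.co ⊗ Y.ob) ⊗ (b : C)) :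
    S.circState b a Y (DPair.of (𝟙_ C)) k ((ρ_ (b : C)).hom ≫ (λ_ (b : C)).inv) =
      fun x => k ≫ S.coendMapRight Y (b : C) x := by
  rw [S.circState_congr b a Y (P := DPair.of (𝟙_ C)) (Q := DPair.unit) rfl k _ _ HEq.rfl]
  funext x
  unfold circState
  rw [S.openStep_unitPair]

/-- A circulator appends a factor `b` to the open morphism of a state. -/
theorem circulator_circState (b a : S.Obj) (Y P : DPair C)
    (k : (a : C) ⟶ (Y.co ⊗ Y.ob) ⊗ (b : C)) (F : (b : C) ⊗ P.ob ⟶ P.ob ⊗ (b : C)) :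
    S.circulator b a (S.circState b a Y P k F) =
      S.circState b a Y (P.tensor (DPair.of (b : C))) k (openComp F (𝟙 ((b : C) ⊗ (b : C)))) := by
  have h := S.circulator_apply b a (Y.tensor P) (k ≫ openStep Y.co Y.ob P.η F)
  simp only [Category.assoc] at h
  unfold circState
  rw [h]
  funext x
  exact congrArg (k ≫ ·) (S.openStep_openStep Y P (DPair.of (b : C)) F (𝟙 _) x)

theorem circulator_pow (b a : S.Obj) (Y : DPair C) (k : (a : C) ⟶ (Y.co ⊗ Y.ob) ⊗ (b : C)) :
    ∀ l : ℕ, (S.circulator b a ^ l) (fun x => k ≫ S.coendMapRight Y (b : C) x) =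
      S.circState b a Y (DPair.of (natPow (b : C) l)) k (shift (b : C) l)
  | 0 => (S.circState_unit b a Y k).symm
  | l + 1 => by
    rw [pow_succ', Module.End.mul_apply, circulator_pow b a Y k l, circulator_circState]
    refine S.circState_congr b a Y (P := (DPair.of (natPow (b : C) l)).tensor (DPair.of (b : C)))
      (Q := DPair.of (natPow (b : C) (l + 1))) rfl k _ _ (heq_of_eq ?_)
    change (α_ _ _ _).inv ≫ shift (b : C) l ▷ (b : C) ≫ (α_ _ _ _).hom ≫ natPow (b : C) l ◁ 𝟙 _ ≫
      (α_ _ _ _).inv = (α_ _ _ _).inv ≫ shift (b : C) l ▷ (b : C)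
    simp

/-- A circulator undoes one factor of a negative power. -/
theorem circulator_reverse (b a : S.Obj) (Y : DPair C) (k : (a : C) ⟶ (Y.co ⊗ Y.ob) ⊗ (b : C))
    (l : ℕ) : S.circulator b a (S.circState b a Y (DPair.of (natPow (dual (b : C)) (l + 1))) k
        (reverse (b : C) _ (shift (dual (b : C)) (l + 1)))) =
      S.circState b a Y (DPair.of (natPow (dual (b : C)) l)) k
        (reverse (b : C) _ (shift (dual (b : C)) l)) := by
  rw [circulator_circState]
  have h := S.circState_dinatural b a Y (P := DPair.of (natPow (dual (b : C)) l))
    (Q := (DPair.of (natPow (dual (b : C)) (l + 1))).tensor (DPair.of (b : C)))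
    (reverseUnit (b : C) (natPow (dual (b : C)) l) (shift (dual (b : C)) l)) k (reverseCounit (b : C) _)
  refine Eq.trans ?_ (h.trans ?_)
  · exact congrArg (S.circState b a Y
      ((DPair.of (natPow (dual (b : C)) (l + 1))).tensor (DPair.of (b : C))) k)
      (reverse_openComp (b : C) _ (shift (dual (b : C)) l))
  · exact congrArg (S.circState b a Y (DPair.of (natPow (dual (b : C)) l)) k)
      (reverseUnit_counit (b : C) _ (shift (dual (b : C)) l))

theorem circulator_pow_reverse (b a : S.Obj) (Y : DPair C)
    (k : (a : C) ⟶ (Y.co ⊗ Y.ob) ⊗ (b : C)) :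
    ∀ l : ℕ, (S.circulator b a ^ l) (S.circState b a Y (DPair.of (natPow (dual (b : C)) l)) k
        (reverse (b : C) _ (shift (dual (b : C)) l))) = fun x => k ≫ S.coendMapRight Y (b : C) x
  | 0 => by
    rw [← S.circState_unit b a Y k, pow_zero]
    exact congrArg (S.circState b a Y _ k) (reverse_unit (b : C))
  | l + 1 => by
    rw [pow_succ, Module.End.mul_apply, circulator_reverse, circulator_pow_reverse b a Y k l]

theorem coendMapRight_self (b : C) (x : S.Obj) :
    S.coendMapRight (S.pair x) b x = (β_ _ _).hom ≫ (α_ b (x : C) (dual (x : C))).inv := by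
  unfold coendMapRight
  rw [coendMap_self]
  simp

theorem coendMapRight_of_ne (b : C) {x z : S.Obj} (h : x ≠ z) :
    S.coendMapRight (S.pair x) b z = 0 := by
  unfold coendMapRight
  rw [S.coendMap_of_ne h]
  simp

open Classical in
/-- The summands of the domain of the circulator are spanned by states. -/
theorem single_eq_coendMapRight (b a x : S.Obj)
    (k : (a : C) ⟶ ((b : C) ⊗ (x : C)) ⊗ dual (x : C)) :
    (LinearMap.single K (fun x : S.Obj => (a : C) ⟶ ((b : C) ⊗ (x : C)) ⊗ dual (x : C)) x k) =
      fun z => (k ≫ (α_ _ _ _).hom ≫ (β_ (b : C) ((x : C) ⊗ dual (x : C))).hom) ≫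
        S.coendMapRight (S.pair x) (b : C) z := by
  funext z
  by_cases h : x = z
  · subst h
    rw [coendMapRight_self]
    simp only [Category.assoc, SymmetricCategory.symmetry_assoc, Iso.hom_inv_id, Category.comp_id]
    simp
  · rw [S.coendMapRight_of_ne _ h, comp_zero]
    simp [Ne.symm h]

/-- Each standard summand consists of states, and states lie in the range of the circulator by
`circulator_pow_reverse`; an onto endomorphism of a finite-dimensional space is invertible. -/
theorem isUnit_circulator (b a : S.Obj) : IsUnit (S.circulator b a) := by
  classical
  have hs : Function.Surjective (S.circulator b a) := by
    rw [← LinearMap.range_eq_top, eq_top_iff]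
    intro w _
    rw [← LinearMap.sum_single_apply
      (φ := fun x : S.Obj => (a : C) ⟶ ((b : C) ⊗ (x : C)) ⊗ dual (x : C)) w]
    refine Submodule.sum_mem _ fun x _ => ?_
    have hx := S.single_eq_coendMapRight b a x (w x)
    rw [LinearMap.coe_single] at hx
    rw [hx]
    exact ⟨_, (congrFun (congrArg DFunLike.coe (pow_one _)) _).symm.trans
      (S.circulator_pow_reverse b a (S.pair x) _ 1)⟩
  rw [Module.End.isUnit_iff]
  exact ⟨LinearMap.injective_iff_surjective.mpr hs, hs⟩

/-- The powers of the circulator let the strand `b` pass through the open morphism of a power. -/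
theorem circPow_coendMapRight (b a : S.Obj) (Y : DPair C)
    (k : (a : C) ⟶ (Y.co ⊗ Y.ob) ⊗ (b : C)) : ∀ l : ℤ,
    S.circPow b a l (fun x => k ≫ S.coendMapRight Y (b : C) x) =
      S.circState b a Y (DPair.of (intPow (b : C) l)) k (powMor (b : C) l)
  | Int.ofNat l => S.circulator_pow b a Y k l
  | Int.negSucc l => by
    rw [← S.circulator_pow_reverse b a Y k (l + 1)]
    change (Ring.inverse (S.circulator b a) ^ (l + 1)) ((S.circulator b a ^ (l + 1)) _) = _
    rw [← Module.End.mul_apply, Ring.inverse_pow, Ring.inverse_mul_cancel _ ((S.isUnit_circulator b a).pow _)]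
    rfl

end Simples

end

/-! ### Permutations of factors -/

section

section Permutations

variable {C : Type u} [Category.{v} C] [MonoidalCategory C] [SymmetricCategory C]

theorem swapIso_natural {A A' B B' D D' : C} (f : A ⟶ A') (g : B ⟶ B') (h : D ⟶ D') :
    (f ⊗ₘ (g ⊗ₘ h)) ≫ (swapIso A' B' D').hom = (swapIso A B D).hom ≫ (g ⊗ₘ (f ⊗ₘ h)) := by
  simp only [swapIso, Iso.trans_hom, Iso.symm_hom, whiskerRightIso_hom]
  rw [associator_inv_naturality_assoc, ← tensorHom_id, tensorHom_comp_tensorHom_assoc,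
    BraidedCategory.braiding_naturality]
  simp only [Category.assoc, ← associator_naturality, ← tensorHom_id]
  rw [tensorHom_comp_tensorHom_assoc, Category.comp_id, Category.id_comp]

/-- The permutation `(A ⋄ R) ⋄ B ⟶ (A ⋄ B) ⋄ R`. -/
def swapRight (A R B : C) : (A ⊗ R) ⊗ B ≅ (A ⊗ B) ⊗ R :=
  α_ A R B ≪≫ whiskerLeftIso A (β_ R B) ≪≫ (α_ A B R).symm

theorem swapRight_hom_hom_assoc (A R B : C) {Z : C} (h : (A ⊗ R) ⊗ B ⟶ Z) :
    (swapRight A R B).hom ≫ (swapRight A B R).hom ≫ h = h := by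
  simp only [swapRight, Iso.trans_hom, Iso.symm_hom, whiskerLeftIso_hom, Category.assoc,
    Iso.inv_hom_id_assoc]
  rw [← MonoidalCategory.whiskerLeft_comp_assoc, SymmetricCategory.symmetry]
  simp

theorem swapRight_natural {A A' R R' B B' : C} (f : A ⟶ A') (g : R ⟶ R') (h : B ⟶ B') :
    ((f ⊗ₘ g) ⊗ₘ h) ≫ (swapRight A' R' B').hom = (swapRight A R B).hom ≫ ((f ⊗ₘ h) ⊗ₘ g) := by
  simp only [swapRight, Iso.trans_hom, Iso.symm_hom, whiskerLeftIso_hom]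
  rw [associator_naturality_assoc, ← id_tensorHom, tensorHom_comp_tensorHom_assoc,
    BraidedCategory.braiding_naturality]
  simp only [Category.assoc, ← associator_inv_naturality, ← id_tensorHom]
  rw [tensorHom_comp_tensorHom_assoc, Category.comp_id, Category.id_comp]

theorem swapRight_swapIso (A₀ A R B : C) :
    (α_ A₀ (A ⊗ R) B).hom ≫ A₀ ◁ (swapRight A R B).hom ≫ (swapIso A₀ (A ⊗ B) R).hom =
      (swapIso A₀ A R).hom ▷ B ≫ (swapRight A (A₀ ⊗ R) B).hom := by
  simp only [swapIso, swapRight, Iso.trans_hom, Iso.symm_hom, whiskerRightIso_hom, whiskerLeftIso_hom]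
  rw [BraidedCategory.braiding_tensor_right_hom, BraidedCategory.braiding_tensor_left_hom A₀ R B]
  calc _ = 𝟙 _ ⊗≫ ((A₀ ⊗ A) ◁ (β_ R B).hom ≫ (β_ A₀ A).hom ▷ (B ⊗ R)) ⊗≫
        A ◁ (β_ A₀ B).hom ▷ R ⊗≫ 𝟙 _ := by monoidal
    _ = _ := by rw [whisker_exchange]; monoidal

theorem insertRight_zero_step {A R F B : C} (e : A ⊗ B ⟶ F) :
    ((swapRight A R B).hom ≫ e ▷ R) ≫ 𝟙 (F ⊗ R) =
      𝟙 (A ⊗ R) ▷ B ≫ (swapRight A R B).hom ≫ e ▷ R := by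
  simp

theorem insertRight_pull_step {A₀ T T' A R F B : C} (p : T ⟶ A ⊗ R) (ins : T ⊗ B ⟶ T')
    (q : T' ⟶ F ⊗ R) (e : A ⊗ B ⟶ F)
    (h : ins ≫ q = p ▷ B ≫ (swapRight A R B).hom ≫ e ▷ R) :
    ((α_ A₀ T B).hom ≫ A₀ ◁ ins) ≫ A₀ ◁ q ≫ (swapIso A₀ F R).hom =
      (A₀ ◁ p ≫ (swapIso A₀ A R).hom) ▷ B ≫ (swapRight A (A₀ ⊗ R) B).hom ≫ e ▷ (A₀ ⊗ R) := by
  have h1 : A₀ ◁ (e ▷ R) ≫ (swapIso A₀ F R).hom =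
      (swapIso A₀ (A ⊗ B) R).hom ≫ e ▷ (A₀ ⊗ R) := by
    have := swapIso_natural (𝟙 A₀) e (𝟙 R)
    simpa only [id_tensorHom, tensorHom_id, id_whiskerRight, MonoidalCategory.whiskerLeft_id]
      using this
  rw [comp_whiskerRight, Category.assoc, Category.assoc, ← reassoc_of% swapRight_swapIso, ← h1,
    ← MonoidalCategory.whiskerLeft_comp_assoc, h]
  simp

theorem tensorFinMap_pull_step {A₀ Y₀ T T' X R Y R' : C} (f : A₀ ⟶ Y₀) (t : T ⟶ T')
    (p : T ⟶ X ⊗ R) (q : T' ⟶ Y ⊗ R') (φ : X ⟶ Y) (r : R ⟶ R') (h : t ≫ q = p ≫ (φ ⊗ₘ r)) :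
    (f ⊗ₘ t) ≫ Y₀ ◁ q ≫ (swapIso Y₀ Y R').hom =
      (A₀ ◁ p ≫ (swapIso A₀ X R).hom) ≫ (φ ⊗ₘ (f ⊗ₘ r)) := by
  rw [Category.assoc, ← swapIso_natural, ← id_tensorHom, ← id_tensorHom,
    tensorHom_comp_tensorHom_assoc, tensorHom_comp_tensorHom_assoc, h]
  simp

theorem coformTensor_comp {A' A B' B D' D E' E : C} (η : 𝟙_ C ⟶ A' ⊗ A) (η' : 𝟙_ C ⟶ B' ⊗ B)
    (f : A' ⟶ D') (g : A ⟶ D) (f' : B' ⟶ E') (g' : B ⟶ E) :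
    coformTensor (η ≫ (f ⊗ₘ g)) (η' ≫ (f' ⊗ₘ g')) =
      coformTensor η η' ≫ ((f ⊗ₘ f') ⊗ₘ (g ⊗ₘ g')) := by
  unfold coformTensor
  rw [← tensorHom_comp_tensorHom]
  simp only [Category.assoc]
  rw [tensorμ_natural]

theorem coformTensor_assoc {A' A B' B D' D : C} (η : 𝟙_ C ⟶ A' ⊗ A) (η' : 𝟙_ C ⟶ B' ⊗ B)
    (η'' : 𝟙_ C ⟶ D' ⊗ D) :
    coformTensor (coformTensor η η') η'' ≫ ((α_ A' B' D').hom ⊗ₘ (α_ A B D).hom) =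
      coformTensor η (coformTensor η' η'') := by
  have h := tensor_associativity A' A B' B D' D
  unfold coformTensor
  have e1 : ((λ_ (𝟙_ C)).inv ≫ (η ⊗ₘ η') ≫ tensorμ A' A B' B) ⊗ₘ η'' =
      ((λ_ (𝟙_ C)).inv ▷ 𝟙_ C) ≫ ((η ⊗ₘ η') ⊗ₘ η'') ≫ tensorμ A' A B' B ▷ (D' ⊗ D) := by
    simp only [MonoidalCategory.tensorHom_def']
    monoidal
  have e2 : η ⊗ₘ ((λ_ (𝟙_ C)).inv ≫ (η' ⊗ₘ η'') ≫ tensorμ B' B D' D) =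
      (𝟙_ C ◁ (λ_ (𝟙_ C)).inv) ≫ (η ⊗ₘ (η' ⊗ₘ η'')) ≫ (A' ⊗ A) ◁ tensorμ B' B D' D := by
    simp only [MonoidalCategory.tensorHom_def]
    monoidal
  rw [e1, e2]
  simp only [Category.assoc, h]
  rw [associator_naturality_assoc]
  congr 1
  simp only [← Category.assoc]
  congr 3
  monoidal_coherence

theorem coformTensor_braiding {A' A B' B : C} (η : 𝟙_ C ⟶ A' ⊗ A) (η' : 𝟙_ C ⟶ B' ⊗ B) :
    coformTensor η η' ≫ ((β_ A' B').hom ⊗ₘ (β_ A B).hom) = coformTensor η' η := by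
  have h := tensorμ_braiding A' B' A B
  have h' : tensorμ A' A B' B ≫ ((β_ A' B').hom ⊗ₘ (β_ A B).hom) =
      (β_ (A' ⊗ A) (B' ⊗ B)).hom ≫ tensorμ B' B A' A := by
    rw [← cancel_mono (tensorμ B' A' B A), Category.assoc, ← h]
    simp
  unfold coformTensor
  rw [Category.assoc, Category.assoc, h', BraidedCategory.braiding_naturality_assoc]
  simp [unitors_inv_equal]

/-- The coform of a triple product does not depend on the order of the last two factors. -/
theorem coformTensor_swapRight {A' A B' B D' D : C} (η : 𝟙_ C ⟶ A' ⊗ A) (η' : 𝟙_ C ⟶ B' ⊗ B)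
    (η'' : 𝟙_ C ⟶ D' ⊗ D) :
    coformTensor (coformTensor η η') η'' ≫ ((swapRight A' B' D').hom ⊗ₘ (swapRight A B D).hom) =
      coformTensor (coformTensor η η'') η' := by
  have h := coformTensor_comp η (coformTensor η' η'') (𝟙 _) (𝟙 _) (β_ B' D').hom (β_ B D).hom
  rw [coformTensor_braiding, id_tensorHom_id, Category.comp_id, ← coformTensor_assoc,
    ← coformTensor_assoc] at h
  rw [← cancel_mono ((α_ A' D' B').hom ⊗ₘ (α_ A D B).hom), h]
  simp [swapRight]

theorem coformFin_succ_step {A' A B' B D' D E' E : C} (η : 𝟙_ C ⟶ A' ⊗ A) (η' : 𝟙_ C ⟶ B' ⊗ B)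
    (η'' : 𝟙_ C ⟶ D' ⊗ D) (f' : B' ⊗ D' ⟶ E') (f : B ⊗ D ⟶ E) :
    coformTensor η (coformTensor η' η'' ≫ (f' ⊗ₘ f)) =
      coformTensor (coformTensor η η') η'' ≫
        (((α_ A' B' D').hom ≫ A' ◁ f') ⊗ₘ ((α_ A B D).hom ≫ A ◁ f)) := by
  have h := coformTensor_comp η (coformTensor η' η'') (𝟙 _) (𝟙 _) f' f
  rw [id_tensorHom_id, Category.comp_id] at h
  rw [h, ← coformTensor_assoc]
  simp

theorem tensorμ_braiding' (T U B D : C) :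
    tensorμ T U B D ≫ ((β_ T B).hom ⊗ₘ (β_ U D).hom) =
      (β_ (T ⊗ U) (B ⊗ D)).hom ≫ tensorμ B D T U := by
  have h := tensorμ_braiding T B U D
  rw [← cancel_mono (tensorμ B T D U), Category.assoc, ← h]
  simp

/-- The two ways of inserting a pair `B D` into the first of two pairs. -/
theorem tensorμ_swapRight (X Z T U B D : C) :
    tensorμ (X ⊗ T) (Z ⊗ U) B D ≫ ((swapRight X T B).hom ⊗ₘ (swapRight Z U D).hom) ≫
        tensorμ (X ⊗ B) T (Z ⊗ D) U =
      tensorμ X T Z U ▷ (B ⊗ D) ≫ (swapRight (X ⊗ Z) (T ⊗ U) (B ⊗ D)).hom ≫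
        tensorμ X Z B D ▷ (T ⊗ U) := by
  have h1 := tensor_associativity X Z T U B D
  have h2 := tensor_associativity X Z B D T U
  have h2' : (X ⊗ Z) ◁ tensorμ B D T U ≫ tensorμ X Z (B ⊗ T) (D ⊗ U) =
      (α_ _ _ _).inv ≫ tensorμ X Z B D ▷ (T ⊗ U) ≫ tensorμ (X ⊗ B) (Z ⊗ D) T U ≫
        ((α_ X B T).hom ⊗ₘ (α_ Z D U).hom) := by rw [h2]; simp
  have e : (swapRight X T B).hom ⊗ₘ (swapRight Z U D).hom =
      ((α_ _ _ _).hom ⊗ₘ (α_ _ _ _).hom) ≫ (X ◁ (β_ T B).hom ⊗ₘ Z ◁ (β_ U D).hom) ≫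
        ((α_ _ _ _).inv ⊗ₘ (α_ _ _ _).inv) := by
    simp [swapRight]
  rw [← cancel_epi (tensorμ X Z T U ▷ (B ⊗ D)), e]
  simp only [Category.assoc]
  rw [reassoc_of% h1, ← tensorμ_natural_right_assoc, ← MonoidalCategory.whiskerLeft_comp_assoc,
    tensorμ_braiding', MonoidalCategory.whiskerLeft_comp_assoc, reassoc_of% h2',
    ← comp_whiskerRight_assoc]
  simp [swapRight]

theorem interchange_zero_step {X T Z U B D X' Z' V : C} (z : T ⊗ U ⟶ V) (e₁ : X ⊗ B ⟶ X')
    (e₂ : Z ⊗ D ⟶ Z') :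
    tensorμ (X ⊗ T) (Z ⊗ U) B D ≫
        (((swapRight X T B).hom ≫ e₁ ▷ T) ⊗ₘ ((swapRight Z U D).hom ≫ e₂ ▷ U)) ≫
        tensorμ X' T Z' U ≫ (X' ⊗ Z') ◁ z =
      (tensorμ X T Z U ≫ (X ⊗ Z) ◁ z) ▷ (B ⊗ D) ≫ (swapRight (X ⊗ Z) V (B ⊗ D)).hom ≫
        (tensorμ X Z B D ≫ (e₁ ⊗ₘ e₂)) ▷ V := by
  have h := tensorμ_swapRight X Z T U B D
  have h3 := tensorμ_natural e₁ (𝟙 T) e₂ (𝟙 U)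
  simp only [tensorHom_id, id_whiskerRight] at h3
  have h4 := swapRight_natural (𝟙 (X ⊗ Z)) z (𝟙 (B ⊗ D))
  simp only [tensorHom_id, id_tensorHom, id_whiskerRight] at h4
  rw [← tensorHom_comp_tensorHom_assoc, reassoc_of% h3, reassoc_of% h, comp_whiskerRight,
    Category.assoc, reassoc_of% h4]
  rw [comp_whiskerRight, whisker_exchange_assoc, whisker_exchange]

theorem interchange_succ_step {X T Z U B D T' U' V V' : C} (z : T ⊗ U ⟶ V) (z' : T' ⊗ U' ⟶ V')
    (i₁ : T ⊗ B ⟶ T') (i₂ : U ⊗ D ⟶ U') (ins : V ⊗ (B ⊗ D) ⟶ V')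
    (h : tensorμ T U B D ≫ (i₁ ⊗ₘ i₂) ≫ z' = z ▷ (B ⊗ D) ≫ ins) :
    tensorμ (X ⊗ T) (Z ⊗ U) B D ≫
        (((α_ X T B).hom ≫ X ◁ i₁) ⊗ₘ ((α_ Z U D).hom ≫ Z ◁ i₂)) ≫
        tensorμ X T' Z U' ≫ (X ⊗ Z) ◁ z' =
      (tensorμ X T Z U ≫ (X ⊗ Z) ◁ z) ▷ (B ⊗ D) ≫ (α_ _ _ _).hom ≫ (X ⊗ Z) ◁ ins := by
  have h1 := tensor_associativity X Z T U B D
  rw [← cancel_epi (tensorμ X Z T U ▷ (B ⊗ D)), ← tensorHom_comp_tensorHom_assoc, reassoc_of% h1,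
    ← tensorμ_natural_right_assoc, tensorμ_tensorμ_assoc,
    ← MonoidalCategory.whiskerLeft_comp, ← MonoidalCategory.whiskerLeft_comp, h,
    ← comp_whiskerRight_assoc, tensorμ_tensorμ_assoc]
  simp

end Permutations

end

/-! ### Products of families -/

section

section Families

variable {C : Type u} [Category.{v} C] [MonoidalCategory C]

/-- The product of a family of morphisms. -/
def tensorFinMap : (n : ℕ) → {X Z : Fin n → C} → (∀ k, X k ⟶ Z k) → (tensorFin n X ⟶ tensorFin n Z)
  | 0, _, _, _ => 𝟙 (𝟙_ C)
  | n + 1, _, _, f => f 0 ⊗ₘ tensorFinMap n (fun k => f k.succ)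

/-- The product of a family of morphisms, with the `i`-th one omitted. -/
def restFinMap : (n : ℕ) → (i : Fin n) → {X Z : Fin n → C} → (∀ k, X k ⟶ Z k) →
    (restFin n i X ⟶ restFin n i Z)
  | n + 1, ⟨0, _⟩, _, _, f => tensorFinMap n (fun k => f k.succ)
  | n + 1, ⟨i + 1, h⟩, _, _, f =>
      f 0 ⊗ₘ restFinMap n ⟨i, Nat.lt_of_succ_lt_succ h⟩ (fun k => f k.succ)

theorem tensorFinMap_comp : ∀ (n : ℕ) {X Y Z : Fin n → C} (f : ∀ k, X k ⟶ Y k)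
    (g : ∀ k, Y k ⟶ Z k),
    tensorFinMap n f ≫ tensorFinMap n g = tensorFinMap n (fun k => f k ≫ g k)
  | 0, _, _, _, _, _ => Category.id_comp _
  | n + 1, _, _, _, f, g =>
    (tensorHom_comp_tensorHom _ _ _ _).trans
      (congrArg (f 0 ≫ g 0 ⊗ₘ ·) (tensorFinMap_comp n (fun k => f k.succ) fun k => g k.succ))

theorem tensorFinMap_id : ∀ (n : ℕ) (X : Fin n → C),
    tensorFinMap n (fun k => 𝟙 (X k)) = 𝟙 (tensorFin n X)
  | 0, _ => rfl
  | n + 1, X => by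
    simp only [tensorFinMap, tensorFinMap_id n]
    exact id_tensorHom_id _ _

variable [SymmetricCategory C]

/-- The interchange of factors `(X₁ X₂ ⋯) ⋄ (Z₁ Z₂ ⋯) ⟶ (X₁ Z₁) ⋄ (X₂ Z₂) ⋄ ⋯`. -/
def interchange : (n : ℕ) → (X Z : Fin n → C) →
    (tensorFin n X ⊗ tensorFin n Z ⟶ tensorFin n (fun k => X k ⊗ Z k))
  | 0, _, _ => (λ_ (𝟙_ C)).hom
  | n + 1, X, Z => tensorμ (X 0) (tensorFin n fun k => X k.succ) (Z 0)
        (tensorFin n fun k => Z k.succ) ≫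
      (X 0 ⊗ Z 0) ◁ interchange n (fun k => X k.succ) (fun k => Z k.succ)

/-- The coform of the product of a family. -/
def coformFin : (n : ℕ) → (P : Fin n → DPair C) →
    (𝟙_ C ⟶ tensorFin n (fun k => (P k).co) ⊗ tensorFin n (fun k => (P k).ob))
  | 0, _ => (λ_ (𝟙_ C)).inv
  | n + 1, P => coformTensor (P 0).η (coformFin n fun k => (P k.succ))

/-- Multiplication of the `i`-th factor of a product by `B` from the right. The `i`-th entry of the
tuple `y` changes to `x`. -/
def insertRight {α : Type*} (F : α → C) (B : C) (x : α) : (n : ℕ) → (i : Fin n) → (y : Fin n → α) →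
    (F (y i) ⊗ B ≅ F x) →
    (tensorFin n (fun k => F (y k)) ⊗ B ≅ tensorFin n (fun k => F (setAt x n i y k)))
  | _ + 1, ⟨0, _⟩, _, e => swapRight _ _ _ ≪≫ whiskerRightIso e _
  | n + 1, ⟨i + 1, h⟩, y, e => α_ _ _ _ ≪≫ whiskerLeftIso (F (y 0))
      (insertRight F B x n ⟨i, Nat.lt_of_succ_lt_succ h⟩ (fun k => y k.succ) e)

/-- Multiplying the `i`-th factor by `B` and then bringing it to the front. -/
theorem insertRight_pullSetIso {α : Type*} (F : α → C) (B : C) (x : α) :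
    ∀ (n : ℕ) (i : Fin n) (y : Fin n → α) (e : F (y i) ⊗ B ≅ F x),
    (insertRight F B x n i y e).hom ≫ (pullSetIso F x n i y).hom =
      (pullIso n i (fun k => F (y k))).hom ▷ B ≫ (swapRight _ _ _).hom ≫ e.hom ▷ _
  | _ + 1, ⟨0, _⟩, _, e => insertRight_zero_step e.hom
  | n + 1, ⟨i + 1, h⟩, y, e =>
    insertRight_pull_step _ _ _ e.hom
      (insertRight_pullSetIso F B x n ⟨i, Nat.lt_of_succ_lt_succ h⟩ (fun k => y k.succ) e)

/-- Products of morphisms commute with bringing the `i`-th factor to the front. The morphisms depend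
on the entries of the target tuple, one of which is replaced. -/
theorem tensorFinMap_pullSetIso {β : Type*} (Y : β → C) (x : β) : ∀ (n : ℕ) (i : Fin n)
    (X : Fin n → C) (y : Fin n → β) (φ : ∀ k z, X k ⟶ Y z),
    tensorFinMap n (fun k => φ k (setAt x n i y k)) ≫ (pullSetIso Y x n i y).hom =
      (pullIso n i X).hom ≫ (φ i x ⊗ₘ restFinMap n i (fun k => φ k (y k)))
  | _ + 1, ⟨0, _⟩, _, _, _ => (Category.comp_id _).trans (Category.id_comp _).symm
  | n + 1, ⟨i + 1, h⟩, X, y, φ => tensorFinMap_pull_step (φ 0 (y 0)) _ _ _ _ _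
      (tensorFinMap_pullSetIso Y x n ⟨i, Nat.lt_of_succ_lt_succ h⟩ (fun k => X k.succ)
        (fun k => y k.succ) (fun k => φ k.succ))

/-- As `tensorFinMap_pullSetIso`, with the replaced entry in the source. -/
theorem tensorFinMap_pullIso {α : Type*} (F : α → C) (p : α) : ∀ (n : ℕ) (i : Fin n)
    (P : Fin n → α) (Z : Fin n → C) (ψ : ∀ k q, F q ⟶ Z k),
    tensorFinMap n (fun k => ψ k (setAt p n i P k)) ≫ (pullIso n i Z).hom =
      (pullSetIso F p n i P).hom ≫ (ψ i p ⊗ₘ restFinMap n i (fun k => ψ k (P k)))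
  | _ + 1, ⟨0, _⟩, _, _, _ => (Category.comp_id _).trans (Category.id_comp _).symm
  | n + 1, ⟨i + 1, h⟩, P, Z, ψ => tensorFinMap_pull_step (ψ 0 (P 0)) _ _ _ _ _
      (tensorFinMap_pullIso F p n ⟨i, Nat.lt_of_succ_lt_succ h⟩ (fun k => P k.succ)
        (fun k => Z k.succ) (fun k => ψ k.succ))

/-- The coform of a product of a family one of whose members is multiplied by `Q`. -/
theorem coformFin_setAt (Q : DPair C) : ∀ (n : ℕ) (i : Fin n) (P : Fin n → DPair C),
    coformFin n (setAt ((P i).tensor Q) n i P) = coformTensor (coformFin n P) Q.η ≫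
      ((insertRight DPair.co Q.co ((P i).tensor Q) n i P (Iso.refl _)).hom ⊗ₘ
        (insertRight DPair.ob Q.ob ((P i).tensor Q) n i P (Iso.refl _)).hom)
  | n + 1, ⟨0, _⟩, P => by
    have h := coformTensor_swapRight (P 0).η (coformFin n fun k => P k.succ) Q.η
    refine h.symm.trans ?_
    have e : ∀ A R B : C, (swapRight A R B).hom = (swapRight A R B).hom ≫ 𝟙 (A ⊗ B) ▷ R := by simp
    exact congrArg₂ (fun s t => coformTensor (coformTensor (P 0).η (coformFin n fun k => P k.succ)) Q.η
      ≫ (s ⊗ₘ t)) (e _ _ _) (e _ _ _)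
  | n + 1, ⟨i + 1, h⟩, P => by
    have ih := coformFin_setAt Q n ⟨i, Nat.lt_of_succ_lt_succ h⟩ (fun k => P k.succ)
    exact (congrArg (coformTensor (P 0).η) ih).trans (coformFin_succ_step _ _ _ _ _)

/-- The interchange of factors is compatible with the multiplication of the `i`-th factors. -/
theorem interchange_insertRight {α : Type*} (F₁ F₂ : α → C) (B D : C) (x : α) :
    ∀ (n : ℕ) (i : Fin n) (y : Fin n → α) (e₁ : F₁ (y i) ⊗ B ≅ F₁ x) (e₂ : F₂ (y i) ⊗ D ≅ F₂ x),
    tensorμ (tensorFin n fun k => F₁ (y k)) (tensorFin n fun k => F₂ (y k)) B D ≫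
        ((insertRight F₁ B x n i y e₁).hom ⊗ₘ (insertRight F₂ D x n i y e₂).hom) ≫
        interchange n (fun k => F₁ (setAt x n i y k)) (fun k => F₂ (setAt x n i y k)) =
      interchange n (fun k => F₁ (y k)) (fun k => F₂ (y k)) ▷ (B ⊗ D) ≫
        (insertRight (fun a => F₁ a ⊗ F₂ a) (B ⊗ D) x n i y
          (asIso (tensorμ (F₁ (y i)) (F₂ (y i)) B D) ≪≫ (e₁ ⊗ᵢ e₂))).hom
  | _ + 1, ⟨0, _⟩, _, e₁, e₂ => interchange_zero_step _ e₁.hom e₂.hom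
  | n + 1, ⟨i + 1, h⟩, y, e₁, e₂ => interchange_succ_step _ _ _ _ _
      (interchange_insertRight F₁ F₂ B D x n ⟨i, Nat.lt_of_succ_lt_succ h⟩ (fun k => y k.succ) e₁ e₂)

end Families

end

/-! ### The morphism of a factor -/

section

section
variable {C : Type u} [Category.{v} C] [MonoidalCategory C] [SymmetricCategory C]

/-- A strand that passes an open morphism, whose name is then merged into `D`, may be moved past `R`
before or after. -/
theorem swapRight_pass {D R Q N b b₁ : C} (ν : b ⟶ Q ⊗ b₁) (μ : D ⊗ Q ⟶ N) :
    (D ⊗ R) ◁ ν ≫ (α_ _ _ _).inv ≫ ((swapRight D R Q).hom ≫ μ ▷ R) ▷ b₁ =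
      (swapRight D R b).hom ≫ (D ◁ ν ≫ (α_ _ _ _).inv ≫ μ ▷ b₁) ▷ R ≫ (swapRight N b₁ R).hom := by
  have h1 : (β_ R b₁).hom ≫ (β_ b₁ R).hom = 𝟙 _ := SymmetricCategory.symmetry _ _
  simp only [swapRight, Iso.trans_hom, Iso.symm_hom, whiskerLeftIso_hom]
  symm
  calc _ = 𝟙 _ ⊗≫ D ◁ ((β_ R b).hom ≫ ν ▷ R) ⊗≫ (μ ▷ (b₁ ⊗ R) ≫ N ◁ (β_ b₁ R).hom) ⊗≫ 𝟙 _ := by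
        monoidal
    _ = 𝟙 _ ⊗≫ D ◁ (R ◁ ν) ⊗≫ D ◁ ((β_ R Q).hom ▷ b₁) ⊗≫ (D ⊗ Q) ◁ ((β_ R b₁).hom ≫ (β_ b₁ R).hom) ⊗≫
          μ ▷ (R ⊗ b₁) ⊗≫ 𝟙 _ := by
        rw [← whisker_exchange, ← BraidedCategory.braiding_naturality_right,
          BraidedCategory.braiding_tensor_right_hom]
        monoidal
    _ = _ := by rw [h1]; monoidal

/-- The permutation of factors multiplying the `i`-th factor `A* A` of a family by `B* B`. -/
def insertPair (n : ℕ) (i : Fin n) (P : Fin n → DPair C) (Q : DPair C) :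
    tensorFin n (fun k => (P k).co ⊗ (P k).ob) ⊗ (Q.co ⊗ Q.ob) ≅
      tensorFin n (fun k => (setAt ((P i).tensor Q) n i P k).co ⊗
        (setAt ((P i).tensor Q) n i P k).ob) :=
  insertRight (fun p : DPair C => p.co ⊗ p.ob) (Q.co ⊗ Q.ob) ((P i).tensor Q) n i P
    (asIso (tensorμ (P i).co (P i).ob Q.co Q.ob) ≪≫ (Iso.refl _ ⊗ᵢ Iso.refl _))

/-- The strand `b` passes an open morphism, and the factor `B* B` which arises is merged into the
`i`-th factor of a family. -/
def passStep (n : ℕ) (i : Fin n) (P : Fin n → DPair C) (Q : DPair C) {b b₁ : C}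
    (G : b ⊗ Q.ob ⟶ Q.ob ⊗ b₁) :
    tensorFin n (fun k => (P k).co ⊗ (P k).ob) ⊗ b ⟶
      tensorFin n (fun k => (setAt ((P i).tensor Q) n i P k).co ⊗
        (setAt ((P i).tensor Q) n i P k).ob) ⊗ b₁ :=
  _ ◁ openName Q.η G ≫ (α_ _ _ _).inv ≫ (insertPair n i P Q).hom ▷ b₁

/-- A step at the `i`-th factor is a step at the front once this factor has been brought there. -/
theorem passStep_pullSetIso (n : ℕ) (i : Fin n) (P : Fin n → DPair C) (Q : DPair C) {b b₁ : C}
    (G : b ⊗ Q.ob ⟶ Q.ob ⊗ b₁) :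
    passStep n i P Q G ≫
        (pullSetIso (fun p : DPair C => p.co ⊗ p.ob) ((P i).tensor Q) n i P).hom ▷ b₁ =
      (pullIso n i (fun k => (P k).co ⊗ (P k).ob)).hom ▷ b ≫ (swapRight _ _ b).hom ≫
        openStep (P i).co (P i).ob Q.η G ▷ _ ≫ (swapRight _ b₁ _).hom := by
  have h := insertRight_pullSetIso (fun p : DPair C => p.co ⊗ p.ob) (Q.co ⊗ Q.ob)
    ((P i).tensor Q) n i P
    (asIso (tensorμ (P i).co (P i).ob Q.co Q.ob) ≪≫ (Iso.refl _ ⊗ᵢ Iso.refl _))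
  have h2 := swapRight_pass (D := (P i).co ⊗ (P i).ob)
    (R := restFin n i (fun k => (P k).co ⊗ (P k).ob)) (openName Q.η G)
    (tensorμ (P i).co (P i).ob Q.co Q.ob)
  unfold passStep insertPair
  rw [Category.assoc, Category.assoc, ← comp_whiskerRight, h]
  have e : (asIso (tensorμ (P i).co (P i).ob Q.co Q.ob) ≪≫
      (Iso.refl ((P i).co ⊗ Q.co) ⊗ᵢ Iso.refl ((P i).ob ⊗ Q.ob))).hom =
      tensorμ (P i).co (P i).ob Q.co Q.ob := by simp
  refine (congrArg (fun t => _ ◁ openName Q.η G ≫ (α_ _ _ _).inv ≫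
    ((pullIso n i (fun k => (P k).co ⊗ (P k).ob)).hom ▷ (Q.co ⊗ Q.ob) ≫ (swapRight _ _ _).hom ≫
      t ▷ _) ▷ b₁) e).trans ?_
  refine Eq.trans ?_ (congrArg ((pullIso n i (fun k => (P k).co ⊗ (P k).ob)).hom ▷ b ≫ ·) h2)
  rw [comp_whiskerRight, ← associator_inv_naturality_left_assoc, whisker_exchange_assoc]

/-- The permutation `moveIso` of the algorithm, applied after a product of morphisms. -/
theorem braiding_moveIso {D R b R' : C} (A A' : C) (f : D ⟶ A ⊗ A') (r : R ⟶ R') :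
    (f ⊗ₘ r) ▷ b ≫ (β_ ((A ⊗ A') ⊗ R') b).hom ≫ (α_ b (A ⊗ A') R').inv ≫ (α_ b A A').inv ▷ R' =
      (swapRight D R b).hom ≫ (f ▷ b ≫ (β_ (A ⊗ A') b).hom ≫ (α_ b A A').inv) ▷ R ≫ _ ◁ r := by
  have hn := swapRight_natural f r (𝟙 b)
  simp only [tensorHom_id] at hn
  have h : (β_ ((A ⊗ A') ⊗ R') b).hom ≫ (α_ b (A ⊗ A') R').inv =
      (swapRight (A ⊗ A') R' b).hom ≫ (β_ (A ⊗ A') b).hom ▷ R' := by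
    rw [BraidedCategory.braiding_tensor_left_hom]
    simp [swapRight]
  rw [reassoc_of% h, reassoc_of% hn, MonoidalCategory.tensorHom_def']
  simp only [comp_whiskerRight, Category.assoc, whisker_exchange_assoc, whisker_exchange]

end

variable {K : Type w} [Field K] {C : Type u} [Category.{v} C] [Abelian C] [Linear K C]
  [MonoidalCategory C] [MonoidalPreadditive C] [MonoidalLinear K C]
  [LeftRigidCategory C] [SymmetricCategory C] [Stable C]

namespace Simples

variable (S : Simples K C)

open Classical in
/-- The universal map followed by the block decomposition of a power of the circulator. -/
theorem sum_circPow (b : S.Obj) (Y : DPair C) (s : ℤ) (z : S.Obj) :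
    ∑ x : S.Obj, ∑ a : S.Obj, ∑ i, S.coendMapRight Y (b : C) x ≫
      (S.basis a (((b : C) ⊗ (x : C)) ⊗ dual (x : C))).ε' i ≫
      S.circPow b a s (LinearMap.single K
        (fun x : S.Obj => (a : C) ⟶ ((b : C) ⊗ (x : C)) ⊗ dual (x : C)) x
        ((S.basis a (((b : C) ⊗ (x : C)) ⊗ dual (x : C))).ε i)) z =
    openStep Y.co Y.ob (DPair.of (intPow (b : C) s)).η (powMor (b : C) s) ≫
      S.coendMapRight (Y.tensor (DPair.of (intPow (b : C) s))) (b : C) z := by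
  refine S.hom_ext fun a₀ k => ?_
  have h := congrFun (S.circPow_coendMapRight b a₀ Y k s) z
  refine Eq.trans ?_ h
  have hs : (fun x => k ≫ S.coendMapRight Y (b : C) x) = ∑ x : S.Obj, LinearMap.single K
      (fun x : S.Obj => (a₀ : C) ⟶ ((b : C) ⊗ (x : C)) ⊗ dual (x : C)) x
        (k ≫ S.coendMapRight Y (b : C) x) := by
    symm
    exact LinearMap.sum_single_apply
      (φ := fun x : S.Obj => (a₀ : C) ⟶ ((b : C) ⊗ (x : C)) ⊗ dual (x : C)) _
  rw [hs, map_sum, Finset.sum_apply, Preadditive.comp_sum]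
  refine Finset.sum_congr rfl fun x _ => ?_
  rw [Preadditive.comp_sum, Finset.sum_eq_single a₀ ?_ (by simp)]
  · have hb := S.sum_comp_basis a₀ (k ≫ S.coendMapRight Y (b : C) x)
    conv_rhs => rw [← hb, map_sum, map_sum, Finset.sum_apply]
    rw [Preadditive.comp_sum]
    refine Finset.sum_congr rfl fun i _ => ?_
    obtain ⟨r, hr⟩ := S.exists_smul_id a₀ ((k ≫ S.coendMapRight Y (b : C) x) ≫
      (S.basis a₀ (((b : C) ⊗ (x : C)) ⊗ dual (x : C))).ε' i)
    rw [hr, Linear.smul_comp, Category.id_comp, map_smul, map_smul, Pi.smul_apply,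
      ← Category.assoc, ← Category.assoc, hr, Linear.smul_comp, Category.id_comp]
  · intro a _ ha
    rw [Preadditive.comp_sum]
    refine Finset.sum_eq_zero fun i _ => ?_
    rw [← Category.assoc, ← Category.assoc, S.hom_eq_zero' ha.symm (_ ≫ _), zero_comp]

variable {n : ℕ}

/-- The vector of the state space with free strand `b` attached to a family of objects with chosen
duals and a morphism `ψ : 1 ⟶ b* ⋄ (A₁* A₁ ⋄ A₂* A₂ ⋄ ⋯) ⋄ b`. -/
def strandState (b : S.Obj) (P : Fin n → DPair C)
    (ψ : 𝟙_ C ⟶ dual (b : C) ⊗ (tensorFin n (fun k => (P k).co ⊗ (P k).ob) ⊗ (b : C)))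
    (y : Fin n → S.Obj) : 𝟙_ C ⟶ dual (b : C) ⊗ ((b : C) ⊗ S.stateObj y) :=
  ψ ≫ dual (b : C) ◁ (tensorFinMap n (fun k => S.coendMap (P k) (y k)) ▷ (b : C) ≫ (β_ _ _).hom)

open Classical in
/-- The blocks of the morphism of a factor, on vectors. -/
theorem factor_apply (i : Fin n) (s : ℤ) (v : S.VRel n) (b : S.Obj) (y : Fin n → S.Obj) :
    S.factor i s v b y = ∑ x : S.Obj, ∑ a : S.Obj, ∑ j,
      (v b (setAt x n i y) ≫ dual (b : C) ◁ ((S.moveIso b x i y).hom ≫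
        ((S.basis a (((b : C) ⊗ (x : C)) ⊗ dual (x : C))).ε' j ≫
          S.circPow b a s (LinearMap.single K
            (fun x : S.Obj => (a : C) ⟶ ((b : C) ⊗ (x : C)) ⊗ dual (x : C)) x
            ((S.basis a (((b : C) ⊗ (x : C)) ⊗ dual (x : C))).ε j)) (y i)) ▷ S.restObj i y ≫
        (S.moveIso' b i y).inv)) := by
  unfold factor
  simp only [LinearMap.pi_apply, LinearMap.sum_apply]
  refine Finset.sum_congr rfl fun x _ => Finset.sum_congr rfl fun a _ => ?_
  simp only [LinearMap.comp_apply, LinearMap.proj_apply]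
  rw [nablaInv_apply, map_sum, map_sum, map_sum]
  refine Finset.sum_congr rfl fun j _ => ?_
  rw [LinearMap.lTensor_tmul, nabla_tmul]
  simp [Linear.rightComp_apply]

end Simples

end

section

variable {K : Type w} [Field K] {C : Type u} [Category.{v} C] [Abelian C] [Linear K C]
  [MonoidalCategory C] [MonoidalPreadditive C] [MonoidalLinear K C]
  [LeftRigidCategory C] [SymmetricCategory C] [Stable C]

namespace Simples

variable (S : Simples K C) {n : ℕ}

/-- The first permutation in the morphism of a factor, on states. -/
theorem coendMap_moveIso (b x : S.Obj) (i : Fin n) (P : Fin n → DPair C) (y : Fin n → S.Obj) :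
    tensorFinMap n (fun k => S.coendMap (P k) (setAt x n i y k)) ▷ (b : C) ≫ (β_ _ _).hom ≫
        (S.moveIso b x i y).hom =
      (pullIso n i (fun k => (P k).co ⊗ (P k).ob)).hom ▷ (b : C) ≫ (swapRight _ _ (b : C)).hom ≫
        S.coendMapRight (P i) (b : C) x ▷ _ ≫
          _ ◁ restFinMap n i (fun k => S.coendMap (P k) (y k)) := by
  have h := tensorFinMap_pullSetIso (fun x : S.Obj => (x : C) ⊗ dual (x : C)) x n i
    (fun k => (P k).co ⊗ (P k).ob) y (fun k z => S.coendMap (P k) z)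
  have h2 := braiding_moveIso (b := (b : C)) (x : C) (dual (x : C)) (S.coendMap (P i) x)
    (restFinMap n i (fun k => S.coendMap (P k) (y k)))
  unfold coendMapRight
  rw [← h2, ← comp_whiskerRight_assoc, ← h, comp_whiskerRight_assoc,
    reassoc_of% BraidedCategory.braiding_naturality_left
      (pullSetIso (fun x : S.Obj => (x : C) ⊗ dual (x : C)) x n i y).hom (b : C)]
  simp [moveIso]

/-- The last permutation in the morphism of a factor, on states. -/
theorem coendMap_moveIso' (b : S.Obj) (i : Fin n) (P : Fin n → DPair C) (Y : DPair C)
    (y : Fin n → S.Obj) :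
    tensorFinMap n (fun k => S.coendMap (setAt Y n i P k) (y k)) ▷ (b : C) ≫ (β_ _ _).hom ≫
        (S.moveIso' b i y).hom =
      (pullSetIso (fun p : DPair C => p.co ⊗ p.ob) Y n i P).hom ▷ (b : C) ≫
        (swapRight _ _ (b : C)).hom ≫ S.coendMapRight Y (b : C) (y i) ▷ _ ≫
          _ ◁ restFinMap n i (fun k => S.coendMap (P k) (y k)) := by
  have h := tensorFinMap_pullIso (fun p : DPair C => p.co ⊗ p.ob) Y n i P
    (fun j => (y j : C) ⊗ dual (y j : C)) (fun k q => S.coendMap q (y k))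
  have h2 := braiding_moveIso (b := (b : C)) (y i : C) (dual (y i : C)) (S.coendMap Y (y i))
    (restFinMap n i (fun k => S.coendMap (P k) (y k)))
  unfold coendMapRight
  rw [← h2, ← comp_whiskerRight_assoc, ← h, comp_whiskerRight_assoc,
    reassoc_of% BraidedCategory.braiding_naturality_left
      (pullIso n i fun j => (y j : C) ⊗ dual (y j : C)).hom (b : C)]
  simp [moveIso']

/-- The morphism of a factor `x_i^s` lets the strand `b` pass through the open morphism of the
power `b^s`, the factors `b^s` and its dual being merged into the `i`-th pair of the family. -/
theorem factor_strandState (i : Fin n) (s : ℤ) (v : S.VRel n) (b : S.Obj) (P : Fin n → DPair C)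
    (ψ : 𝟙_ C ⟶ dual (b : C) ⊗ (tensorFin n (fun k => (P k).co ⊗ (P k).ob) ⊗ (b : C)))
    (hv : v b = S.strandState b P ψ) :
    S.factor i s v b = S.strandState b
      (setAt ((P i).tensor (DPair.of (intPow (b : C) s))) n i P)
      (ψ ≫ dual (b : C) ◁ passStep n i P (DPair.of (intPow (b : C) s)) (powMor (b : C) s)) := by
  classical
  funext y
  rw [factor_apply]
  set θ := ψ ≫ dual (b : C) ◁ ((pullIso n i (fun k => (P k).co ⊗ (P k).ob)).hom ▷ (b : C) ≫
    (swapRight _ _ (b : C)).hom) with hθ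
  set rr := restFinMap n i (fun k => S.coendMap (P k) (y k)) with hrr
  have h1 : ∀ x a j, (v b (setAt x n i y) ≫ dual (b : C) ◁ ((S.moveIso b x i y).hom ≫
        ((S.basis a (((b : C) ⊗ (x : C)) ⊗ dual (x : C))).ε' j ≫
          S.circPow b a s (LinearMap.single K
            (fun x : S.Obj => (a : C) ⟶ ((b : C) ⊗ (x : C)) ⊗ dual (x : C)) x
            ((S.basis a (((b : C) ⊗ (x : C)) ⊗ dual (x : C))).ε j)) (y i)) ▷ S.restObj i y ≫
        (S.moveIso' b i y).inv)) = θ ≫ dual (b : C) ◁ ((S.coendMapRight (P i) (b : C) x ≫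
        (S.basis a (((b : C) ⊗ (x : C)) ⊗ dual (x : C))).ε' j ≫
          S.circPow b a s (LinearMap.single K
            (fun x : S.Obj => (a : C) ⟶ ((b : C) ⊗ (x : C)) ⊗ dual (x : C)) x
            ((S.basis a (((b : C) ⊗ (x : C)) ⊗ dual (x : C))).ε j)) (y i)) ▷ _ ≫ _ ◁ rr ≫
              (S.moveIso' b i y).inv) := by
    intro x a j
    have hm := S.coendMap_moveIso b x i P y
    rw [hv]
    unfold strandState
    rw [Category.assoc, ← MonoidalCategory.whiskerLeft_comp]
    simp only [Category.assoc]
    rw [reassoc_of% hm, hθ, Category.assoc, ← MonoidalCategory.whiskerLeft_comp]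
    simp only [Category.assoc, comp_whiskerRight, whisker_exchange_assoc]
    rfl
  have h2 : θ ≫ dual (b : C) ◁ ((openStep (P i).co (P i).ob
      (DPair.of (intPow (b : C) s)).η (powMor (b : C) s) ≫
      S.coendMapRight ((P i).tensor (DPair.of (intPow (b : C) s))) (b : C) (y i)) ▷ _ ≫ _ ◁ rr ≫
        (S.moveIso' b i y).inv) = S.strandState b
      (setAt ((P i).tensor (DPair.of (intPow (b : C) s))) n i P)
      (ψ ≫ dual (b : C) ◁ passStep n i P (DPair.of (intPow (b : C) s)) (powMor (b : C) s)) y := by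
    have hm := S.coendMap_moveIso' b i P ((P i).tensor (DPair.of (intPow (b : C) s))) y
    have hp := passStep_pullSetIso n i P (DPair.of (intPow (b : C) s)) (powMor (b : C) s)
    unfold strandState
    rw [hθ, Category.assoc, Category.assoc, ← MonoidalCategory.whiskerLeft_comp,
      ← MonoidalCategory.whiskerLeft_comp]
    congr 2
    rw [← cancel_mono (S.moveIso' b i y).hom]
    simp only [Category.assoc, Iso.inv_hom_id, Category.comp_id]
    rw [hm, reassoc_of% hp, swapRight_hom_hom_assoc, comp_whiskerRight, Category.assoc]
  rw [← h2, ← S.sum_circPow b (P i) s (y i)]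
  simp only [sum_whiskerRight, Preadditive.sum_comp, whiskerLeft_sum, Preadditive.comp_sum]
  exact Finset.sum_congr rfl fun x _ => Finset.sum_congr rfl fun a _ =>
    Finset.sum_congr rfl fun j _ => h1 x a j

end Simples

end

/-! ### Closing the free strand -/

section

section
variable {C : Type u} [Category.{v} C] [MonoidalCategory C]

/-- Transport of an open morphism along an isomorphism of the objects passed. -/
def openConj {A B : C} (u : A ≅ B) {b b₁ : C} (F : b ⊗ A ⟶ A ⊗ b₁) : b ⊗ B ⟶ B ⊗ b₁ :=
  b ◁ u.inv ≫ F ≫ u.hom ▷ b₁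

theorem openConj_trans {A B D : C} (u : A ≅ B) (u' : B ≅ D) {b b₁ : C} (F : b ⊗ A ⟶ A ⊗ b₁) :
    openConj u' (openConj u F) = openConj (u ≪≫ u') F := by
  simp [openConj]

/-- The open morphism without factors is neutral for composition. -/
theorem openConj_rightUnitor {A b b₁ : C} (F : b ⊗ A ⟶ A ⊗ b₁) :
    openConj (ρ_ A) (openComp F ((ρ_ b₁).hom ≫ (λ_ b₁).inv)) = F := by
  unfold openConj openComp
  calc _ = 𝟙 (b ⊗ A) ⊗≫ (F ▷ 𝟙_ C ≫ (A ⊗ b₁) ◁ 𝟙 (𝟙_ C)) ⊗≫ 𝟙 (A ⊗ b₁) := by monoidal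
    _ = _ := by monoidal

/-- Composition of open morphisms is associative. -/
theorem openComp_assoc {A B D b b₁ b₂ b₃ : C} (F : b ⊗ A ⟶ A ⊗ b₁) (G : b₁ ⊗ B ⟶ B ⊗ b₂)
    (H : b₂ ⊗ D ⟶ D ⊗ b₃) :
    openConj (α_ A B D).symm (openComp F (openComp G H)) = openComp (openComp F G) H := by
  unfold openConj openComp
  simp only [Iso.symm_inv, Iso.symm_hom]
  monoidal

theorem openComp_openConj {A A' B b b₁ b₂ : C} (u : A ≅ A') (F : b ⊗ A ⟶ A ⊗ b₁)
    (G : b₁ ⊗ B ⟶ B ⊗ b₂) :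
    openComp (openConj u F) G = openConj (whiskerRightIso u B) (openComp F G) := by
  unfold openConj openComp
  simp only [whiskerRightIso_hom, whiskerRightIso_inv]
  calc _ = 𝟙 _ ⊗≫ b ◁ u.inv ▷ B ⊗≫ F ▷ B ⊗≫ (u.hom ▷ (b₁ ⊗ B) ≫ A' ◁ G) ⊗≫ 𝟙 _ := by monoidal
    _ = _ := by rw [← whisker_exchange]; monoidal

variable [SymmetricCategory C]

/-- The name of an open morphism in which the strand does not interact with `φ`. -/
theorem openName_braiding {A' A b : C} (η : 𝟙_ C ⟶ A' ⊗ A) (φ : A ⟶ A) :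
    openName η ((β_ b A).hom ≫ φ ▷ b) = (λ_ b).inv ≫ (η ≫ A' ◁ φ) ▷ b := by
  unfold openName
  rw [SymmetricCategory.symmetry_assoc]
  monoidal

/-- An object passes a form from either side. -/
theorem cap_braiding {b' b A : C} (ev : b' ⊗ b ⟶ 𝟙_ C) :
    b' ◁ (β_ A b).hom ≫ (α_ b' b A).inv ≫ ev ▷ A =
      (α_ b' A b).inv ≫ (β_ b' A).hom ▷ b ≫ (α_ A b' b).hom ≫ A ◁ ev ≫
        (ρ_ A).hom ≫ (λ_ A).inv := by
  have h := BraidedCategory.braiding_naturality_right A ev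
  rw [BraidedCategory.braiding_tensor_right_hom] at h
  have h2 : (β_ b' A).hom ≫ (β_ A b').hom = 𝟙 _ := SymmetricCategory.symmetry _ _
  have h3 : (β_ A (𝟙_ C)).hom = (ρ_ A).hom ≫ (λ_ A).inv := by simp
  rw [← h3, h]
  simp only [Category.assoc, Iso.hom_inv_id_assoc]
  rw [← comp_whiskerRight_assoc, h2]
  simp

variable [LeftRigidCategory C] [Stable C]

/-- Closing the strand `b` of the name of an open morphism gives the name of its closure. -/
theorem openName_closure {A' A b : C} (η : 𝟙_ C ⟶ A' ⊗ A) (F : b ⊗ A ⟶ A ⊗ b) :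
    coform b ≫ dual b ◁ (openName η F ≫ (β_ (A' ⊗ A) b).hom) ≫ (α_ _ _ _).inv ≫
      formDual b ▷ (A' ⊗ A) ≫ (λ_ _).hom = η ≫ A' ◁ closure b A F := by
  have h1 : (β_ A' (dual b)).hom ≫ (β_ (dual b) A').hom = 𝟙 _ := SymmetricCategory.symmetry _ _
  have hn : openName η F = (ρ_ b).inv ≫ b ◁ η ≫ (α_ _ _ _).inv ≫ (β_ b A').hom ▷ A ≫
      (α_ _ _ _).hom ≫ A' ◁ F ≫ (α_ _ _ _).inv := by
    have := cup_braiding η b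
    unfold openName
    rw [MonoidalCategory.whiskerLeft_comp, Category.assoc, reassoc_of% this]
  have hcup := cup_braiding (coform b) A'
  have hcap := cap_braiding (A := A') (formDual b)
  rw [hn, BraidedCategory.braiding_tensor_left_hom A' A b]
  calc _ = 𝟙 _ ⊗≫ (coform b ▷ 𝟙_ C ≫ (dual b ⊗ b) ◁ η) ⊗≫ dual b ◁ (β_ b A').hom ▷ A ⊗≫
        dual b ◁ A' ◁ (F ≫ (β_ A b).hom) ⊗≫
        (dual b ◁ (β_ A' b).hom ≫ (α_ (dual b) b A').inv ≫ formDual b ▷ A') ▷ A ⊗≫ 𝟙 _ := by monoidal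
    _ = η ⊗≫ ((λ_ A').inv ≫ coform b ▷ A' ≫ (α_ _ _ _).hom ≫ dual b ◁ (β_ b A').hom) ▷ A ⊗≫
        dual b ◁ A' ◁ (F ≫ (β_ A b).hom) ⊗≫ (dual b ◁ (β_ A' b).hom ≫ (α_ (dual b) b A').inv ≫
          formDual b ▷ A') ▷ A ⊗≫ 𝟙 _ := by
        rw [← whisker_exchange]; monoidal
    _ = η ⊗≫ A' ◁ coform b ▷ A ⊗≫ ((β_ A' (dual b)).hom ▷ (b ⊗ A) ≫
        (dual b ⊗ A') ◁ (F ≫ (β_ A b).hom)) ⊗≫ (β_ (dual b) A').hom ▷ b ▷ A ⊗≫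
          A' ◁ formDual b ▷ A ⊗≫ 𝟙 _ := by
        rw [hcup, hcap]; monoidal
    _ = η ⊗≫ A' ◁ coform b ▷ A ⊗≫ A' ◁ dual b ◁ (F ≫ (β_ A b).hom) ⊗≫
        ((β_ A' (dual b)).hom ≫ (β_ (dual b) A').hom) ▷ b ▷ A ⊗≫
          A' ◁ formDual b ▷ A ⊗≫ 𝟙 _ := by
        rw [← whisker_exchange]; monoidal
    _ = _ := by rw [h1]; unfold closure; monoidal

theorem closure_openConj {A B : C} (u : A ≅ B) {b : C} (F : b ⊗ A ⟶ A ⊗ b) :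
    closure b B (openConj u F) = u.inv ≫ closure b A F ≫ u.hom := by
  unfold closure openConj
  calc _ = 𝟙 _ ⊗≫ (coform b ▷ B ≫ (dual b ⊗ b) ◁ u.inv) ⊗≫ dual b ◁ F ⊗≫
        dual b ◁ (u.hom ▷ b ≫ (β_ B b).hom) ⊗≫ formDual b ▷ B ⊗≫ 𝟙 _ := by monoidal
    _ = 𝟙 _ ⊗≫ u.inv ⊗≫ coform b ▷ A ⊗≫ dual b ◁ F ⊗≫ dual b ◁ (β_ A b).hom ⊗≫
        ((dual b ⊗ b) ◁ u.hom ≫ formDual b ▷ B) ⊗≫ 𝟙 _ := by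
        rw [← whisker_exchange, BraidedCategory.braiding_naturality_left]; monoidal
    _ = _ := by rw [whisker_exchange]; monoidal

/-- Closing the strand that passes `φ` without interaction and then `G`. -/
theorem closure_openComp_braiding {A B b : C} (φ : A ⟶ A) (G : b ⊗ B ⟶ B ⊗ b) :
    closure b (A ⊗ B) (openComp ((β_ b A).hom ≫ φ ▷ b) G) = φ ⊗ₘ closure b B G := by
  have h1 : (β_ A (dual b)).hom ≫ (β_ (dual b) A).hom = 𝟙 _ := SymmetricCategory.symmetry _ _
  have hcup := cup_braiding (coform b) A
  have hcap := cap_braiding (A := A) (formDual b)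
  unfold closure openComp
  rw [BraidedCategory.braiding_tensor_left_hom, MonoidalCategory.tensorHom_def']
  calc _ = 𝟙 _ ⊗≫ ((λ_ A).inv ≫ coform b ▷ A ≫ (α_ _ _ _).hom ≫ dual b ◁ (β_ b A).hom) ▷ B ⊗≫
        dual b ◁ φ ▷ b ▷ B ⊗≫ dual b ◁ A ◁ (G ≫ (β_ B b).hom) ⊗≫
        (dual b ◁ (β_ A b).hom ≫ (α_ (dual b) b A).inv ≫ formDual b ▷ A) ▷ B ⊗≫ 𝟙 _ := by monoidal
    _ = 𝟙 _ ⊗≫ A ◁ coform b ▷ B ⊗≫ ((β_ A (dual b)).hom ▷ (b ⊗ B) ≫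
        (dual b ◁ φ) ▷ (b ⊗ B) ≫ (dual b ⊗ A) ◁ (G ≫ (β_ B b).hom)) ⊗≫
        (β_ (dual b) A).hom ▷ b ▷ B ⊗≫ A ◁ formDual b ▷ B ⊗≫ 𝟙 _ := by
        rw [hcup, hcap]; monoidal
    _ = 𝟙 _ ⊗≫ A ◁ coform b ▷ B ⊗≫ A ◁ dual b ◁ (G ≫ (β_ B b).hom) ⊗≫
        ((β_ A (dual b)).hom ≫ dual b ◁ φ ≫ (β_ (dual b) A).hom) ▷ b ▷ B ⊗≫
          A ◁ formDual b ▷ B ⊗≫ 𝟙 _ := by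
        rw [← comp_whiskerRight_assoc, ← whisker_exchange]; monoidal
    _ = 𝟙 _ ⊗≫ A ◁ coform b ▷ B ⊗≫ A ◁ dual b ◁ (G ≫ (β_ B b).hom) ⊗≫
        (φ ▷ ((dual b ⊗ b) ⊗ B) ≫ A ◁ formDual b ▷ B) ⊗≫ 𝟙 _ := by
        rw [BraidedCategory.braiding_naturality_right, reassoc_of% h1]; monoidal
    _ = 𝟙 _ ⊗≫ A ◁ coform b ▷ B ⊗≫ (A ◁ dual b ◁ (G ≫ (β_ B b).hom) ⊗≫
        A ◁ formDual b ▷ B) ⊗≫ φ ▷ B ⊗≫ 𝟙 _ := by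
        rw [← whisker_exchange]; monoidal
    _ = _ := by monoidal

end

end

/-! ### The endomorphism of a relation -/

section

section
variable {C : Type u} [Category.{v} C] [MonoidalCategory C] [SymmetricCategory C]

/-- A step into a family, on names: the compatibility `h` of the interchanges carries the step of
the strand over to the grouped family. -/
theorem openName_pass {T U V B' B T' U' V' b b₁ b₂ : C} (η : 𝟙_ C ⟶ T ⊗ U) (η' : 𝟙_ C ⟶ B' ⊗ B)
    (F : b ⊗ U ⟶ U ⊗ b₁) (G : b₁ ⊗ B ⟶ B ⊗ b₂) (r' : T ⊗ B' ⟶ T') (r : U ⊗ B ≅ U')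
    (z : T ⊗ U ⟶ V) (z' : T' ⊗ U' ⟶ V') (ins : V ⊗ (B' ⊗ B) ⟶ V')
    (h : tensorμ T U B' B ≫ (r' ⊗ₘ r.hom) ≫ z' = z ▷ (B' ⊗ B) ≫ ins) :
    openName (coformTensor η η' ≫ (r' ⊗ₘ r.hom)) (openConj r (openComp F G)) ≫ z' ▷ b₂ =
      (openName η F ≫ z ▷ b₁) ≫ V ◁ openName η' G ≫ (α_ _ _ _).inv ≫ ins ▷ b₂ := by
  have h1 := openName_natural (coformTensor η η') r' r.hom (b ◁ r.inv ≫ openComp F G)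
  rw [← MonoidalCategory.whiskerLeft_comp_assoc, r.hom_inv_id, MonoidalCategory.whiskerLeft_id,
    Category.id_comp, Category.assoc, openName_openComp] at h1
  have e : openConj r (openComp F G) = b ◁ r.inv ≫ openComp F G ≫ r.hom ▷ b₂ := rfl
  rw [e, h1]
  unfold openStep
  simp only [Category.assoc, ← comp_whiskerRight, h]
  rw [← whisker_exchange_assoc, comp_whiskerRight, ← associator_inv_naturality_left_assoc]

/-- The family of duality pairs obtained by multiplying, for each power `x_i^l` of a word in turn,
the `i`-th pair by the pair of `b^l`. -/
def famWord [LeftRigidCategory C] [Stable C] {n : ℕ} (b : C) :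
    Word n → (Fin n → DPair C) → (Fin n → DPair C)
  | [], P => P
  | (i, l) :: R, P => famWord b R (setAt ((P i).tensor (DPair.of (intPow b l))) n i P)

/-- The permutation of factors distributing the factors of `R(b)` over the members of a family. -/
def distribWord [LeftRigidCategory C] [Stable C] {n : ℕ} (b : C) :
    (R : Word n) → (P : Fin n → DPair C) →
    (tensorFin n (fun k => (P k).ob) ⊗ relObj b R ≅ tensorFin n (fun k => (famWord b R P k).ob))
  | [], _ => ρ_ _
  | (i, l) :: R, P => (α_ _ _ _).symm ≪≫ whiskerRightIso
      (insertRight DPair.ob (intPow b l) ((P i).tensor (DPair.of (intPow b l))) n i P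
        (Iso.refl _)) _ ≪≫
      distribWord b R (setAt ((P i).tensor (DPair.of (intPow b l))) n i P)

end

variable {K : Type w} [Field K] {C : Type u} [Category.{v} C] [Abelian C] [Linear K C]
  [MonoidalCategory C] [MonoidalPreadditive C] [MonoidalLinear K C]
  [LeftRigidCategory C] [SymmetricCategory C] [Stable C]

namespace Simples

variable (S : Simples K C) {n : ℕ}

/-- The state with strand `b` given by an open morphism `F` of the product of a family. -/
def strandVec (b : S.Obj) (P : Fin n → DPair C)
    (F : (b : C) ⊗ tensorFin n (fun k => (P k).ob) ⟶ tensorFin n (fun k => (P k).ob) ⊗ (b : C)) :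
    ∀ y : Fin n → S.Obj, 𝟙_ C ⟶ dual (b : C) ⊗ ((b : C) ⊗ S.stateObj y) :=
  S.strandState b P (coform (b : C) ≫ dual (b : C) ◁ (openName (coformFin n P) F ≫
    interchange n (fun k => (P k).co) (fun k => (P k).ob) ▷ (b : C)))

/-- The state given by an endomorphism `φ` of the product of a family: the name of `φ`, with the
factors grouped in pairs, followed by the universal dinatural projections. -/
def stateVec (P : Fin n → DPair C)
    (φ : tensorFin n (fun k => (P k).ob) ⟶ tensorFin n (fun k => (P k).ob)) : S.V n :=
  fun y => coformFin n P ≫ _ ◁ φ ≫ interchange n (fun k => (P k).co) (fun k => (P k).ob) ≫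
    tensorFinMap n (fun k => S.coendMap (P k) (y k))

/-- A factor `x_i^s` composes the open morphism of a state with `f(b, s)`. -/
theorem factor_strandVec (i : Fin n) (s : ℤ) (v : S.VRel n) (b : S.Obj) (P : Fin n → DPair C)
    (F : (b : C) ⊗ tensorFin n (fun k => (P k).ob) ⟶ tensorFin n (fun k => (P k).ob) ⊗ (b : C))
    (hv : v b = S.strandVec b P F) :
    S.factor i s v b = S.strandVec b (setAt ((P i).tensor (DPair.of (intPow (b : C) s))) n i P)
      (openConj (insertRight DPair.ob (intPow (b : C) s)
        ((P i).tensor (DPair.of (intPow (b : C) s))) n i P (Iso.refl _))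
        (openComp F (powMor (b : C) s))) := by
  rw [S.factor_strandState i s v b P _ hv]
  unfold strandVec
  congr 1
  rw [Category.assoc, ← MonoidalCategory.whiskerLeft_comp]
  congr 2
  set Q := DPair.of (intPow (b : C) s)
  have h := interchange_insertRight DPair.co DPair.ob Q.co Q.ob ((P i).tensor Q) n i P
    (Iso.refl ((P i).co ⊗ Q.co)) (Iso.refl ((P i).ob ⊗ Q.ob))
  rw [coformFin_setAt]
  exact (openName_pass _ Q.η F (powMor (b : C) s) _ _ _ _ _ h).symm

/-- A word composes the open morphism of a state with the open morphism of the word. -/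
theorem wordMap_strandVec (b : S.Obj) : ∀ (R : Word n) (v : S.VRel n) (P : Fin n → DPair C)
    (F : (b : C) ⊗ tensorFin n (fun k => (P k).ob) ⟶ tensorFin n (fun k => (P k).ob) ⊗ (b : C))
    (_ : v b = S.strandVec b P F),
    S.wordMap R v b = S.strandVec b (famWord (b : C) R P)
      (openConj (distribWord (b : C) R P) (openComp F (openRel (b : C) R)))
  | [], v, P, F, hv => by
    refine hv.trans (congrArg (S.strandVec b P) ?_)
    exact (openConj_rightUnitor F).symm
  | (i, l) :: R, v, P, F, hv => by
    refine (wordMap_strandVec b R _ _ _ (S.factor_strandVec i l v b P F hv)).trans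
      (congrArg (S.strandVec b _) ?_)
    rw [openComp_openConj, ← openComp_assoc, openConj_trans, openConj_trans]
    rfl

/-- The beginning of a relation places a free strand beside a state. -/
theorem beginRelation_stateVec (b : S.Obj) (P : Fin n → DPair C)
    (φ : tensorFin n (fun k => (P k).ob) ⟶ tensorFin n (fun k => (P k).ob)) :
    S.beginRelation n (S.stateVec P φ) b =
      S.rank (b : C) ^ 2 • S.strandVec b P ((β_ (b : C) _).hom ≫ φ ▷ (b : C)) := by
  funext y
  set X := S.stateVec P φ y with hX
  have e : S.strandVec b P ((β_ (b : C) _).hom ≫ φ ▷ (b : C)) y =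
      X ≫ (λ_ _).inv ≫ coform (b : C) ▷ S.stateObj y ≫ (α_ _ _ _).hom := by
    have h1 := BraidedCategory.braiding_naturality_left X (b : C)
    have h2 : S.strandVec b P ((β_ (b : C) _).hom ≫ φ ▷ (b : C)) y =
        coform (b : C) ≫ dual (b : C) ◁ ((λ_ (b : C)).inv ≫ X ▷ (b : C) ≫ (β_ _ _).hom) := by
      rw [hX]
      unfold strandVec strandState stateVec
      rw [openName_braiding]
      simp only [comp_whiskerRight, MonoidalCategory.whiskerLeft_comp, Category.assoc]
    rw [h2, h1]
    calc _ = 𝟙 _ ⊗≫ (coform (b : C) ▷ 𝟙_ C ≫ (dual (b : C) ⊗ (b : C)) ◁ X) ⊗≫ 𝟙 _ := by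
          simp only [braiding_tensorUnit_left]; monoidal
      _ = _ := by rw [← whisker_exchange]; monoidal
  exact (congrArg (S.rank (b : C) ^ 2 • ·) e).symm

/-- The end of a relation closes the free strand. -/
theorem endRelation_strandVec (w : S.VRel n) (P : S.Obj → Fin n → DPair C)
    (F : ∀ b : S.Obj, (b : C) ⊗ tensorFin n (fun k => (P b k).ob) ⟶
      tensorFin n (fun k => (P b k).ob) ⊗ (b : C))
    (hw : ∀ b, w b = S.strandVec b (P b) (F b)) :
    S.endRelation n w =
      ∑ b : S.Obj, (S.rank (b : C))⁻¹ • S.stateVec (P b) (closure (b : C) _ (F b)) := by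
  funext y
  rw [Finset.sum_apply]
  have e : S.endRelation n w y = ∑ b : S.Obj, (S.rank (b : C))⁻¹ • (w b y ≫
      (α_ (dual (b : C)) (b : C) (S.stateObj y)).inv ≫ formDual (b : C) ▷ S.stateObj y ≫
        (λ_ _).hom) := by
    simp [endRelation, LinearMap.sum_apply]
  rw [e]
  refine Finset.sum_congr rfl fun b _ => congrArg ((S.rank (b : C))⁻¹ • ·) ?_
  have h := openName_closure (coformFin n (P b)) (F b)
  rw [hw b]
  unfold strandVec strandState stateVec
  set Y := interchange n (fun k => (P b k).co) (fun k => (P b k).ob) ≫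
    tensorFinMap n (fun k => S.coendMap (P b k) (y k)) with hY
  have h1 := BraidedCategory.braiding_naturality_left Y (b : C)
  calc _ = coform (b : C) ≫ dual (b : C) ◁ (openName (coformFin n (P b)) (F b) ≫
        (Y ▷ (b : C) ≫ (β_ _ _).hom)) ≫ (α_ _ _ _).inv ≫ formDual (b : C) ▷ _ ≫ (λ_ _).hom := by
        rw [hY]; simp only [Category.assoc, comp_whiskerRight, MonoidalCategory.whiskerLeft_comp]
    _ = (coform (b : C) ≫ dual (b : C) ◁ (openName (coformFin n (P b)) (F b) ≫
        (β_ _ (b : C)).hom) ≫ (α_ _ _ _).inv ≫ formDual (b : C) ▷ _ ≫ (λ_ _).hom) ≫ Y := by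
        rw [h1]
        simp only [MonoidalCategory.whiskerLeft_comp, Category.assoc]
        rw [associator_inv_naturality_right_assoc, whisker_exchange_assoc,
          leftUnitor_naturality]
    _ = _ := by rw [h, hY]; simp

theorem strandState_smul (c : K) (b : S.Obj) (P : Fin n → DPair C)
    (ψ : 𝟙_ C ⟶ dual (b : C) ⊗ (tensorFin n (fun k => (P k).co ⊗ (P k).ob) ⊗ (b : C))) :
    S.strandState b P (c • ψ) = c • S.strandState b P ψ :=
  funext fun _ => Linear.smul_comp _ _ _ _ _ _

theorem strandVec_smul (c : K) (b : S.Obj) (P : Fin n → DPair C)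
    (F : (b : C) ⊗ tensorFin n (fun k => (P k).ob) ⟶ tensorFin n (fun k => (P k).ob) ⊗ (b : C)) :
    S.strandVec b P (c • F) = c • S.strandVec b P F := by
  unfold strandVec openName
  rw [← strandState_smul]
  simp

theorem stateVec_smul (c : K) (P : Fin n → DPair C)
    (φ : tensorFin n (fun k => (P k).ob) ⟶ tensorFin n (fun k => (P k).ob)) :
    S.stateVec P (c • φ) = c • S.stateVec P φ := by
  funext y
  simp [stateVec]

/-- A relation tensors the endomorphism which describes a state with the morphisms `[R, b]`. -/
theorem relationMap_stateVec (R : Word n) (P : Fin n → DPair C)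
    (φ : tensorFin n (fun k => (P k).ob) ⟶ tensorFin n (fun k => (P k).ob)) :
    S.relationMap R (S.stateVec P φ) = ∑ b : S.Obj, S.stateVec (famWord (b : C) R P)
      ((distribWord (b : C) R P).inv ≫ (φ ⊗ₘ S.relMor b R) ≫ (distribWord (b : C) R P).hom) := by
  have h := S.endRelation_strandVec (S.wordMap R (S.beginRelation n (S.stateVec P φ)))
    (fun b => famWord (b : C) R P) (fun b => openConj (distribWord (b : C) R P)
      (openComp ((β_ (b : C) _).hom ≫ (S.rank (b : C) ^ 2 • φ) ▷ (b : C)) (openRel (b : C) R)))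
    (fun b => S.wordMap_strandVec b R _ P _ (by
      rw [S.beginRelation_stateVec, ← strandVec_smul]; simp))
  refine h.trans (Finset.sum_congr rfl fun b _ => ?_)
  have hb := S.rank_ne_zero b
  rw [closure_openConj, closure_openComp_braiding, ← stateVec_smul]
  unfold relMor
  congr 1
  simp only [tensorHom_smul', smul_tensorHom', Linear.smul_comp, Linear.comp_smul, smul_smul]
  congr 1
  field_simp

end Simples

end

/-! ### Grouping factors by generators -/

section

section Comparison

variable {C : Type u} [Category.{v} C] [MonoidalCategory C] [SymmetricCategory C]

theorem insertRight_interchange_zero_step {A T B X W U V : C} (e : A ⊗ B ≅ X) (z : T ⊗ U ⟶ V) :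
    ((swapRight A T B).hom ≫ e.hom ▷ T) ▷ (W ⊗ U) ≫ (tensorμ X T W U ≫ (X ⊗ W) ◁ z) ≫
        ((e.inv ▷ W ≫ (α_ A B W).hom) ⊗ₘ 𝟙 V) =
      (α_ (A ⊗ T) B (W ⊗ U)).hom ≫ (A ⊗ T) ◁ (B ◁ 𝟙 (W ⊗ U) ≫ (α_ B W U).inv ≫
        𝟙 ((B ⊗ W) ⊗ U)) ≫ tensorμ A T (B ⊗ W) U ≫ (A ⊗ (B ⊗ W)) ◁ z := by
  have h := tensorμ_natural_left e.hom (𝟙 T) W U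
  simp only [tensorHom_id, id_whiskerRight] at h
  have h2 : (swapRight A T B).hom ▷ (W ⊗ U) ≫ tensorμ (A ⊗ B) T W U ≫ (α_ A B W).hom ▷ (T ⊗ U) =
      (α_ (A ⊗ T) B (W ⊗ U)).hom ≫ (A ⊗ T) ◁ (α_ B W U).inv ≫ tensorμ A T (B ⊗ W) U := by
    unfold tensorμ swapRight
    rw [BraidedCategory.braiding_tensor_right_hom]
    simp only [Iso.trans_hom, Iso.symm_hom, whiskerLeftIso_hom]
    monoidal
  rw [comp_whiskerRight, Category.assoc, Category.assoc, reassoc_of% h, tensorHom_id,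
    whisker_exchange, ← comp_whiskerRight_assoc, hom_inv_whiskerRight_assoc]
  simp only [MonoidalCategory.whiskerLeft_id, Category.id_comp, Category.comp_id]
  rw [← reassoc_of% h2]

theorem insertRight_interchange_succ_step {A T B T' W U U' V V' : C} (i : T ⊗ B ⟶ T')
    (z' : T' ⊗ U ⟶ V') (t : V' ⟶ V) (ins : B ⊗ U ⟶ U') (z : T ⊗ U' ⟶ V)
    (h : i ▷ U ≫ z' ≫ t = (α_ T B U).hom ≫ T ◁ ins ≫ z) :
    ((α_ A T B).hom ≫ A ◁ i) ▷ (W ⊗ U) ≫ (tensorμ A T' W U ≫ (A ⊗ W) ◁ z') ≫ (𝟙 (A ⊗ W) ⊗ₘ t) =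
      (α_ (A ⊗ T) B (W ⊗ U)).hom ≫ (A ⊗ T) ◁ ((swapIso B W U).hom ≫ W ◁ ins) ≫
        tensorμ A T W U' ≫ (A ⊗ W) ◁ z := by
  have h1 := tensorμ_natural_left (𝟙 A) i W U
  have h2 := tensorμ_natural_right A T (𝟙 W) ins
  simp only [id_tensorHom, id_whiskerRight, MonoidalCategory.whiskerLeft_id] at h1 h2
  have h3 : (α_ A T B).hom ▷ (W ⊗ U) ≫ tensorμ A (T ⊗ B) W U ≫ (A ⊗ W) ◁ (α_ T B U).hom =
      (α_ (A ⊗ T) B (W ⊗ U)).hom ≫ (A ⊗ T) ◁ (swapIso B W U).hom ≫ tensorμ A T W (B ⊗ U) := by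
    unfold tensorμ swapIso
    rw [BraidedCategory.braiding_tensor_left_hom]
    simp only [Iso.trans_hom, Iso.symm_hom, whiskerRightIso_hom]
    monoidal
  rw [comp_whiskerRight, Category.assoc, Category.assoc, reassoc_of% h1, id_tensorHom,
    ← MonoidalCategory.whiskerLeft_comp, ← MonoidalCategory.whiskerLeft_comp, h,
    MonoidalCategory.whiskerLeft_comp, reassoc_of% h3, MonoidalCategory.whiskerLeft_comp,
    MonoidalCategory.whiskerLeft_comp]
  simp only [Category.assoc]
  rw [reassoc_of% h2]

theorem insertIso_succ_step {B W U X R X' U' : C} (p : U ≅ X ⊗ R) (q : U' ≅ X' ⊗ R)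
    (f : B ⊗ X ≅ X') :
    B ◁ (W ◁ p.hom ≫ (swapIso W X R).hom) ≫ (α_ B X (W ⊗ R)).inv ≫ f.hom ▷ (W ⊗ R) ≫
        (swapIso W X' R).inv ≫ W ◁ q.inv =
      (swapIso B W U).hom ≫ W ◁ (B ◁ p.hom ≫ (α_ B X R).inv ≫ f.hom ▷ R ≫ q.inv) := by
  have h1 := swapIso_natural (𝟙 B) (𝟙 W) p.hom
  have h2 := swapIso_natural (𝟙 W) f.hom (𝟙 R)
  simp only [id_tensorHom, tensorHom_id, id_whiskerRight] at h1 h2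
  rw [MonoidalCategory.whiskerLeft_comp, Category.assoc]
  have h3 : f.hom ▷ (W ⊗ R) ≫ (swapIso W X' R).inv = (swapIso W (B ⊗ X) R).inv ≫ W ◁ f.hom ▷ R := by
    rw [Iso.comp_inv_eq, Category.assoc, h2, Iso.inv_hom_id_assoc]
  rw [reassoc_of% h3, MonoidalCategory.whiskerLeft_comp, ← reassoc_of% h1,
    MonoidalCategory.whiskerLeft_comp, MonoidalCategory.whiskerLeft_comp]
  congr 1
  simp only [← Category.assoc]
  congr 2
  have h4 : (β_ W X).hom ≫ (β_ X W).hom = 𝟙 _ := SymmetricCategory.symmetry _ _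
  rw [← cancel_mono (swapIso W (B ⊗ X) R).hom]
  simp only [Category.assoc, Iso.inv_hom_id, Category.comp_id]
  simp only [swapIso, Iso.trans_hom, Iso.symm_hom, whiskerRightIso_hom]
  rw [BraidedCategory.braiding_tensor_right_hom]
  have h5 : (β_ B W).hom ≫ (β_ W B).hom = 𝟙 _ := SymmetricCategory.symmetry _ _
  symm
  calc _ = 𝟙 _ ⊗≫ ((β_ B W).hom ≫ (β_ W B).hom) ▷ (X ⊗ R) ⊗≫ B ◁ (β_ W X).hom ▷ R ⊗≫ 𝟙 _ := by
        monoidal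
    _ = _ := by rw [h5]; monoidal

/-- Recursion for the permutation `insertIso`: move `B` past the first factor. -/
theorem insertIso_succ (B : C) (n i : ℕ) (h : i + 1 < n + 1) (W : Fin (n + 1) → C) :
    (insertIso B (n + 1) ⟨i + 1, h⟩ W).hom = (swapIso B (W 0) _).hom ≫
      W 0 ◁ (insertIso B n ⟨i, Nat.lt_of_succ_lt_succ h⟩ (fun k => W k.succ)).hom := by
  have e := insertIso_succ_step (W := W 0) (pullIso n ⟨i, Nat.lt_of_succ_lt_succ h⟩ (fun k => W k.succ))
    (pullSetIso (fun Y : C => Y) (B ⊗ W ⟨i + 1, h⟩) n ⟨i, Nat.lt_of_succ_lt_succ h⟩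
      (fun k => W k.succ)) (Iso.refl _)
  simp only [Iso.refl_hom, id_whiskerRight, Category.id_comp] at e
  exact e

/-- Multiplying the `i`-th factor on the right by `B` before interchanging with a second family is,
up to isomorphisms of the factors, the same as multiplying the `i`-th factor of the second family
on the left by `B`. -/
theorem exists_insertRight_interchange {α : Type*} (F : α → C) (B : C) (x : α) :
    ∀ (n : ℕ) (i : Fin n) (y : Fin n → α) (W : Fin n → C) (e : F (y i) ⊗ B ≅ F x),
    ∃ t : ∀ k, F (setAt x n i y k) ⊗ W k ≅ F (y k) ⊗ mulAt B n i W k,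
      (insertRight F B x n i y e).hom ▷ tensorFin n W ≫
          interchange n (fun k => F (setAt x n i y k)) W ≫ tensorFinMap n (fun k => (t k).hom) =
        (α_ _ _ _).hom ≫ tensorFin n (fun k => F (y k)) ◁ (insertIso B n i W).hom ≫
          interchange n (fun k => F (y k)) (mulAt B n i W)
  | n + 1, ⟨0, h0⟩, y, W, e => by
    refine ⟨Fin.cases (whiskerRightIso e.symm (W 0) ≪≫ α_ _ _ _) (fun k => Iso.refl _), ?_⟩
    have hs := insertRight_interchange_zero_step (W := W 0) e
      (interchange n (fun k => F (y k.succ)) (fun k => W k.succ))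
    have ht := tensorFinMap_id n (fun k => F (y k.succ) ⊗ W k.succ)
    rw [← ht] at hs
    exact hs
  | n + 1, ⟨i + 1, h⟩, y, W, e => by
    obtain ⟨t, ht⟩ := exists_insertRight_interchange F B x n ⟨i, Nat.lt_of_succ_lt_succ h⟩
      (fun k => y k.succ) (fun k => W k.succ) e
    refine ⟨Fin.cases (Iso.refl _) t, ?_⟩
    rw [insertIso_succ]
    exact insertRight_interchange_succ_step _ _ _ _ _ ht

theorem tensorFinMap_rightUnitor_inv_step {X T U V : C} (d : 𝟙_ C ⟶ U) (z : T ⊗ U ⟶ V)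
    (t : T ⟶ V) (h : (ρ_ T).hom ≫ t = T ◁ d ≫ z) :
    (ρ_ (X ⊗ T)).hom ≫ ((ρ_ X).inv ⊗ₘ t) = (X ⊗ T) ◁ ((λ_ (𝟙_ C)).inv ≫ 𝟙_ C ◁ d) ≫
      tensorμ X T (𝟙_ C) U ≫ (X ⊗ 𝟙_ C) ◁ z := by
  have h2 := tensorμ_natural_right X T (𝟙 (𝟙_ C)) d
  simp only [id_tensorHom, MonoidalCategory.whiskerLeft_id] at h2
  have h3 : t = (ρ_ T).inv ≫ T ◁ d ≫ z := by rw [← h, Iso.inv_hom_id_assoc]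
  rw [MonoidalCategory.whiskerLeft_comp, Category.assoc, reassoc_of% h2, h3,
    MonoidalCategory.tensorHom_def, MonoidalCategory.whiskerLeft_comp,
    MonoidalCategory.whiskerLeft_comp]
  unfold tensorμ
  simp only [braiding_tensorUnit_right]
  monoidal

/-- Interchange with a family of units on the right. -/
theorem tensorFinMap_rightUnitor_inv : ∀ (n : ℕ) (X : Fin n → C),
    (ρ_ (tensorFin n X)).hom ≫ tensorFinMap n (fun k => (ρ_ (X k)).inv) =
      tensorFin n X ◁ (unitIso n).hom ≫ interchange n X (fun _ => 𝟙_ C)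
  | 0, _ => by
    change (ρ_ (𝟙_ C)).hom ≫ 𝟙 _ = 𝟙_ C ◁ 𝟙 _ ≫ (λ_ (𝟙_ C)).hom
    simp [unitors_equal]
  | n + 1, X => tensorFinMap_rightUnitor_inv_step _ _ _ (tensorFinMap_rightUnitor_inv n _)

theorem interchange_leftUnitor_step {X T U V : C} (d : 𝟙_ C ≅ U) (z : U ⊗ T ⟶ V)
    (t : V ⟶ T) (h : z ≫ t = d.inv ▷ T ≫ (λ_ T).hom) :
    (tensorμ (𝟙_ C) U X T ≫ (𝟙_ C ⊗ X) ◁ z) ≫ ((λ_ X).hom ⊗ₘ t) =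
      (𝟙_ C ◁ d.inv ≫ (λ_ (𝟙_ C)).hom) ▷ (X ⊗ T) ≫ (λ_ (X ⊗ T)).hom := by
  have h2 := tensorμ_natural_left (𝟙 (𝟙_ C)) d.inv X T
  simp only [id_tensorHom, id_whiskerRight] at h2
  rw [MonoidalCategory.tensorHom_def', Category.assoc, ← MonoidalCategory.whiskerLeft_comp_assoc, h,
    MonoidalCategory.whiskerLeft_comp, Category.assoc, ← reassoc_of% h2, comp_whiskerRight,
    Category.assoc]
  unfold tensorμ
  simp only [braiding_tensorUnit_left]
  monoidal

/-- Interchange with a family of units. -/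
theorem interchange_leftUnitor : ∀ (n : ℕ) (X : Fin n → C),
    interchange n (fun _ => 𝟙_ C) X ≫ tensorFinMap n (fun k => (λ_ (X k)).hom) =
      (unitIso n).inv ▷ tensorFin n X ≫ (λ_ (tensorFin n X)).hom
  | 0, _ => by
    change (λ_ (𝟙_ C)).hom ≫ 𝟙 _ = 𝟙 _ ▷ 𝟙_ C ≫ (λ_ (𝟙_ C)).hom
    simp
  | n + 1, X => by
    refine (interchange_leftUnitor_step (unitIso n) _ _ (interchange_leftUnitor n _)).trans ?_
    rfl

variable [LeftRigidCategory C] [Stable C]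

/-- The permutations of the algorithm and of the invariant agree on a word, up to isomorphisms of the
single factors. -/
theorem exists_distribWord_interchange {n : ℕ} (b : C) (G : Fin n → C) :
    ∀ (R : Word n) (P : Fin n → DPair C),
    ∃ t : ∀ k, (famWord b R P k).ob ⊗ G k ≅ (P k).ob ⊗ wordGens b G R k,
      (distribWord b R P).hom ▷ tensorFin n G ≫
          interchange n (fun k => (famWord b R P k).ob) G ≫ tensorFinMap n (fun k => (t k).hom) =
        (α_ _ _ _).hom ≫ tensorFin n (fun k => (P k).ob) ◁ (wordPerm b G R).hom ≫
          interchange n (fun k => (P k).ob) (wordGens b G R)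
  | [], P => by
    refine ⟨fun k => Iso.refl _, ?_⟩
    have step : ∀ {T V W : C} (z : T ⊗ V ⟶ W) (m : W ⟶ W) (_ : m = 𝟙 W),
        (ρ_ T).hom ▷ V ≫ z ≫ m = (α_ T (𝟙_ C) V).hom ≫ T ◁ (λ_ V).hom ≫ z := by
      intro T V W z m h
      simp [h]
    exact step _ _ (tensorFinMap_id n (fun k => (P k).ob ⊗ G k))
  | (i, l) :: R, P => by
    set B := intPow b l
    set P' := setAt ((P i).tensor (DPair.of B)) n i P with hP'
    obtain ⟨t, ht⟩ := exists_distribWord_interchange b G R P'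
    obtain ⟨t', ht'⟩ := exists_insertRight_interchange DPair.ob B ((P i).tensor (DPair.of B)) n i P
      (wordGens b G R) (Iso.refl _)
    refine ⟨fun k => t k ≪≫ t' k, ?_⟩
    have hc := tensorFinMap_comp n (fun k => (t k).hom) (fun k => (t' k).hom)
    have step : ∀ {T B D T' U V W W' X Y : C} (r : T ⊗ B ⟶ T') (d : T' ⊗ D ⟶ U) (z : U ⊗ V ⟶ W)
        (m : W ⟶ W') (m' : W' ⟶ X) (p : D ⊗ V ⟶ Y) (z' : T' ⊗ Y ⟶ W') {Y' : C} (q : B ⊗ Y ⟶ Y')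
        (z'' : T ⊗ Y' ⟶ X) (_ : d ▷ V ≫ z ≫ m = (α_ _ _ _).hom ≫ T' ◁ p ≫ z')
        (_ : r ▷ Y ≫ z' ≫ m' = (α_ _ _ _).hom ≫ T ◁ q ≫ z''),
        ((α_ T B D).inv ≫ r ▷ D ≫ d) ▷ V ≫ z ≫ (m ≫ m') = (α_ T (B ⊗ D) V).hom ≫
          T ◁ ((α_ B D V).hom ≫ B ◁ p ≫ q) ≫ z'' := by
      intro T B D T' U V W W' X Y r d z m m' p z' Y' q z'' h1 h2
      simp only [comp_whiskerRight, Category.assoc]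
      rw [reassoc_of% h1, associator_naturality_left_assoc, ← whisker_exchange_assoc, h2]
      simp
    refine Eq.trans ?_ (step _ _ _ _ _ _ _ _ _ ht ht')
    exact congrArg (fun s => (distribWord b ((i, l) :: R) P).hom ▷ tensorFin n G ≫
          interchange n (fun k => (famWord b R P' k).ob) G ≫ s) hc.symm

end Comparison

end

/-! ### Lists of relations -/

section

variable {K : Type w} [Field K] {C : Type u} [Category.{v} C] [Abelian C] [Linear K C]
  [MonoidalCategory C] [MonoidalPreadditive C] [MonoidalLinear K C]
  [LeftRigidCategory C] [SymmetricCategory C] [Stable C]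

namespace Simples

variable (S : Simples K C) {n : ℕ}

/-- The family of duality pairs obtained from `P` after the words of a list of relations. -/
def famRels : List (Word n × S.Obj) → (Fin n → DPair C) → (Fin n → DPair C)
  | [], P => P
  | (R, b) :: L, P => famRels L (famWord (b : C) R P)

/-- The permutation of factors distributing the factors of `Rel(b₁, b₂, …)` over the members of a
family. -/
def distribRels : (L : List (Word n × S.Obj)) → (P : Fin n → DPair C) →
    (tensorFin n (fun k => (P k).ob) ⊗ S.relsObj L ≅ tensorFin n (fun k => (S.famRels L P k).ob))
  | [], _ => ρ_ _
  | (R, b) :: L, P => (α_ _ _ _).symm ≪≫ whiskerRightIso (distribWord (b : C) R P) _ ≪≫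
      distribRels L (famWord (b : C) R P)

/-- The permutation built up by the algorithm and the permutation `ξ(P)` agree up to isomorphisms of
the single factors. -/
theorem exists_distribRels : ∀ (L : List (Word n × S.Obj)) (P : Fin n → DPair C),
    ∃ t : ∀ k, (S.famRels L P k).ob ≅ (P k).ob ⊗ S.relsGens L k,
      (S.distribRels L P).hom ≫ tensorFinMap n (fun k => (t k).hom) =
        tensorFin n (fun k => (P k).ob) ◁ (S.relsPerm L).hom ≫
          interchange n (fun k => (P k).ob) (S.relsGens L)
  | [], P => ⟨fun k => (ρ_ _).symm, tensorFinMap_rightUnitor_inv n _⟩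
  | (R, b) :: L, P => by
    obtain ⟨t, ht⟩ := exists_distribRels L (famWord (b : C) R P)
    obtain ⟨t', ht'⟩ := exists_distribWord_interchange (b : C) (S.relsGens L) R P
    refine ⟨fun k => t k ≪≫ t' k, ?_⟩
    have hc := tensorFinMap_comp n (fun k => (t k).hom) (fun k => (t' k).hom)
    have step : ∀ {T R D T' U V W X Y : C} (r : T ⊗ R ⟶ T') (d : T' ⊗ D ⟶ U)
        (m : U ⟶ V) (m' : V ⟶ W) (p : D ⟶ X) (z : T' ⊗ X ⟶ V)
        (q : R ⊗ X ⟶ Y) (z' : T ⊗ Y ⟶ W) (_ : d ≫ m = T' ◁ p ≫ z)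
        (_ : r ▷ X ≫ z ≫ m' = (α_ _ _ _).hom ≫ T ◁ q ≫ z'),
        ((α_ T R D).inv ≫ r ▷ D ≫ d) ≫ (m ≫ m') = T ◁ (R ◁ p ≫ q) ≫ z' := by
      intro T R D T' U V W X Y r d m m' p z q z' h1 h2
      simp only [Category.assoc]
      rw [reassoc_of% h1, ← whisker_exchange_assoc, h2]
      simp
    refine Eq.trans ?_ (step _ _ _ _ _ _ _ _ ht ht')
    exact congrArg (fun s => (S.distribRels ((R, b) :: L) P).hom ≫ s) hc.symm

/-- The state after a list of relations, coloured by simple objects. -/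
def relsVec (L : List (Word n × S.Obj)) (P : Fin n → DPair C)
    (φ : tensorFin n (fun k => (P k).ob) ⟶ tensorFin n (fun k => (P k).ob)) : S.V n :=
  S.stateVec (S.famRels L P)
    ((S.distribRels L P).inv ≫ (φ ⊗ₘ S.relsMor L) ≫ (S.distribRels L P).hom)

theorem relsVec_nil (P : Fin n → DPair C)
    (φ : tensorFin n (fun k => (P k).ob) ⟶ tensorFin n (fun k => (P k).ob)) :
    S.relsVec [] P φ = S.stateVec P φ := by
  have h : ∀ {T : C} (f : T ⟶ T), (ρ_ T).inv ≫ (f ⊗ₘ 𝟙 (𝟙_ C)) ≫ (ρ_ T).hom = f := by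
    intro T f; simp
  exact congrArg (S.stateVec P) (h φ)

theorem relsVec_cons (R : Word n) (b : S.Obj) (L : List (Word n × S.Obj)) (P : Fin n → DPair C)
    (φ : tensorFin n (fun k => (P k).ob) ⟶ tensorFin n (fun k => (P k).ob)) :
    S.relsVec ((R, b) :: L) P φ = S.relsVec L (famWord (b : C) R P)
      ((distribWord (b : C) R P).inv ≫ (φ ⊗ₘ S.relMor b R) ≫ (distribWord (b : C) R P).hom) := by
  have h : ∀ {T R D T' U : C} (r : T ⊗ R ≅ T') (d : T' ⊗ D ≅ U) (f : T ⟶ T) (g : R ⟶ R)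
      (k : D ⟶ D), ((α_ T R D).symm ≪≫ whiskerRightIso r D ≪≫ d).inv ≫ (f ⊗ₘ (g ⊗ₘ k)) ≫
        ((α_ T R D).symm ≪≫ whiskerRightIso r D ≪≫ d).hom =
      d.inv ≫ ((r.inv ≫ (f ⊗ₘ g) ≫ r.hom) ⊗ₘ k) ≫ d.hom := by
    intro T R D T' U r d f g k
    simp only [Iso.trans_inv, Iso.trans_hom, Iso.symm_inv, Iso.symm_hom, whiskerRightIso_inv,
      whiskerRightIso_hom, Category.assoc, ← tensorHom_id]
    rw [← associator_naturality_assoc, Iso.hom_inv_id_assoc, tensorHom_comp_tensorHom_assoc,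
      tensorHom_comp_tensorHom_assoc]
    simp
  exact congrArg (S.stateVec _) (h _ _ _ _ _)

/-- The relations turn the state of `φ` into the sum over all colourings of the states of
`φ ⋄ [R₁, b₁] ⋄ [R₂, b₂] ⋄ ⋯`. -/
theorem relationsMap_stateVec : ∀ (m : ℕ) (rel : Fin m → Word n) (P : Fin n → DPair C)
    (φ : tensorFin n (fun k => (P k).ob) ⟶ tensorFin n (fun k => (P k).ob)),
    S.relationsMap (List.ofFn rel) (S.stateVec P φ) =
      ∑ b : Fin m → S.Obj, S.relsVec (List.ofFn fun j => (rel j, b j)) P φ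
  | 0, rel, P, φ => by
    rw [Fintype.sum_unique, List.ofFn_zero, List.ofFn_zero, relsVec_nil]
    rfl
  | m + 1, rel, P, φ => by
    have h : S.relationsMap (List.ofFn rel) (S.stateVec P φ) =
        S.relationsMap (List.ofFn fun j => rel j.succ) (S.relationMap (rel 0) (S.stateVec P φ)) := by
      rw [List.ofFn_succ]; rfl
    rw [h, S.relationMap_stateVec, map_sum,
      ← (Fin.consEquiv fun _ : Fin (m + 1) => S.Obj).sum_comp, Fintype.sum_prod_type]
    refine Finset.sum_congr rfl fun b₀ _ => ?_
    rw [relationsMap_stateVec m]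
    refine Finset.sum_congr rfl fun b _ => ?_
    rw [← relsVec_cons]
    congr 1
    rw [List.ofFn_succ]
    rfl

end Simples

end

/-! ### Partial traces -/

section

section
variable {C : Type u} [Category.{v} C] [MonoidalCategory C] [SymmetricCategory C]

/-- Removal of a trivial first factor from a closed-up endomorphism. -/
theorem coformTensor_unit {A' A : C} (η : 𝟙_ C ⟶ A' ⊗ A) (φ : 𝟙_ C ⊗ A ⟶ 𝟙_ C ⊗ A)
    (z : A' ⊗ A ⟶ 𝟙_ C) :
    coformTensor (λ_ (𝟙_ C)).inv η ≫ (𝟙_ C ⊗ A') ◁ φ ≫ tensorμ (𝟙_ C) A' (𝟙_ C) A ≫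
        ((λ_ (𝟙_ C)).hom ⊗ₘ z) ≫ (λ_ (𝟙_ C)).hom =
      η ≫ A' ◁ ((λ_ A).inv ≫ φ ≫ (λ_ A).hom) ≫ z := by
  unfold coformTensor tensorμ
  simp only [braiding_tensorUnit_right, braiding_tensorUnit_left, MonoidalCategory.tensorHom_def']
  monoidal

/-- Evaluating the first factor of a closed-up endomorphism by `f ⋄ g` yields a summand of a partial
trace, if `ε` is the transpose of `f`. -/
theorem trace_step {C₀ O₀ C₁ O₁ V : C} (η₀ : 𝟙_ C ⟶ C₀ ⊗ O₀) (η₁ : 𝟙_ C ⟶ C₁ ⊗ O₁)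
    (φ : O₀ ⊗ O₁ ⟶ O₀ ⊗ O₁) (z : C₁ ⊗ O₁ ⟶ V) (t : V ⟶ 𝟙_ C) (f : C₀ ⟶ 𝟙_ C) (g : O₀ ⟶ 𝟙_ C)
    (ε : 𝟙_ C ⟶ O₀) (h : η₀ ≫ f ▷ O₀ = (λ_ (𝟙_ C)).inv ≫ 𝟙_ C ◁ ε) :
    coformTensor η₀ η₁ ≫ (C₀ ⊗ C₁) ◁ φ ≫ (tensorμ C₀ C₁ O₀ O₁ ≫ (C₀ ⊗ O₀) ◁ z) ≫
        (((f ⊗ₘ g) ≫ (λ_ (𝟙_ C)).hom) ⊗ₘ t) ≫ (λ_ (𝟙_ C)).hom =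
      η₁ ≫ C₁ ◁ ((λ_ O₁).inv ≫ (ε ▷ O₁ ≫ φ ≫ g ▷ O₁) ≫ (λ_ O₁).hom) ≫ z ≫ t := by
  have h1 := coformTensor_comp η₀ η₁ f (𝟙 O₀) (𝟙 C₁) (𝟙 O₁)
  have h2 := coformTensor_comp (λ_ (𝟙_ C)).inv η₁ (𝟙 (𝟙_ C)) ε (𝟙 C₁) (𝟙 O₁)
  simp only [tensorHom_id, id_tensorHom, id_whiskerRight, Category.comp_id] at h1 h2
  rw [h, h2] at h1
  have h3 := tensorμ_natural f (𝟙 C₁) g (𝟙 O₁)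
  simp only [tensorHom_id, id_whiskerRight] at h3
  rw [← coformTensor_unit η₁ _ (z ≫ t)]
  have e1 : (C₀ ⊗ O₀) ◁ z ≫ (((f ⊗ₘ g) ≫ (λ_ (𝟙_ C)).hom) ⊗ₘ t) =
      ((f ⊗ₘ g) ▷ (C₁ ⊗ O₁)) ≫ ((λ_ (𝟙_ C)).hom ⊗ₘ (z ≫ t)) := by
    rw [← id_tensorHom, ← tensorHom_id, tensorHom_comp_tensorHom, tensorHom_comp_tensorHom]
    simp
  rw [Category.assoc, reassoc_of% e1, ← reassoc_of% h3, MonoidalCategory.tensorHom_def (f ▷ C₁),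
    Category.assoc, whisker_exchange_assoc, ← reassoc_of% h1]
  simp only [MonoidalCategory.whiskerLeft_comp, Category.assoc]

end

variable {K : Type w} [Field K] {C : Type u} [Category.{v} C] [Abelian C] [Linear K C]
  [MonoidalCategory C] [MonoidalPreadditive C] [MonoidalLinear K C]
  [LeftRigidCategory C] 

namespace Simples

variable (S : Simples K C) {n : ℕ}

/-- The partial trace does not depend on the basis, hence is invariant under isomorphisms of the
factor that is traced. -/
theorem partialTrace_conj (a : S.Obj) {A A' Y Y' : C} (w : A ≅ A') (t : Y ≅ Y')
    (φ : A ⊗ Y ⟶ A ⊗ Y) :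
    S.partialTrace a A' Y' ((w.inv ⊗ₘ t.inv) ≫ φ ≫ (w.hom ⊗ₘ t.hom)) =
      (a : C) ◁ t.inv ≫ S.partialTrace a A Y φ ≫ (a : C) ◁ t.hom := by
  choose r hr using fun i j => S.exists_smul_id a
    ((S.basis a A').ε i ≫ w.inv ≫ (S.basis a A).ε' j)
  have h1 : ∀ i, (S.basis a A').ε i ≫ w.inv = ∑ j, r i j • (S.basis a A).ε j := by
    intro i
    rw [← S.sum_comp_basis a ((S.basis a A').ε i ≫ w.inv)]
    refine Finset.sum_congr rfl fun j _ => ?_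
    rw [Category.assoc ((S.basis a A').ε i), hr, Linear.smul_comp, Category.id_comp]
  have h2 : ∀ j, ∑ i, r i j • (w.hom ≫ (S.basis a A').ε' i) = (S.basis a A).ε' j := by
    intro j
    have h := S.sum_basis_comp a (w.inv ≫ (S.basis a A).ε' j)
    rw [← cancel_epi w.inv, ← h, Preadditive.comp_sum]
    refine Finset.sum_congr rfl fun i _ => ?_
    rw [hr, Linear.comp_smul, Linear.comp_smul, Iso.inv_hom_id_assoc, Category.comp_id]
  have h3 : ∀ i, (S.basis a A').ε i ▷ Y' ≫ ((w.inv ⊗ₘ t.inv) ≫ φ ≫ (w.hom ⊗ₘ t.hom)) ≫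
      (S.basis a A').ε' i ▷ Y' = ∑ j, (a : C) ◁ t.inv ≫ ((S.basis a A).ε j ▷ Y ≫ φ ≫
        (r i j • (w.hom ≫ (S.basis a A').ε' i)) ▷ Y) ≫ (a : C) ◁ t.hom := by
    intro i
    have e : (S.basis a A').ε i ▷ Y' ≫ ((w.inv ⊗ₘ t.inv) ≫ φ ≫ (w.hom ⊗ₘ t.hom)) ≫
      (S.basis a A').ε' i ▷ Y' = (a : C) ◁ t.inv ≫ (((S.basis a A').ε i ≫ w.inv) ▷ Y ≫ φ ≫
        (w.hom ≫ (S.basis a A').ε' i) ▷ Y) ≫ (a : C) ◁ t.hom := by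
      rw [MonoidalCategory.tensorHom_def', MonoidalCategory.tensorHom_def]
      simp only [comp_whiskerRight, Category.assoc]
      rw [whisker_exchange, ← whisker_exchange_assoc]
    rw [e, h1]
    simp [sum_whiskerRight, Preadditive.sum_comp, Preadditive.comp_sum]
  unfold partialTrace
  rw [Finset.sum_congr rfl fun i _ => h3 i, Finset.sum_comm, Preadditive.sum_comp,
    Preadditive.comp_sum]
  refine Finset.sum_congr rfl fun j _ => ?_
  rw [← h2 j, sum_whiskerRight, Preadditive.comp_sum, Preadditive.comp_sum, Preadditive.sum_comp,
    Preadditive.comp_sum]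

/-- The iterated trace is invariant under isomorphisms of the factors. -/
theorem traceUnit_conj : ∀ (n : ℕ) {X X' : Fin n → C} (w : ∀ k, X k ≅ X' k)
    (φ : tensorFin n X ⟶ tensorFin n X),
    S.traceUnit n X' (tensorFinMap n (fun k => (w k).inv) ≫ φ ≫ tensorFinMap n (fun k => (w k).hom)) =
      S.traceUnit n X φ
  | 0, _, _, _, φ => (Category.id_comp _).trans (Category.comp_id φ)
  | n + 1, X, X', w, φ => by
    have hi : tensorFinMap n (fun k => (w k.succ).inv) ≫ tensorFinMap n (fun k => (w k.succ).hom) =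
        𝟙 _ := by
      rw [tensorFinMap_comp, ← tensorFinMap_id]; simp
    have hi' : tensorFinMap n (fun k => (w k.succ).hom) ≫ tensorFinMap n (fun k => (w k.succ).inv) =
        𝟙 _ := by
      rw [tensorFinMap_comp, ← tensorFinMap_id]; simp
    have h := S.partialTrace_conj S.unit (w 0) ⟨_, _, hi', hi⟩ φ
    have h' : ∀ {T T' : C} (p : (𝟙_ C) ⊗ T ⟶ 𝟙_ C ⊗ T) (i : T' ⟶ T) (j : T ⟶ T'),
        (λ_ T').inv ≫ (𝟙_ C ◁ i ≫ p ≫ 𝟙_ C ◁ j) ≫ (λ_ T').hom =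
          i ≫ ((λ_ T).inv ≫ p ≫ (λ_ T).hom) ≫ j := by
      intro T T' p i j
      simp
    refine Eq.trans ?_ (traceUnit_conj n (fun k => w k.succ) _)
    refine congrArg (S.traceUnit n _) ?_
    refine Eq.trans ?_ (h' _ _ _)
    exact congrArg (fun s => (λ_ _).inv ≫ s ≫ (λ_ _).hom) h

theorem partialTrace_eqToHom {a a' : S.Obj} (h : a = a') (A Y : C) (φ : A ⊗ Y ⟶ A ⊗ Y) :
    ∑ i, (eqToHom (congrArg Subtype.val h.symm) ≫ (S.basis a A).ε i) ▷ Y ≫ φ ≫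
        ((S.basis a A).ε' i ≫ eqToHom (congrArg Subtype.val h)) ▷ Y =
      S.partialTrace a' A Y φ := by
  subst h
  simp [partialTrace]

theorem partialTrace_id (a : S.Obj) (Y : C) :
    S.partialTrace a (a : C) Y (𝟙 ((a : C) ⊗ Y)) = 𝟙 ((a : C) ⊗ Y) := by
  choose r hr using fun i => S.exists_smul_id a ((S.basis a (a : C)).ε i)
  have h1 := S.sum_basis_comp a (𝟙 (a : C))
  have h2 : ∑ i, (S.basis a (a : C)).ε i ≫ (S.basis a (a : C)).ε' i = 𝟙 (a : C) := by
    refine Eq.trans (Finset.sum_congr rfl fun i _ => ?_) h1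
    rw [hr, Linear.smul_comp, Category.id_comp, Category.comp_id, Linear.comp_smul,
      Category.comp_id]
  unfold partialTrace
  simp only [Category.id_comp, ← comp_whiskerRight]
  rw [← sum_whiskerRight, h2, id_whiskerRight]

/-- The iterated trace of the identity of `1 ⋄ 1 ⋄ ⋯` is `1`. -/
theorem traceUnit_id : ∀ n : ℕ,
    S.traceUnit n (fun _ => 𝟙_ C) (𝟙 _) = 𝟙 (𝟙_ C)
  | 0 => rfl
  | n + 1 => by
    have h : ∀ {T : C} (p : (𝟙_ C) ⊗ T ⟶ 𝟙_ C ⊗ T) (_ : p = 𝟙 _),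
        (λ_ T).inv ≫ p ≫ (λ_ T).hom = 𝟙 T := by
      intro T p hp
      simp [hp]
    exact (congrArg (S.traceUnit n (fun _ => 𝟙_ C))
      (h _ (S.partialTrace_id S.unit (tensorFin n fun _ => 𝟙_ C)))).trans (traceUnit_id n)

end Simples

end

/-! ### The trivial summand -/

section

variable {K : Type w} [Field K] {C : Type u} [Category.{v} C] [Abelian C] [Linear K C]
  [MonoidalCategory C] [MonoidalPreadditive C] [MonoidalLinear K C]
  [LeftRigidCategory C] [SymmetricCategory C] [Stable C]

namespace Simples

variable (S : Simples K C) {n : ℕ}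

theorem exists_smul_id_unit (S : Simples K C) (f : 𝟙_ C ⟶ 𝟙_ C) : ∃ r : K, f = r • 𝟙 (𝟙_ C) :=
  S.exists_smul_id S.unit f

/-- If `x` and `x*` are isomorphic to `1`, the coform of `(x, x*)` is a nonzero multiple of the
canonical morphism `1 ⟶ 1 1`. -/
theorem exists_coform_unit (x : S.Obj) (p : (x : C) ≅ 𝟙_ C) (q : dual (x : C) ≅ 𝟙_ C) :
    ∃ c : K, c ≠ 0 ∧
      (S.pair x).η ≫ p.hom ▷ dual (x : C) = c • ((λ_ (𝟙_ C)).inv ≫ 𝟙_ C ◁ q.inv) := by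
  have e : (S.pair x).η = coform (x : C) ≫ (β_ (x : C) (dual (x : C))).inv := rfl
  rw [e]
  obtain ⟨c, hc⟩ := S.exists_smul_id_unit ((coform (x : C) ≫ (β_ (x : C) (dual (x : C))).inv) ≫
    p.hom ▷ dual (x : C) ≫ 𝟙_ C ◁ q.hom ≫ (λ_ (𝟙_ C)).hom)
  have h : (coform (x : C) ≫ (β_ (x : C) (dual (x : C))).inv) ≫ p.hom ▷ dual (x : C) =
      c • ((λ_ (𝟙_ C)).inv ≫ 𝟙_ C ◁ q.inv) := by
    rw [← cancel_mono (𝟙_ C ◁ q.hom), ← cancel_mono (λ_ (𝟙_ C)).hom, Category.assoc,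
      Category.assoc, hc, Linear.smul_comp, Linear.smul_comp]
    simp
  refine ⟨c, fun h0 => S.coform_ne_zero x ?_, h⟩
  rw [← cancel_mono (β_ (x : C) (dual (x : C))).inv, ← cancel_mono (p.hom ▷ dual (x : C)), h, h0]
  simp

/-- The transpose of a morphism `x* ⟶ A`, for `x` isomorphic to `1`, in terms of coforms. -/
theorem coform_transpose_unit {x : S.Obj} {p : (x : C) ≅ 𝟙_ C} {q : dual (x : C) ≅ 𝟙_ C} {c : K}
    (hc : (S.pair x).η ≫ p.hom ▷ dual (x : C) = c • ((λ_ (𝟙_ C)).inv ≫ 𝟙_ C ◁ q.inv))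
    (P : DPair C) (f : dual (x : C) ⟶ P.ob) :
    P.η ≫ (S.transpose P x f ≫ p.hom) ▷ P.ob = (λ_ (𝟙_ C)).inv ≫ 𝟙_ C ◁ (c • (q.inv ≫ f)) := by
  have h : (S.pair x).η ≫ (x : C) ◁ f = P.η ≫ S.transpose P x f ▷ P.ob :=
    (DPair.isMate_mate (S.pair x) P f).η_comp
  have hx : (x : C) ◁ f ≫ p.hom ▷ P.ob = p.hom ▷ dual (x : C) ≫ 𝟙_ C ◁ f := whisker_exchange _ _
  rw [comp_whiskerRight, ← Category.assoc, ← h]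
  refine (Category.assoc _ _ _).trans ((congrArg ((S.pair x).η ≫ ·) hx).trans ?_)
  refine (Category.assoc _ _ _).symm.trans ((congrArg (· ≫ 𝟙_ C ◁ f) hc).trans ?_)
  rw [Linear.smul_comp, MonoidalLinear.whiskerLeft_smul, Linear.comp_smul, Category.assoc,
    MonoidalCategory.whiskerLeft_comp]

theorem coendMap_comp (P : DPair C) (x : S.Obj) {X Y : C} (p : (x : C) ⟶ X) (q : dual (x : C) ⟶ Y) :
    S.coendMap P x ≫ (p ⊗ₘ q) = ∑ i, (S.transpose P x (S.eps x P.ob i) ≫ p) ⊗ₘ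
      (S.eps' x P.ob i ≫ q) := by
  unfold coendMap
  rw [Preadditive.sum_comp]
  exact Finset.sum_congr rfl fun i _ => tensorHom_comp_tensorHom _ _ _ _

/-- Evaluating the component at the trivial object of the universal dinatural map gives the
partial trace. -/
theorem coendMap_trace {x : S.Obj} {p : (x : C) ≅ 𝟙_ C} {q : dual (x : C) ≅ 𝟙_ C} {c : K}
    (hc : (S.pair x).η ≫ p.hom ▷ dual (x : C) = c • ((λ_ (𝟙_ C)).inv ≫ 𝟙_ C ◁ q.inv))
    (P : DPair C) {C₁ O₁ V : C} (η₁ : 𝟙_ C ⟶ C₁ ⊗ O₁) (φ : P.ob ⊗ O₁ ⟶ P.ob ⊗ O₁)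
    (z : C₁ ⊗ O₁ ⟶ V) (t : V ⟶ 𝟙_ C) :
    coformTensor P.η η₁ ≫ (P.co ⊗ C₁) ◁ φ ≫ (tensorμ P.co C₁ P.ob O₁ ≫ (P.co ⊗ P.ob) ◁ z) ≫
        ((S.coendMap P x ≫ (p.hom ⊗ₘ q.hom) ≫ (λ_ (𝟙_ C)).hom) ⊗ₘ t) ≫ (λ_ (𝟙_ C)).hom =
      c • (η₁ ≫ C₁ ◁ ((λ_ O₁).inv ≫ (∑ i, (q.inv ≫ S.eps x P.ob i) ▷ O₁ ≫ φ ≫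
        (S.eps' x P.ob i ≫ q.hom) ▷ O₁) ≫ (λ_ O₁).hom) ≫ z ≫ t) := by
  have h := fun i => trace_step P.η η₁ φ z t (S.transpose P x (S.eps x P.ob i) ≫ p.hom)
      (S.eps' x P.ob i ≫ q.hom) _ (S.coform_transpose_unit hc P (S.eps x P.ob i))
  have e : S.coendMap P x ≫ (p.hom ⊗ₘ q.hom) ≫ (λ_ (𝟙_ C)).hom =
      ∑ i, ((S.transpose P x (S.eps x P.ob i) ≫ p.hom) ⊗ₘ (S.eps' x P.ob i ≫ q.hom)) ≫
        (λ_ (𝟙_ C)).hom := by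
    rw [← Category.assoc, coendMap_comp, Preadditive.sum_comp]
  rw [e, sum_tensorHom']
  simp only [Preadditive.sum_comp, Preadditive.comp_sum, whiskerLeft_sum, Finset.smul_sum]
  refine Finset.sum_congr rfl fun i _ => (h i).trans ?_
  simp only [MonoidalLinear.smul_whiskerRight, Linear.smul_comp, Linear.comp_smul,
    MonoidalLinear.whiskerLeft_smul]

theorem star_unit : S.star S.unit = S.unit := Subtype.ext S.dual_unit

/-- The end of the presentation takes the state of `φ` to its iterated trace. The factor `c ^ n`
arises because the coform of `1` need not be the canonical one. -/
theorem stateVec_unit {c : K}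
    (hc : (S.pair S.unit).η ≫ (Iso.refl (𝟙_ C)).hom ▷ dual (𝟙_ C) =
      c • ((λ_ (𝟙_ C)).inv ≫ 𝟙_ C ◁ (eqToIso S.dual_unit).inv)) :
    ∀ (n : ℕ) (P : Fin n → DPair C)
    (φ : tensorFin n (fun k => (P k).ob) ⟶ tensorFin n (fun k => (P k).ob)),
    S.stateVec P φ (fun _ => S.unit) ≫ (S.trivialIso n).inv =
      c ^ n • S.traceUnit n (fun k => (P k).ob) φ
  | 0, P, φ => by
    have h : ∀ (φ : 𝟙_ C ⟶ 𝟙_ C), ((λ_ (𝟙_ C)).inv ≫ 𝟙_ C ◁ φ ≫ (λ_ (𝟙_ C)).hom ≫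
        𝟙 (𝟙_ C)) ≫ 𝟙 (𝟙_ C) = φ := by
      intro φ; simp
    rw [pow_zero, one_smul]
    exact h φ
  | n + 1, P, φ => by
    have ih := stateVec_unit hc n (fun k => P k.succ)
    have h := S.coendMap_trace (x := S.unit) (p := Iso.refl (𝟙_ C)) (q := eqToIso S.dual_unit) hc
      (P 0) (coformFin n fun k => P k.succ) φ
      (interchange n (fun k => (P k.succ).co) (fun k => (P k.succ).ob))
      (tensorFinMap n (fun k => S.coendMap (P k.succ) S.unit) ≫ (S.trivialIso n).inv)
    have hp := S.partialTrace_eqToHom S.star_unit (P 0).ob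
      (tensorFin n (fun k => (P k.succ).ob)) φ
    have hh : ∀ {A B D' E' D₁ D₂ : C} (p : 𝟙_ C ⟶ A) (q : A ⟶ A) (r : A ⟶ B ⊗ D')
        (d : B ⟶ D₁ ⊗ D₂) (d' : D' ⟶ E') (i : D₁ ≅ 𝟙_ C) (i' : D₂ ≅ 𝟙_ C)
        (f' : E' ⟶ 𝟙_ C) (j : D₁ ⊗ D₂ ⟶ 𝟙_ C) (_ : j = (i.hom ⊗ₘ i'.hom) ≫ (λ_ (𝟙_ C)).hom),
        (p ≫ q ≫ r ≫ (d ⊗ₘ d')) ≫ (j ⊗ₘ f') ≫ (λ_ (𝟙_ C)).hom =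
        p ≫ q ≫ r ≫ ((d ≫ (i.hom ⊗ₘ i'.hom) ≫ (λ_ (𝟙_ C)).hom) ⊗ₘ (d' ≫ f')) ≫
          (λ_ (𝟙_ C)).hom := by
      intro A B D' E' D₁ D₂ p q r d d' i i' f' j hj
      subst hj
      simp
    have h1 : S.stateVec P φ (fun _ => S.unit) ≫ (S.trivialIso (n + 1)).inv = _ :=
      (hh (coformFin (n + 1) P) (_ ◁ φ) _ _ _ (Iso.refl (𝟙_ C)) (eqToIso S.dual_unit) _
        (𝟙_ C ◁ (eqToIso S.dual_unit).hom ≫ (λ_ (𝟙_ C)).hom) (by simp)).trans h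
    rw [h1, pow_succ', mul_smul]
    refine congrArg (c • ·) (Eq.trans ?_ (ih _))
    refine Eq.trans ?_ (Category.assoc _ _ _).symm
    refine congrArg (coformFin n (fun k => P k.succ) ≫ ·) ?_
    refine Eq.trans ?_ (Category.assoc _ _ _).symm
    refine congrArg₂ (fun s t => (_ ◁ ((λ_ _).inv ≫ s ≫ (λ_ _).hom)) ≫ t) hp ?_
    exact (Category.assoc _ _ _).symm

end Simples

end

/-! ### Comparison with the invariant -/

section

variable {K : Type w} [Field K] {C : Type u} [Category.{v} C] [Abelian C] [Linear K C]
  [MonoidalCategory C] [MonoidalPreadditive C] [MonoidalLinear K C]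
  [LeftRigidCategory C] [SymmetricCategory C] [Stable C]

namespace Simples

variable (S : Simples K C) {n : ℕ}

/-- After the words of a list of relations have been distributed over trivial pairs, the trace of
the resulting endomorphism is the corresponding summand of `Q(P)`. -/
theorem traceUnit_distribRels (L : List (Word n × S.Obj)) :
    S.traceUnit n (fun k => (S.famRels L (fun _ => DPair.unit) k).ob)
        ((S.distribRels L (fun _ => DPair.unit)).inv ≫
          (𝟙 (tensorFin n fun _ => 𝟙_ C) ⊗ₘ S.relsMor L) ≫
          (S.distribRels L (fun _ => DPair.unit)).hom) = S.invariantTerm L := by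
  obtain ⟨t, ht⟩ := S.exists_distribRels L (fun _ => DPair.unit)
  set w : ∀ k, (S.famRels L (fun _ => DPair.unit) k).ob ≅ S.relsGens L k :=
    fun k => t k ≪≫ λ_ (S.relsGens L k) with hw
  have hw1 : tensorFinMap n (fun k => (w k).hom) =
      tensorFinMap n (fun k => (t k).hom) ≫ tensorFinMap n (fun k => (λ_ (S.relsGens L k)).hom) :=
    (tensorFinMap_comp n (fun k => (t k).hom) (fun k => (λ_ (S.relsGens L k)).hom)).symm
  have hd : (S.distribRels L (fun _ => DPair.unit)).hom ≫ tensorFinMap n (fun k => (w k).hom) =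
      (unitIso n).inv ▷ _ ≫ (λ_ _).hom ≫ (S.relsPerm L).hom := by
    have step : ∀ {A B T D E F : C} (d : A ⟶ B) (m : B ⟶ D) (m' : D ⟶ F) (p : E ⟶ F)
        (i : T ⊗ F ⟶ D) (u : T ⟶ 𝟙_ C) (a : A ⟶ T ⊗ E) (_ : d ≫ m = a ≫ T ◁ p ≫ i)
        (_ : i ≫ m' = u ▷ F ≫ (λ_ F).hom),
        d ≫ m ≫ m' = a ≫ u ▷ E ≫ (λ_ E).hom ≫ p := by
      intro A B T D E F d m m' p i u a h1 h2
      rw [reassoc_of% h1, h2, whisker_exchange_assoc]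
      simp
    rw [hw1]
    exact (step _ _ _ _ _ _ (𝟙 _) (ht.trans (Category.id_comp _).symm)
      (interchange_leftUnitor n (S.relsGens L))).trans (Category.id_comp _)
  have hi : tensorFinMap n (fun k => (w k).hom) ≫ tensorFinMap n (fun k => (w k).inv) = 𝟙 _ := by
    rw [tensorFinMap_comp, ← tensorFinMap_id]; simp
  have hi' : tensorFinMap n (fun k => (w k).inv) ≫ tensorFinMap n (fun k => (w k).hom) = 𝟙 _ := by
    rw [tensorFinMap_comp, ← tensorFinMap_id]; simp
  rw [← S.traceUnit_conj n w]
  unfold invariantTerm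
  congr 1
  have step : ∀ {T A B D : C} (d : T ⊗ A ≅ B) (m : B ≅ D) (u : 𝟙_ C ≅ T) (p : A ≅ D) (f : A ⟶ A)
      (_ : d.hom ≫ m.hom = u.inv ▷ A ≫ (λ_ A).hom ≫ p.hom),
      m.inv ≫ (d.inv ≫ (𝟙 T ⊗ₘ f) ≫ d.hom) ≫ m.hom = p.inv ≫ f ≫ p.hom := by
    intro T A B D d m u p f h
    have h' : m.inv ≫ d.inv = p.inv ≫ (λ_ A).inv ≫ u.hom ▷ A := by
      have e : d ≪≫ m = whiskerRightIso u.symm A ≪≫ λ_ A ≪≫ p := Iso.ext h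
      simpa using congrArg Iso.inv e
    simp only [Category.assoc]
    rw [h, reassoc_of% h', id_tensorHom, ← whisker_exchange_assoc]
    simp
  exact step (S.distribRels L (fun _ => DPair.unit)) ⟨_, _, hi, hi'⟩ (unitIso n) (S.relsPerm L) _ hd

/-- A state supported at the trivial summand comes from `F(1, 1)`. -/
theorem beginPresentation_endPresentation (v : S.V n)
    (hv : ∀ y, y ≠ (fun _ => S.unit) → v y = 0) :
    S.beginPresentation n (S.endPresentation n v) = v := by
  classical
  funext y
  by_cases hy : y = fun _ => S.unit
  · subst hy
    simp [beginPresentation, endPresentation]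
  · rw [hv y hy]
    simp [beginPresentation, endPresentation, hy]

theorem tensorFinMap_eq_zero : ∀ (n : ℕ) {X Z : Fin n → C} (f : ∀ k, X k ⟶ Z k) (i : Fin n)
    (_ : f i = 0), tensorFinMap n f = 0
  | n + 1, _, _, f, ⟨0, _⟩, h => by
    refine (congrArg (· ⊗ₘ tensorFinMap n (fun k => f k.succ)) h).trans ?_
    exact MonoidalPreadditive.zero_tensor _
  | n + 1, _, _, f, ⟨i + 1, hi⟩, h => by
    refine (congrArg (f 0 ⊗ₘ ·) (tensorFinMap_eq_zero n (fun k => f k.succ)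
      ⟨i, Nat.lt_of_succ_lt_succ hi⟩ h)).trans ?_
    exact MonoidalPreadditive.tensor_zero _

/-- The state of the identity of a product of units is supported at the trivial summand. -/
theorem coendMap_unit_of_ne {y : S.Obj} (h : y ≠ S.unit) :
    S.coendMap (DPair.unit : DPair C) y = 0 := by
  refine Finset.sum_eq_zero fun i _ => ?_
  have h0 : S.eps' y (𝟙_ C) i = 0 := S.hom_eq_zero' (a := S.unit) (b := S.star y)
    (fun e => h (S.star_injective (e.symm.trans S.star_unit.symm))) _
  refine (congrArg (_ ⊗ₘ ·) h0).trans ?_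
  exact MonoidalPreadditive.tensor_zero _

/-- The map of the algorithm is determined by its value at `1`, which is computed from the state of
the identity of a product of units. -/
theorem quinnMap_eq {m : ℕ} (P : Presentation n m) : S.quinnMap P = S.Q P • LinearMap.id := by
  obtain ⟨c, hc0, hc⟩ := S.exists_coform_unit S.unit (Iso.refl (𝟙_ C)) (eqToIso S.dual_unit)
  set v := S.stateVec (fun _ : Fin n => (DPair.unit : DPair C)) (𝟙 _) with hv
  have he : ∀ (F : Fin n → DPair C) φ, S.endPresentation n (S.stateVec F φ) =
      c ^ n • S.traceUnit n (fun k => (F k).ob) φ := fun F φ => S.stateVec_unit hc n F φ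
  have hb : S.beginPresentation n (c ^ n • 𝟙 (𝟙_ C)) = v := by
    refine Eq.trans ?_ (S.beginPresentation_endPresentation v fun y hy => ?_)
    · refine congrArg _ ((he _ _).trans (congrArg (c ^ n • ·) (S.traceUnit_id n))).symm
    · obtain ⟨i, hi⟩ : ∃ i, y i ≠ S.unit := by
        by_contra hcon
        push Not at hcon
        exact hy (funext hcon)
      rw [hv]
      unfold stateVec
      rw [tensorFinMap_eq_zero n _ i (S.coendMap_unit_of_ne hi)]
      simp
  have hq : ∑ b : Fin m → S.Obj, S.invariantTerm (List.ofFn fun j => (P.rel j, b j)) =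
      S.Q P • 𝟙 (𝟙_ C) := (S.scalarEquiv.apply_symm_apply _).symm
  have h1 : S.quinnMap P (c ^ n • 𝟙 (𝟙_ C)) = c ^ n • S.Q P • 𝟙 (𝟙_ C) := by
    have e : S.quinnMap P (c ^ n • 𝟙 (𝟙_ C)) = S.endPresentation n
        (S.relationsMap (List.ofFn P.rel) (S.beginPresentation n (c ^ n • 𝟙 (𝟙_ C)))) := rfl
    rw [e, hb, hv, S.relationsMap_stateVec, map_sum, ← hq, Finset.smul_sum]
    refine Finset.sum_congr rfl fun b _ => ?_
    refine (he _ _).trans (congrArg (c ^ n • ·) ?_)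
    exact S.traceUnit_distribRels _
  rw [map_smul] at h1
  have h2 := smul_right_injective _ (pow_ne_zero n hc0) h1
  refine LinearMap.ext fun f => ?_
  obtain ⟨r, rfl⟩ := S.exists_smul_id_unit f
  rw [map_smul, h2, LinearMap.smul_apply, LinearMap.id_apply, smul_comm]

end Simples

end

end QuinnInvariant

end

open QuinnInvariant in
theorem mainTheorem2 {K : Type w} [Field K] {C : Type u} [Category.{v} C] [Abelian C]
    [Linear K C] [MonoidalCategory C] [MonoidalPreadditive C] [MonoidalLinear K C]
    [SymmetricCategory C] [LeftRigidCategory C] [Stable C] (S : Simples K C)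
    {n m : ℕ} (P : Presentation n m) :
    (∀ b : S.Obj, S.rank (b : C) ≠ 0) ∧
      (∀ b a : S.Obj, IsUnit (S.circulator b a)) ∧
      S.quinnMap P = S.Q P • LinearMap.id :=
  ⟨S.rank_ne_zero, S.isUnit_circulator, S.quinnMap_eq P⟩
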